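/- **Setting.** Forms and functions are smooth; $R$ is a real constant, and indices after a comma denote Wirtinger derivatives, with $\bar w_{,\zeta}=\partial_\zeta\bar w$. On a 3-manifold $\mathcal N$ consider a complex one-form $\mathbf M$ and a real one-form $\mathbf K$ with $\mathbf M\wedge\bar{\mathbf M}\wedge\mathbf K\neq 0$, one-forms $\Gamma_{ab}=-\Gamma_{ba}$ (complex conjugation exchanges the indices $1,2$), and complex functions $\Psi_0,\Psi_1,\Psi_2,\Psi_3$. The *null Einstein structure equations* with Ricci scalar $R$ are $$d\mathbf M=-\Gamma_{21}\wedge\mathbf M-\Gamma_{24}\wedge\mathbf K,\quad 0=\Gamma_{41}\wedge\mathbf M+\Gamma_{42}\wedge\bar{\mathbf M},\quad d\mathbf K=\Gamma_{31}\wedge\mathbf M+\Gamma_{32}\wedge\bar{\mathbf M}+\Gamma_{34}\wedge\mathbf K,$$ $$d\Gamma_{23}=(\Gamma_{12}+\Gamma_{34})\wedge\Gamma_{23}-\Psi_3\,\mathbf M\wedge\bar{\mathbf M}+(\Psi_2+\tfrac{R}{12})\mathbf K\wedge\mathbf M,$$ $$d\Gamma_{14}=\Gamma_{14}\wedge(\Gamma_{12}+\Gamma_{34})+\Psi_1\mathbf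 M\wedge\bar{\mathbf M}-\Psi_0\mathbf K\wedge\mathbf M,$$ $$\tfrac12 (d\Gamma_{12}+d\Gamma_{34})=\Gamma_{23}\wedge\Gamma_{14}+(\Psi_2-\tfrac{R}{24})\mathbf M\wedge\bar{\mathbf M}-\Psi_1\mathbf K\wedge\mathbf M .$$ Write $\Gamma_{41}=\sigma\mathbf M+\rho\bar{\mathbf M}+\kappa\mathbf K$. A gauge transformation with real $A>0$, real $\phi$ and complex $z$ is $\mathbf M'=e^{i\phi}\mathbf M$, $\mathbf K'=A(\mathbf K+z\bar{\mathbf M}+\bar z\mathbf M)$, together with $$\Gamma_{41}'=A^{-1}e^{-i\phi}\Gamma_{41},\qquad \Gamma_{23}'=Ae^{i\phi}\big(\Gamma_{23}+z(\Gamma_{12}+\Gamma_{34})-z^2\Gamma_{14}-dz\big),$$ $$(\Gamma_{12}+\Gamma_{34})'=\Gamma_{12}+\Gamma_{34}+2z\Gamma_{41}+d\ln A+i\,d\phi,$$ and $\Psi_0'=A^{-2}e^{-2i\phi}\Psi_0$, $\Psi_1'=A^{-1}e^{-i\phi}(\Psi_1-z\Psi_0)$, $\Psi_2'=\Psi_2-2z\Psi_1+z^2\Psi_0$,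 $\Psi_3'=Ae^{i\phi}(\Psi_3-3z\Psi_2+3z^2\Psi_1-z^3\Psi_0)$. **Proposition.** (a) Let $(\mathbf M,\bar{\mathbf M},\mathbf L,\mathbf K)$ be a null coframe, $g=2\mathbf M\bar{\mathbf M}-2\mathbf K\mathbf L$, on a four-dimensional spacetime, with connection forms and curvature given by the first and second Cartan structure equations, satisfying the Einstein equations with cosmological constant $\Lambda$ (vanishing traceless Ricci tensor, $R=4\Lambda$). Let $\iota:\mathcal N\to Q$ be an embedded null hypersurface in this spacetime $Q$ with $\iota^*\mathbf L=0$ and $\rho=\sigma=0$ along it. Then the pulled-back data solve the null Einstein structure equations with $R=4\Lambda$, and the conclusion of (b) holds for them. (b) Every solution of the null Einstein structure equations on $\mathcal N$ with $\rho=\sigma=0$ is, near every point, gauge equivalent to the following one. In suitable coordinates $(r,\zeta)$, with $r$ real and $\zeta$ complex, $$\mathbf M=e^w d\zeta,\qquad \mathbf K=dr+(X+r\bar w_{,\zeta})d\zeta+(\bar X+r w_{,\bar\zeta})d\bar\zeta .$$ With $\Gamma^b{}_c=\Gamma^b{}_{c1}\mathbf M+\Gamma^b{}_{c2}\bar{\mathbf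 M}+\Gamma^b{}_{c4}\mathbf K$ and $\Gamma_{12}=\Gamma^2{}_2$, $\Gamma_{34}=\Gamma^4{}_4$, $\Gamma_{23}=-\Gamma^4{}_2$, $\Gamma_{41}=-\Gamma^2{}_4$, $$\Gamma^2{}_{41}=\Gamma^2{}_{42}=\Gamma^2{}_{44}=0,\quad \Gamma^2{}_{21}=-\bar w_{,\zeta}e^{-w},\quad \Gamma^2{}_{22}=w_{,\bar\zeta}e^{-\bar w},\quad \Gamma^2{}_{24}=0,$$ $$\Gamma^4{}_{41}=-\bar w_{,\zeta}e^{-w},\quad \Gamma^4{}_{42}=-w_{,\bar\zeta}e^{-\bar w},\quad \Gamma^4{}_{44}=0,\quad \Gamma^4{}_{22}=\Gamma^4{}_{24}=0,$$ $$\Gamma^4{}_{21}=-\Big[\big(\tfrac R8e^w+\bar w_{,\zeta\bar\zeta}e^{-\bar w}\big)r+\big(S+\tfrac12(X_{,\bar\zeta}-\bar X_{,\zeta}+w_{,\bar\zeta}X-\bar w_{,\zeta}\bar X)\big)e^{-\bar w}\Big]e^{-w},$$ together with the complex conjugates, where $w,X$ are complex-valued and $S$ is a real-valued function of $(\zeta,\bar\zeta)$.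 The Weyl scalars are $\Psi_0=\Psi_1=0$, $\Psi_2=\frac R{24}+\bar w_{,\zeta\bar\zeta}e^{-(w+\bar w)}$ and $$\Psi_3=e^{-(w+\bar w)}\Big[\Big(\big(\tfrac R8e^w+\bar w_{,\zeta\bar\zeta}e^{-\bar w}\big)r+\tfrac12e^{-\bar w}\big(2S+X_{,\bar\zeta}-\bar X_{,\zeta}+w_{,\bar\zeta}X-\bar w_{,\zeta}\bar X\big)\Big)_{,\bar\zeta}-\big(\tfrac R8e^w+\bar w_{,\zeta\bar\zeta}e^{-\bar w}\big)(\bar X+r w_{,\bar\zeta})\Big].$$ (c) The functions are arbitrary: for every real constant $R$, all smooth complex $w,X$ and all smooth real $S$ on an open set $V\subseteq\mathbb C$, the formulas in (b) define, on $\mathbb R\times V$, a solution of the null Einstein structure equations with Ricci scalar $R$ and with $\rho=\sigma=0$. -/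

import Mathlib

open scoped Manifold ContDiff

noncomputable section

namespace NullHyp

/-! ### Complex-valued differential forms on manifolds -/

section Forms

/-- Complex-valued one-forms on a manifold `N` modelled on the real vector space `E`. -/
abbrev OneForm (E : Type*) [NormedAddCommGroup E] [NormedSpace ℝ E]
    (N : Type*) [TopologicalSpace N] [ChartedSpace E N] :=
  (p : N) → TangentSpace 𝓘(ℝ, E) p →L[ℝ] ℂ

/-- The complex conjugate of a complex-valued covector. -/
def conjCov {V : Type*} [AddCommGroup V] [Module ℝ V] [TopologicalSpace V]
    (a : V →L[ℝ] ℂ) : V →L[ℝ] ℂ :=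
  (Complex.conjCLE : ℂ →L[ℝ] ℂ).comp a

/-- The wedge product of two complex-valued covectors,
`(a ∧ b)(u, v) = a u * b v - a v * b u`. -/
def wedge {V : Type*} [AddCommGroup V] [Module ℝ V] [TopologicalSpace V]
    (a b : V →L[ℝ] ℂ) : V → V → ℂ :=
  fun u v => a u * b v - a v * b u

/-- Wedge product of covectors. -/
infixl:75 " ⋏ " => wedge

variable {E : Type*} [NormedAddCommGroup E] [NormedSpace ℝ E]
variable {N : Type*} [TopologicalSpace N] [ChartedSpace E N]
variable {E' : Type*} [NormedAddCommGroup E'] [NormedSpace ℝ E']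
variable {N' : Type*} [TopologicalSpace N'] [ChartedSpace E' N']

/-- The pull-back of a one-form by a map. -/
def pullForm (f : N → N') (α : OneForm E' N') : OneForm E N :=
  fun p => (α (f p)).comp (mfderiv 𝓘(ℝ, E) 𝓘(ℝ, E') f p)

/-- The expression of a one-form in a chart (a one-form on the model space,
meaningful on `Φ.target`). -/
def chartRep (Φ : OpenPartialHomeomorph N E) (α : OneForm E N) (x : E) : E →L[ℝ] ℂ :=
  (α (Φ.symm x)).comp (mfderiv 𝓘(ℝ, E) 𝓘(ℝ, E) Φ.symm x)

/-- Smoothness of a one-form on a set: its chart expressions are smooth. -/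
def SmoothFormOn (α : OneForm E N) (U : Set N) : Prop :=
  ∀ p ∈ U, ContDiffAt ℝ ∞ (chartRep (chartAt E p) α) (chartAt E p p)

/-- The exterior derivative of a one-form, computed in the preferred chart at the point. -/
def extD (α : OneForm E N) (p : N) :
    TangentSpace 𝓘(ℝ, E) p → TangentSpace 𝓘(ℝ, E) p → ℂ :=
  fun u v =>
    extDeriv
      (fun x : E => ContinuousAlternatingMap.ofSubsingleton ℝ E ℂ (0 : Fin 1)
        (chartRep (chartAt E p) α x))
      (chartAt E p p)
      ![(mfderiv 𝓘(ℝ, E) 𝓘(ℝ, E) (chartAt E p) p u : E),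
        (mfderiv 𝓘(ℝ, E) 𝓘(ℝ, E) (chartAt E p) p v : E)]

/-- The differential of a complex-valued function. -/
def dFun (f : N → ℂ) : OneForm E N :=
  fun p => mfderiv 𝓘(ℝ, E) 𝓘(ℝ, ℂ) f p

end Forms

/-! ### Coframe, connection forms and Weyl scalars -/

/-- The coframe elements `M` (complex), `K` (real), the connection one-forms and the Weyl scalars
that occur in the structure equations of a null hypersurface.  All forms are stored as
complex-valued ones; the reality conditions are imposed below.  The remaining connection forms are
determined by antisymmetry `Γ_ab = -Γ_ba` and by complex conjugation, which exchanges the indices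
`1` and `2`. -/
structure FrameData (E : Type*) [NormedAddCommGroup E] [NormedSpace ℝ E]
    (N : Type*) [TopologicalSpace N] [ChartedSpace E N] where
  M : OneForm E N
  K : OneForm E N
  Γ12 : OneForm E N
  Γ34 : OneForm E N
  Γ23 : OneForm E N
  Γ41 : OneForm E N
  Ψ0 : N → ℂ
  Ψ1 : N → ℂ
  Ψ2 : N → ℂ
  Ψ3 : N → ℂ

namespace FrameData

variable {E : Type*} [NormedAddCommGroup E] [NormedSpace ℝ E]
variable {N : Type*} [TopologicalSpace N] [ChartedSpace E N]
variable {E' : Type*} [NormedAddCommGroup E'] [NormedSpace ℝ E']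
variable {N' : Type*} [TopologicalSpace N'] [ChartedSpace E' N']

/-- The conjugate coframe element. -/
def Mbar (D : FrameData E N) : OneForm E N := fun p => conjCov (D.M p)
def Γ21 (D : FrameData E N) : OneForm E N := fun p => -D.Γ12 p
def Γ14 (D : FrameData E N) : OneForm E N := fun p => -D.Γ41 p
def Γ42 (D : FrameData E N) : OneForm E N := fun p => conjCov (D.Γ41 p)
def Γ24 (D : FrameData E N) : OneForm E N := fun p => -conjCov (D.Γ41 p)
def Γ32 (D : FrameData E N) : OneForm E N := fun p => -D.Γ23 p
def Γ31 (D : FrameData E N) : OneForm E N := fun p => -conjCov (D.Γ23 p)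
def Γ43 (D : FrameData E N) : OneForm E N := fun p => -D.Γ34 p
/-- The combination `Γ12 + Γ34`. -/
def Γs (D : FrameData E N) : OneForm E N := fun p => D.Γ12 p + D.Γ34 p

/-- All one-forms of the data are smooth on `U`. -/
def SmoothOn (D : FrameData E N) (U : Set N) : Prop :=
  SmoothFormOn D.M U ∧ SmoothFormOn D.K U ∧ SmoothFormOn D.Γ12 U ∧
  SmoothFormOn D.Γ34 U ∧ SmoothFormOn D.Γ23 U ∧ SmoothFormOn D.Γ41 U

/-- Reality conditions: `K` and `Γ34` are real, and `conj Γ12 = Γ21 = -Γ12`. -/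
def RealOn (D : FrameData E N) (U : Set N) : Prop :=
  ∀ p ∈ U, conjCov (D.K p) = D.K p ∧ conjCov (D.Γ34 p) = D.Γ34 p ∧
    conjCov (D.Γ12 p) = D.Γ21 p

/-- Pull-back of all forms and functions by a map. -/
def pullback (f : N → N') (D : FrameData E' N') : FrameData E N where
  M := pullForm f D.M
  K := pullForm f D.K
  Γ12 := pullForm f D.Γ12
  Γ34 := pullForm f D.Γ34
  Γ23 := pullForm f D.Γ23
  Γ41 := pullForm f D.Γ41
  Ψ0 := fun p => D.Ψ0 (f p)
  Ψ1 := fun p => D.Ψ1 (f p)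
  Ψ2 := fun p => D.Ψ2 (f p)
  Ψ3 := fun p => D.Ψ3 (f p)

/-- The data coincide at a point. -/
def AgreeAt (D D' : FrameData E N) (p : N) : Prop :=
  D.M p = D'.M p ∧ D.K p = D'.K p ∧ D.Γ12 p = D'.Γ12 p ∧ D.Γ34 p = D'.Γ34 p ∧
  D.Γ23 p = D'.Γ23 p ∧ D.Γ41 p = D'.Γ41 p ∧
  D.Ψ0 p = D'.Ψ0 p ∧ D.Ψ1 p = D'.Ψ1 p ∧ D.Ψ2 p = D'.Ψ2 p ∧ D.Ψ3 p = D'.Ψ3 p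

/-- `Γ41 = σ M + ρ Mbar + κ K` on `U`: shear `σ`, expansion `ρ`, and `κ`. -/
def HasOpticalScalarsOn (D : FrameData E N) (σ ρ κ : N → ℂ) (U : Set N) : Prop :=
  ∀ p ∈ U, D.Γ41 p = σ p • D.M p + ρ p • D.Mbar p + κ p • D.K p

/-- The first Cartan structure equations pulled back to a null hypersurface. -/
def NullCartanFirstOn (D : FrameData E N) (U : Set N) : Prop :=
  ∀ p ∈ U,
    extD D.M p = -(D.Γ21 p ⋏ D.M p) - D.Γ24 p ⋏ D.K p ∧
    0 = D.Γ41 p ⋏ D.M p + D.Γ42 p ⋏ D.Mbar p ∧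
    extD D.K p = D.Γ31 p ⋏ D.M p + D.Γ32 p ⋏ D.Mbar p + D.Γ34 p ⋏ D.K p

/-- The second Cartan structure equations of an Einstein spacetime with Ricci scalar `R`,
pulled back to a null hypersurface. -/
def NullCartanSecondEinsteinOn (D : FrameData E N) (R : ℝ) (U : Set N) : Prop :=
  ∀ p ∈ U,
    extD D.Γ23 p = D.Γs p ⋏ D.Γ23 p - D.Ψ3 p • (D.M p ⋏ D.Mbar p)
      + (D.Ψ2 p + (R : ℂ) / 12) • (D.K p ⋏ D.M p) ∧
    extD D.Γ14 p = D.Γ14 p ⋏ D.Γs p + D.Ψ1 p • (D.M p ⋏ D.Mbar p)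
      - D.Ψ0 p • (D.K p ⋏ D.M p) ∧
    (1 / 2 : ℂ) • (extD D.Γ12 p + extD D.Γ34 p) = D.Γ23 p ⋏ D.Γ14 p
      + (D.Ψ2 p - (R : ℂ) / 24) • (D.M p ⋏ D.Mbar p) - D.Ψ1 p • (D.K p ⋏ D.M p)

/-- A solution, on the subset `U` of a three-dimensional manifold, of the structure equations of a
null hypersurface in an Einstein spacetime with Ricci scalar `R`.  The non-degeneracy condition
says that the real and imaginary parts of `M`, together with `K`, are a basis of the cotangent
space, that is, `M ∧ Mbar ∧ K ≠ 0`. -/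
structure IsNullEinsteinSolutionOn {N₃ : Type*} [TopologicalSpace N₃] [ChartedSpace (ℝ × ℂ) N₃]
    (D : FrameData (ℝ × ℂ) N₃)
    (R : ℝ) (U : Set N₃) : Prop where
  smooth : D.SmoothOn U
  real : D.RealOn U
  nondegenerate : ∀ p ∈ U, ∀ v : TangentSpace 𝓘(ℝ, ℝ × ℂ) p, D.M p v = 0 → D.K p v = 0 → v = 0
  first : D.NullCartanFirstOn U
  second : D.NullCartanSecondEinsteinOn R U

/-- The frame transformation with parameters `A > 0`, `φ` real and `z` complex,
`M' = e^{iφ} M`, `K' = A (K + z Mbar + conj z M)`, with the induced transformations of the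
connection forms (the transformation of `Γ12 + Γ34` is split into its imaginary part `Γ12` and
its real part `Γ34`) and of the Weyl scalars. -/
def gauge (A φ : N → ℝ) (z : N → ℂ) (D : FrameData E N) : FrameData E N where
  M := fun p => Complex.exp (Complex.I * φ p) • D.M p
  K := fun p => (A p : ℂ) • (D.K p + z p • D.Mbar p + starRingEnd ℂ (z p) • D.M p)
  Γ12 := fun p => D.Γ12 p + z p • D.Γ41 p - starRingEnd ℂ (z p) • D.Γ42 p
    + Complex.I • dFun (fun q => (φ q : ℂ)) p
  Γ34 := fun p => D.Γ34 p + z p • D.Γ41 p + starRingEnd ℂ (z p) • D.Γ42 p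
    + dFun (fun q => (Real.log (A q) : ℂ)) p
  Γ23 := fun p => ((A p : ℂ) * Complex.exp (Complex.I * φ p)) •
    (D.Γ23 p + z p • D.Γs p - (z p) ^ 2 • D.Γ14 p - dFun z p)
  Γ41 := fun p => ((A p : ℂ) * Complex.exp (Complex.I * φ p))⁻¹ • D.Γ41 p
  Ψ0 := fun p => ((A p : ℂ) * Complex.exp (Complex.I * φ p))⁻¹ ^ 2 * D.Ψ0 p
  Ψ1 := fun p => ((A p : ℂ) * Complex.exp (Complex.I * φ p))⁻¹ * (D.Ψ1 p - z p * D.Ψ0 p)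
  Ψ2 := fun p => D.Ψ2 p - 2 * z p * D.Ψ1 p + (z p) ^ 2 * D.Ψ0 p
  Ψ3 := fun p => ((A p : ℂ) * Complex.exp (Complex.I * φ p)) *
    (D.Ψ3 p - 3 * z p * D.Ψ2 p + 3 * (z p) ^ 2 * D.Ψ1 p - (z p) ^ 3 * D.Ψ0 p)

end FrameData

/-! ### Four-dimensional spacetimes -/

/-- A null coframe `(M, Mbar, L, K)` on a four-dimensional spacetime with metric
`g = 2 M Mbar - 2 K L`, with connection forms, Weyl scalars `Ψ0, …, Ψ4`, traceless Ricci
components `S i j` and Ricci scalar `Rsc`.  The frame index `4` is the element `4 = 0` of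
`Fin 4`. -/
structure BulkData (Q : Type*) [TopologicalSpace Q] [ChartedSpace (EuclideanSpace ℝ (Fin 4)) Q]
    extends FrameData (EuclideanSpace ℝ (Fin 4)) Q where
  L : OneForm (EuclideanSpace ℝ (Fin 4)) Q
  Ψ4 : Q → ℂ
  S : Fin 4 → Fin 4 → Q → ℂ
  Rsc : Q → ℝ

namespace BulkData

variable {Q : Type*} [TopologicalSpace Q] [ChartedSpace (EuclideanSpace ℝ (Fin 4)) Q]

/-- The first Cartan structure equations (vanishing torsion of the metric connection). -/
def CartanFirst (B : BulkData Q) : Prop :=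
  ∀ p : Q,
    extD B.M p = -(B.Γ21 p ⋏ B.M p) - B.Γ23 p ⋏ B.L p - B.Γ24 p ⋏ B.K p ∧
    extD B.L p = B.Γ41 p ⋏ B.M p + B.Γ42 p ⋏ B.Mbar p + B.Γ43 p ⋏ B.L p ∧
    extD B.K p = B.Γ31 p ⋏ B.M p + B.Γ32 p ⋏ B.Mbar p + B.Γ34 p ⋏ B.K p

/-- The second Cartan structure equations: the curvature two-forms are decomposed into Weyl
scalars, traceless Ricci components and Ricci scalar. -/
def CartanSecond (B : BulkData Q) : Prop :=
  ∀ p : Q,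
    extD B.Γ23 p = B.Γs p ⋏ B.Γ23 p + B.Ψ4 p • (B.Mbar p ⋏ B.L p)
      + B.Ψ3 p • (B.K p ⋏ B.L p - B.M p ⋏ B.Mbar p)
      + (B.Ψ2 p + (B.Rsc p : ℂ) / 12) • (B.K p ⋏ B.M p)
      + (1 / 2 * B.S 3 3 p) • (B.M p ⋏ B.L p)
      + (1 / 2 * B.S 3 2 p) • (B.K p ⋏ B.L p + B.M p ⋏ B.Mbar p)
      + (1 / 2 * B.S 2 2 p) • (B.K p ⋏ B.Mbar p) ∧
    extD B.Γ14 p = B.Γ14 p ⋏ B.Γs p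
      + (-B.Ψ2 p - (B.Rsc p : ℂ) / 12) • (B.Mbar p ⋏ B.L p)
      - B.Ψ1 p • (B.K p ⋏ B.L p - B.M p ⋏ B.Mbar p)
      - B.Ψ0 p • (B.K p ⋏ B.M p)
      - (1 / 2 * B.S 1 1 p) • (B.M p ⋏ B.L p)
      - (1 / 2 * B.S 4 1 p) • (B.K p ⋏ B.L p + B.M p ⋏ B.Mbar p)
      - (1 / 2 * B.S 4 4 p) • (B.K p ⋏ B.Mbar p) ∧
    (1 / 2 : ℂ) • (extD B.Γ12 p + extD B.Γ34 p) = B.Γ23 p ⋏ B.Γ14 p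
      - B.Ψ3 p • (B.Mbar p ⋏ B.L p)
      - (B.Ψ2 p - (B.Rsc p : ℂ) / 24) • (B.K p ⋏ B.L p - B.M p ⋏ B.Mbar p)
      - B.Ψ1 p • (B.K p ⋏ B.M p)
      - (1 / 2 * B.S 3 1 p) • (B.M p ⋏ B.L p)
      - (1 / 4 * (B.S 1 2 p + B.S 3 4 p)) • (B.K p ⋏ B.L p + B.M p ⋏ B.Mbar p)
      - (1 / 2 * B.S 4 2 p) • (B.K p ⋏ B.Mbar p)

/-- `B` is a smooth null coframe with its Levi-Civita connection forms and the components of its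
curvature. -/
structure IsSpacetime (B : BulkData Q) : Prop where
  smooth : B.toFrameData.SmoothOn Set.univ
  smooth_L : SmoothFormOn B.L Set.univ
  real : B.toFrameData.RealOn Set.univ
  real_L : ∀ p, conjCov (B.L p) = B.L p
  nondegenerate : ∀ (p : Q) (v : TangentSpace 𝓘(ℝ, EuclideanSpace ℝ (Fin 4)) p),
    B.M p v = 0 → B.L p v = 0 → B.K p v = 0 → v = 0
  first : B.CartanFirst
  second : B.CartanSecond

/-- The vacuum Einstein equations with cosmological constant `Λ`: the traceless Ricci tensor
vanishes and the Ricci scalar is `4 Λ`. -/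
def IsEinstein (B : BulkData Q) (Λ : ℝ) : Prop :=
  (∀ i j p, B.S i j p = 0) ∧ ∀ p, B.Rsc p = 4 * Λ

/-- An embedded null hypersurface to which the null coframe is adapted: `ι* L = 0`. -/
def IsNullHypersurface {N : Type*} [TopologicalSpace N] [ChartedSpace (ℝ × ℂ) N]
    (B : BulkData Q) (ι : N → Q) : Prop :=
  Manifold.IsSmoothEmbedding 𝓘(ℝ, ℝ × ℂ) 𝓘(ℝ, EuclideanSpace ℝ (Fin 4)) ∞ ι ∧
  ∀ p : N, pullForm (E := ℝ × ℂ) ι B.L p = 0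

end BulkData

/-! ### The normal form -/

/-- The Wirtinger derivative `f_{,ζ}`. -/
def dz (f : ℂ → ℂ) (ζ : ℂ) : ℂ :=
  (fderiv ℝ f ζ 1 - Complex.I * fderiv ℝ f ζ Complex.I) / 2

/-- The Wirtinger derivative `f_{,ζbar}`. -/
def dzbar (f : ℂ → ℂ) (ζ : ℂ) : ℂ :=
  (fderiv ℝ f ζ 1 + Complex.I * fderiv ℝ f ζ Complex.I) / 2

/-- The complex conjugate of a function. -/
def cbar (f : ℂ → ℂ) : ℂ → ℂ := fun ζ => starRingEnd ℂ (f ζ)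

/-- The coordinate differentials on `ℝ × ℂ`, with coordinates `(r, ζ)`. -/
def dr : ℝ × ℂ →L[ℝ] ℂ := Complex.ofRealCLM.comp (ContinuousLinearMap.fst ℝ ℝ ℂ)
def dζ : ℝ × ℂ →L[ℝ] ℂ := ContinuousLinearMap.snd ℝ ℝ ℂ
def dζbar : ℝ × ℂ →L[ℝ] ℂ := conjCov dζ

/-- `M = e^w dζ`. -/
def normalM (w : ℂ → ℂ) : OneForm (ℝ × ℂ) (ℝ × ℂ) :=
  fun x => (Complex.exp (w x.2) • dζ : ℝ × ℂ →L[ℝ] ℂ)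

/-- `K = dr + (X + r wbar_{,ζ}) dζ + (Xbar + r w_{,ζbar}) dζbar`. -/
def normalK (w X : ℂ → ℂ) : OneForm (ℝ × ℂ) (ℝ × ℂ) :=
  fun x => (dr + (X x.2 + x.1 * dz (cbar w) x.2) • dζ
    + (cbar X x.2 + x.1 * dzbar w x.2) • dζbar : ℝ × ℂ →L[ℝ] ℂ)

/-- The one-form `a₁ M + a₂ Mbar + a₄ K` with components `a₁, a₂, a₄` in the normal-form
coframe. -/
def normalComb (w X : ℂ → ℂ) (a₁ a₂ a₄ : ℝ × ℂ → ℂ) : OneForm (ℝ × ℂ) (ℝ × ℂ) :=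
  fun x => a₁ x • normalM w x + a₂ x • conjCov (normalM w x) + a₄ x • normalK w X x

/-- `(R/8) e^w + wbar_{,ζ ζbar} e^{-wbar}`. -/
def coefC (R : ℝ) (w : ℂ → ℂ) (ζ : ℂ) : ℂ :=
  (R : ℂ) / 8 * Complex.exp (w ζ) + dzbar (dz (cbar w)) ζ * Complex.exp (-cbar w ζ)

/-- `X_{,ζbar} - Xbar_{,ζ} + w_{,ζbar} X - wbar_{,ζ} Xbar`. -/
def coefT (w X : ℂ → ℂ) (ζ : ℂ) : ℂ :=
  dzbar X ζ - dz (cbar X) ζ + dzbar w ζ * X ζ - dz (cbar w) ζ * cbar X ζ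

/-- The normal form with free functions `w, X` (complex) and `S` (real), on the space `ℝ × ℂ` with
coordinates `(r, ζ)`.  The connection forms are given through their coefficients
`Γ^b_c = Γ^b_{c1} M + Γ^b_{c2} Mbar + Γ^b_{c4} K`, where
`Γ12 = Γ^2_2`, `Γ34 = Γ^4_4`, `Γ23 = -Γ^4_2`, `Γ41 = -Γ^2_4`. -/
def normalForm (R : ℝ) (w X : ℂ → ℂ) (S : ℂ → ℝ) : FrameData (ℝ × ℂ) (ℝ × ℂ) where
  M := normalM w
  K := normalK w X
  Γ12 := normalComb w X
    (fun x => -(dz (cbar w) x.2 * Complex.exp (-w x.2)))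
    (fun x => dzbar w x.2 * Complex.exp (-cbar w x.2))
    (fun _ => 0)
  Γ34 := normalComb w X
    (fun x => -(dz (cbar w) x.2 * Complex.exp (-w x.2)))
    (fun x => -(dzbar w x.2 * Complex.exp (-cbar w x.2)))
    (fun _ => 0)
  Γ23 := fun x => -normalComb w X
    (fun x => -((coefC R w x.2 * x.1
      + ((S x.2 : ℂ) + 1 / 2 * coefT w X x.2) * Complex.exp (-cbar w x.2))
        * Complex.exp (-w x.2)))
    (fun _ => 0) (fun _ => 0) x
  Γ41 := fun x => -normalComb w X (fun _ => 0) (fun _ => 0) (fun _ => 0) x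
  Ψ0 := fun _ => 0
  Ψ1 := fun _ => 0
  Ψ2 := fun x => (R : ℂ) / 24
    + dzbar (dz (cbar w)) x.2 * Complex.exp (-(w x.2 + cbar w x.2))
  Ψ3 := fun x => Complex.exp (-(w x.2 + cbar w x.2)) *
    (dzbar (fun ζ => coefC R w ζ * x.1
        + 1 / 2 * Complex.exp (-cbar w ζ) * (2 * (S ζ : ℂ) + coefT w X ζ)) x.2
      - coefC R w x.2 * (cbar X x.2 + x.1 * dzbar w x.2))

/-- Near `p`, the data `D` are gauge equivalent to a normal form: there are coordinates
`Φ = (r, ζ)` around `p`, a smooth frame transformation on the coordinate domain, and smooth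
functions `w, X, S` of `ζ` on an open set containing all values of `ζ`, such that the transformed
data are the normal form expressed in the coordinates `Φ`. -/
def GaugeEquivNormalFormNear {N : Type*} [TopologicalSpace N] [ChartedSpace (ℝ × ℂ) N]
    (D : FrameData (ℝ × ℂ) N) (R : ℝ) (p : N) : Prop :=
  ∃ Φ ∈ IsManifold.maximalAtlas 𝓘(ℝ, ℝ × ℂ) ∞ N, p ∈ Φ.source ∧
  ∃ (A φ : N → ℝ) (z : N → ℂ),
    ContMDiffOn 𝓘(ℝ, ℝ × ℂ) 𝓘(ℝ, ℝ) ∞ A Φ.source ∧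
    ContMDiffOn 𝓘(ℝ, ℝ × ℂ) 𝓘(ℝ, ℝ) ∞ φ Φ.source ∧
    ContMDiffOn 𝓘(ℝ, ℝ × ℂ) 𝓘(ℝ, ℂ) ∞ z Φ.source ∧
    (∀ q ∈ Φ.source, 0 < A q) ∧
  ∃ (V : Set ℂ) (w X : ℂ → ℂ) (S : ℂ → ℝ),
    IsOpen V ∧ (∀ x ∈ Φ.target, x.2 ∈ V) ∧
    ContDiffOn ℝ ∞ w V ∧ ContDiffOn ℝ ∞ X V ∧ ContDiffOn ℝ ∞ S V ∧
    ∀ q ∈ Φ.source,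
      (D.gauge A φ z).AgreeAt ((normalForm R w X S).pullback Φ) q

end NullHyp

end

/-!
# Null hypersurfaces without shear and expansion in Einstein spacetimes

All three parts rest on a description of the solutions with `σ = ρ = 0`. Then `Γ41 = κ K`, and the
equation `0 = Γ41 ∧ M + Γ42 ∧ M̄` forces `κ = 0`; with `Γ41 = 0` the equation for `dΓ14` gives
`Ψ0 = Ψ1 = 0`. In a chart what remains is a `ReducedData` (`exists_reducedData_of_solution`), a
system on `ℝ × ℂ` in which `d` is an antisymmetrised derivative, `curl`.

*Normal form.* The kernel of `M` is a line field; in flow coordinates it is spanned by `∂/∂r`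
(`exists_flow_box`). Since `dM = Γ12 ∧ M`, the Lie derivative of `M` along `∂/∂r` is a multiple of
`M`, so the ratio of the `dζbar` and `dζ` coefficients of `M` does not depend on `r`. A solution of
the Beltrami equation with this coefficient is a new coordinate `ζ` with `M` proportional to `dζ`
(`exists_isothermal_coordinates`). Now `d(Γ12 + Γ34)` and `dΓ23` satisfy exactly the compatibility
conditions under which gauge parameters `h` (with `A e^{iφ} = e^h`) and `z` make `Γ12 + Γ34` and
`Γ23` multiples of `dζ` (`exists_gauge`), and `r` may be replaced by a primitive of `K(∂/∂r)`
(`gaugeEquiv_of_isothermal`). After these normalisations the structure equations are ordinary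
differential equations in `r` with affine solutions, together with constraints at `r = 0`, and they
leave precisely the functions `w`, `X`, `S` free (`agreeAt_reducedNormalForm`).

*Arbitrariness of the functions.* The same equations, read backwards, are identities in the Wirtinger
derivatives of `w`, `X`, `S` (`isSolutionOn_reducedNormalForm`).

*Spacetimes.* Exterior derivatives commute with pull-back (`extD_pullForm`). On a hypersurface where
`L` pulls back to zero, the Cartan equations of an Einstein spacetime lose all terms in `L` and in
the traceless Ricci tensor and become the null Einstein structure equations
(`BulkData.isNullEinsteinSolutionOn_pullback`).

*Analysis.* The Beltrami equation is solved near a point where the coefficient `μ` vanishes: rescaling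
and composing with a periodic map that is the identity near `0` turns `μ` into a smooth function on
the torus whose Fourier coefficients have small `ℓ¹`-norm, and a Neumann series converges in all the
weighted `ℓ¹`-norms that encode smoothness (`exists_beltrami_solution`). Smooth dependence of flows
on initial values comes from the inverse function theorem in a space of curves
(`exists_smooth_flow`).
-/

noncomputable section

namespace NullHyp

open scoped ENNReal NNReal Real

/-! ### Fourier series with rapidly decreasing coefficients -/

/-- The frequencies of a Fourier series on the plane `ℂ = ℝ²`. -/
abbrev Freq := Fin 2 → ℤ

/-- The weight `(1 + δ ‖n‖)^k` on frequencies. -/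
def weight (δ : ℝ≥0) (k : ℕ) (n : Freq) : ℝ≥0∞ := ((1 + δ * ‖n‖₊) ^ k : ℝ≥0)

/-- The weighted `ℓ¹`-norm of a family of Fourier coefficients. -/
def wnorm (δ : ℝ≥0) (k : ℕ) (c : Freq → ℂ) : ℝ≥0∞ := ∑' n, ‖c n‖ₑ * weight δ k n

/-- All the polynomially weighted `ℓ¹`-norms are finite. -/
def RapidDecay (c : Freq → ℂ) : Prop := ∀ k, wnorm 1 k c ≠ ⊤

lemma weight_zero (δ : ℝ≥0) (n : Freq) : weight δ 0 n = 1 := by simp [weight]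

lemma weight_add (k l : ℕ) (n : Freq) : weight 1 (k + l) n = weight 1 k n * weight 1 l n := by
  simp [weight, pow_add]

lemma weight_add_le (δ : ℝ≥0) (k : ℕ) (m n : Freq) :
    weight δ k (m + n) ≤ weight δ k m * weight δ k n := by
  unfold weight
  rw [← ENNReal.coe_mul, ENNReal.coe_le_coe, ← mul_pow]
  gcongr
  calc 1 + δ * ‖m + n‖₊ ≤ 1 + δ * (‖m‖₊ + ‖n‖₊) := by gcongr; exact nnnorm_add_le _ _
    _ ≤ 1 + δ * (‖m‖₊ + ‖n‖₊) + δ * ‖m‖₊ * (δ * ‖n‖₊) := le_self_add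
    _ = (1 + δ * ‖m‖₊) * (1 + δ * ‖n‖₊) := by ring

/-- A coefficientwise bound with polynomial loss preserves rapid decay. -/
lemma RapidDecay.of_le {c c' : Freq → ℂ} (hc : RapidDecay c) (C : ℝ≥0) (j : ℕ)
    (h : ∀ n, ‖c' n‖ₑ ≤ C * (‖c n‖ₑ * weight 1 j n)) : RapidDecay c' := by
  intro k
  refine ne_top_of_le_ne_top (ENNReal.mul_ne_top (ENNReal.coe_ne_top (r := C)) (hc (j + k))) ?_
  unfold wnorm
  rw [← ENNReal.tsum_mul_left]
  refine ENNReal.tsum_le_tsum fun n => ?_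
  rw [weight_add]
  calc ‖c' n‖ₑ * weight 1 k n ≤ C * (‖c n‖ₑ * weight 1 j n) * weight 1 k n := by gcongr; exact h n
    _ = _ := by ring

lemma RapidDecay.summable {c : Freq → ℂ} (hc : RapidDecay c) : Summable fun n => ‖c n‖ := by
  rw [← tsum_enorm_ne_top_iff_summable_norm]
  simpa [wnorm, weight_zero] using hc 0

/-- The convolution of two families of Fourier coefficients. -/
def conv (a b : Freq → ℂ) (n : Freq) : ℂ := ∑' m, a m * b (n - m)

lemma wnorm_conv_le (δ : ℝ≥0) (k : ℕ) (a b : Freq → ℂ) :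
    wnorm δ k (conv a b) ≤ wnorm δ k a * wnorm δ k b := by
  calc wnorm δ k (conv a b)
      ≤ ∑' n, ∑' m, (‖a m‖ₑ * weight δ k m) * (‖b (n - m)‖ₑ * weight δ k (n - m)) := by
        refine ENNReal.tsum_le_tsum fun n => ?_
        calc ‖conv a b n‖ₑ * weight δ k n ≤ (∑' m, ‖a m * b (n - m)‖ₑ) * weight δ k n := by
              gcongr; exact enorm_tsum_le_tsum_enorm
          _ = ∑' m, ‖a m * b (n - m)‖ₑ * weight δ k n := ENNReal.tsum_mul_right.symm
          _ ≤ _ := by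
            refine ENNReal.tsum_le_tsum fun m => ?_
            have := weight_add_le δ k m (n - m)
            rw [add_sub_cancel] at this
            calc ‖a m * b (n - m)‖ₑ * weight δ k n
                ≤ (‖a m‖ₑ * ‖b (n - m)‖ₑ) * (weight δ k m * weight δ k (n - m)) := by
                  rw [enorm_mul]; gcongr
              _ = _ := by ring
    _ = ∑' m, ∑' n, (‖a m‖ₑ * weight δ k m) * (‖b (n - m)‖ₑ * weight δ k (n - m)) :=
        ENNReal.tsum_comm
    _ = ∑' m, (‖a m‖ₑ * weight δ k m) * wnorm δ k b := by
        refine tsum_congr fun m => ?_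
        rw [ENNReal.tsum_mul_left]
        congr 1
        exact (Equiv.subRight m).tsum_eq (fun n => ‖b n‖ₑ * weight δ k n)
    _ = wnorm δ k a * wnorm δ k b := ENNReal.tsum_mul_right

/-- The real part, as a complex-valued covector on `ℂ`. -/
def reL : ℂ →L[ℝ] ℂ := Complex.ofRealCLM.comp Complex.reCLM

/-- The imaginary part, as a complex-valued covector on `ℂ`. -/
def imL : ℂ →L[ℝ] ℂ := Complex.ofRealCLM.comp Complex.imCLM

lemma reL_apply (z : ℂ) : reL z = (z.re : ℂ) := rfl
lemma imL_apply (z : ℂ) : imL z = (z.im : ℂ) := rfl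

/-- The phase `2πi (n₀ x + n₁ y)` of a Fourier mode on the plane. -/
def phase (n : Freq) : ℂ →L[ℝ] ℂ :=
  (2 * π * Complex.I * n 0) • reL + (2 * π * Complex.I * n 1) • imL

lemma phase_apply (n : Freq) (z : ℂ) :
    phase n z = 2 * π * Complex.I * n 0 * z.re + 2 * π * Complex.I * n 1 * z.im := by
  simp [phase, reL_apply, imL_apply]

/-- The Fourier mode with frequency `n`. -/
def mode (n : Freq) (z : ℂ) : ℂ := Complex.exp (phase n z)

lemma norm_mode (n : Freq) (z : ℂ) : ‖mode n z‖ = 1 := by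
  have : phase n z = ((2 * π * (n 0 * z.re + n 1 * z.im) : ℝ) : ℂ) * Complex.I := by
    rw [phase_apply]; push_cast; ring
  rw [mode, this, Complex.norm_exp_ofReal_mul_I]

lemma mode_add (m n : Freq) (z : ℂ) : mode (m + n) z = mode m z * mode n z := by
  rw [mode, mode, mode, ← Complex.exp_add, phase_apply, phase_apply, phase_apply]
  congr 1
  simp only [Pi.add_apply, Int.cast_add]
  ring

lemma hasFDerivAt_mode (n : Freq) (z : ℂ) : HasFDerivAt (mode n) (mode n z • phase n) z :=
  (phase n).hasFDerivAt.cexp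

/-- The Fourier series with coefficients `c`. -/
def series (c : Freq → ℂ) (z : ℂ) : ℂ := ∑' n, c n * mode n z

/-- The Fourier coefficients of a partial derivative. -/
def coeffD (j : Fin 2) (c : Freq → ℂ) (n : Freq) : ℂ := 2 * π * Complex.I * n j * c n

lemma RapidDecay.summable_mul_mode {c : Freq → ℂ} (hc : RapidDecay c) (z : ℂ) :
    Summable fun n => c n * mode n z :=
  .of_norm (by simpa [norm_mode] using hc.summable)

lemma enorm_coeffD_le (j : Fin 2) (c : Freq → ℂ) (n : Freq) :
    ‖coeffD j c n‖ₑ ≤ (2 * NNReal.pi) * (‖c n‖ₑ * weight 1 1 n) := by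
  have h : ‖(n j : ℂ)‖₊ ≤ 1 + 1 * ‖n‖₊ := by
    have h1 : ‖(n j : ℂ)‖₊ = ‖n j‖₊ := by
      rw [← NNReal.coe_inj]; simp [Int.norm_eq_abs]
    rw [h1, one_mul]
    exact (nnnorm_le_pi_nnnorm n j).trans (le_add_self)
  have h2 : ‖((2 * π : ℝ) : ℂ)‖₊ = 2 * NNReal.pi := by
    rw [← NNReal.coe_inj]; simp [Real.pi_pos.le]
  unfold coeffD weight
  simp only [enorm_eq_nnnorm]
  norm_cast
  rw [nnnorm_mul, nnnorm_mul, nnnorm_mul, h2]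
  simp only [Complex.nnnorm_I, pow_one]
  calc _ ≤ 2 * NNReal.pi * 1 * (1 + 1 * ‖n‖₊) * ‖c n‖₊ := by gcongr
    _ = _ := by ring

lemma RapidDecay.coeffD {c : Freq → ℂ} (hc : RapidDecay c) (j : Fin 2) :
    RapidDecay (coeffD j c) :=
  hc.of_le (2 * NNReal.pi) 1 fun n => by simpa using enorm_coeffD_le j c n

lemma RapidDecay.hasFDerivAt_series {c : Freq → ℂ} (hc : RapidDecay c) (z : ℂ) :
    HasFDerivAt (series c)
      (series (NullHyp.coeffD 0 c) z • reL + series (NullHyp.coeffD 1 c) z • imL) z := by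
  have h0 := hc.coeffD 0
  have h1 := hc.coeffD 1
  have hu := (h0.summable.mul_right ‖reL‖).add (h1.summable.mul_right ‖imL‖)
  have hd : ∀ (n : Freq) (x : ℂ), HasFDerivAt (fun x => c n * mode n x)
      ((NullHyp.coeffD 0 c n * mode n x) • reL + (NullHyp.coeffD 1 c n * mode n x) • imL) x := by
    intro n x
    refine ((hasFDerivAt_mode n x).const_mul (c n)).congr_fderiv ?_
    ext v
    simp [phase, NullHyp.coeffD]
    ring
  have key := hasFDerivAt_tsum hu hd (fun n x => ?_) (hc.summable_mul_mode z) z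
  · rw [((h0.summable_mul_mode z).smul_const reL).tsum_add
      ((h1.summable_mul_mode z).smul_const imL), (h0.summable_mul_mode z).tsum_smul_const,
      (h1.summable_mul_mode z).tsum_smul_const] at key
    exact key
  · refine (norm_add_le _ _).trans (le_of_eq ?_)
    simp [norm_smul, norm_mode]

lemma RapidDecay.contDiff_series {c : Freq → ℂ} (hc : RapidDecay c) :
    ContDiff ℝ ∞ (series c) := by
  rw [contDiff_infty]
  intro k
  induction k generalizing c with
  | zero =>
    exact contDiff_zero.2 (continuous_iff_continuousAt.2 fun z =>
      (hc.hasFDerivAt_series z).continuousAt)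
  | succ k ih =>
    push_cast
    rw [contDiff_succ_iff_fderiv]
    refine ⟨fun z => (hc.hasFDerivAt_series z).differentiableAt, by simp, ?_⟩
    rw [show fderiv ℝ (series c) = fun z => series (NullHyp.coeffD 0 c) z • reL
      + series (NullHyp.coeffD 1 c) z • imL from funext fun z => (hc.hasFDerivAt_series z).fderiv]
    exact ((ih (hc.coeffD 0)).smul contDiff_const).add ((ih (hc.coeffD 1)).smul contDiff_const)

lemma series_conv {a b : Freq → ℂ} (ha : RapidDecay a) (hb : RapidDecay b) (z : ℂ) :
    series (conv a b) z = series a z * series b z := by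
  have ha' : Summable fun n => ‖a n * mode n z‖ := by simpa [norm_mode] using ha.summable
  have hb' : Summable fun n => ‖b n * mode n z‖ := by simpa [norm_mode] using hb.summable
  unfold series
  have hs := summable_mul_of_summable_norm ha' hb'
  rw [tsum_mul_tsum_of_summable_norm ha' hb']
  let e : Freq × Freq ≃ Freq × Freq :=
    { toFun := fun p => (p.2, p.1 - p.2), invFun := fun p => (p.1 + p.2, p.1)
      left_inv := fun p => by simp, right_inv := fun p => by simp }
  have hs' : Summable fun p : Freq × Freq =>
      a (e p).1 * mode (e p).1 z * (b (e p).2 * mode (e p).2 z) := (e.summable_iff).2 hs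
  rw [← e.tsum_eq, hs'.tsum_prod]
  refine tsum_congr fun n => ?_
  rw [conv, ← tsum_mul_right]
  refine tsum_congr fun m => ?_
  have : mode n z = mode m z * mode (n - m) z := by rw [← mode_add, add_sub_cancel]
  simp only [e, Equiv.coe_fn_mk]
  rw [this]; ring

/-! ### The Beltrami equation on the torus -/

lemma one_add_mul_pow_add_le (δ x : ℝ≥0) (hδ : δ ≤ 1) (k : ℕ) :
    (1 + δ * x) ^ k + δ ≤ 1 + δ * (1 + x) ^ k := by
  induction k with
  | zero => simp
  | succ k ih =>
    have h1 : (1 : ℝ≥0) ≤ (1 + x) ^ k := one_le_pow₀ le_self_add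
    rw [← NNReal.coe_le_coe] at ih h1 hδ ⊢
    push_cast at ih h1 hδ ⊢
    have hx := x.coe_nonneg
    have hd := δ.coe_nonneg
    rw [pow_succ, pow_succ]
    have h2 := mul_le_mul_of_nonneg_right ih (by positivity : (0 : ℝ) ≤ 1 + δ * x)
    have h3 : 0 ≤ (δ : ℝ) * x * (((1 + x : ℝ)) ^ k - 1) * (1 - δ) :=
      mul_nonneg (mul_nonneg (mul_nonneg hd hx) (by linarith)) (by linarith)
    nlinarith

lemma wnorm_le_add (δ : ℝ≥0) (hδ : δ ≤ 1) (k : ℕ) (a : Freq → ℂ) :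
    wnorm δ k a ≤ wnorm 1 0 a + δ * wnorm 1 k a := by
  unfold wnorm
  rw [← ENNReal.tsum_mul_left, ← ENNReal.tsum_add]
  refine ENNReal.tsum_le_tsum fun n => ?_
  have h : weight δ k n ≤ 1 + δ * weight 1 k n := by
    unfold weight
    norm_cast
    rw [one_mul]
    exact le_self_add.trans (one_add_mul_pow_add_le δ ‖n‖₊ hδ k)
  rw [weight_zero]
  calc ‖a n‖ₑ * weight δ k n ≤ ‖a n‖ₑ * (1 + δ * weight 1 k n) := by gcongr
    _ = _ := by ring

/-- Lowering the slope of the weight brings a weighted norm as close to the unweighted one as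
desired; in particular a small unweighted norm makes suitable weighted norms small. -/
lemma RapidDecay.exists_wnorm_lt_one {a : Freq → ℂ} (ha : RapidDecay a) (h1 : wnorm 1 0 a < 1)
    (k : ℕ) : ∃ δ : ℝ≥0, 0 < δ ∧ δ ≤ 1 ∧ wnorm δ k a < 1 := by
  have ht : Filter.Tendsto (fun δ : ℝ≥0 => wnorm 1 0 a + δ * wnorm 1 k a) (nhds 0)
      (nhds (wnorm 1 0 a + (0 : ℝ≥0) * wnorm 1 k a)) := by
    refine tendsto_const_nhds.add (ENNReal.Tendsto.mul_const ?_ (Or.inr (ha k)))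
    exact ENNReal.tendsto_coe.2 Filter.tendsto_id
  have hev := ht.eventually_lt_const (u := 1) (by simpa using h1)
  have hev' := (hev.and ((Iic_mem_nhds (one_pos (α := ℝ≥0)) : ∀ᶠ δ in nhds (0 : ℝ≥0), δ ≤ 1))).filter_mono
    (nhdsWithin_le_nhds (s := Set.Ioi 0))
  obtain ⟨δ, ⟨h2, h3⟩, h4⟩ := (hev'.and self_mem_nhdsWithin).exists
  exact ⟨δ, h4, h3, (wnorm_le_add δ h3 k a).trans_lt h2⟩

lemma wnorm_mono {δ : ℝ≥0} (hδ : δ ≤ 1) (k : ℕ) (a : Freq → ℂ) : wnorm δ k a ≤ wnorm 1 k a := by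
  refine ENNReal.tsum_le_tsum fun n => ?_
  unfold weight
  gcongr

lemma wnorm_one_le {δ : ℝ≥0} (h0 : 0 < δ) (hδ : δ ≤ 1) (k : ℕ) (a : Freq → ℂ) :
    wnorm 1 k a ≤ ((δ⁻¹ ^ k : ℝ≥0) : ℝ≥0∞) * wnorm δ k a := by
  unfold wnorm
  rw [← ENNReal.tsum_mul_left]
  refine ENNReal.tsum_le_tsum fun n => ?_
  have h : weight 1 k n ≤ ((δ⁻¹ ^ k : ℝ≥0) : ℝ≥0∞) * weight δ k n := by
    unfold weight
    rw [← ENNReal.coe_mul, ENNReal.coe_le_coe, ← mul_pow]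
    gcongr
    rw [mul_add, ← mul_assoc, inv_mul_cancel₀ h0.ne', one_mul, mul_one]
    gcongr
    exact (one_le_inv₀ h0).2 hδ
  calc ‖a n‖ₑ * weight 1 k n ≤ ‖a n‖ₑ * (((δ⁻¹ ^ k : ℝ≥0) : ℝ≥0∞) * weight δ k n) := by gcongr
    _ = _ := by ring

/-- The Fourier multiplier of the Beurling transform, which sends `∂u/∂z̄` to `∂u/∂z`. -/
def beurling (n : Freq) : ℂ := (n 0 - Complex.I * n 1) / (n 0 + Complex.I * n 1)

lemma enorm_beurling_le (n : Freq) : ‖beurling n‖ₑ ≤ 1 := by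
  rw [← ofReal_norm, ENNReal.ofReal_le_one, beurling, norm_div]
  have : ((n 0 : ℂ) - Complex.I * n 1) = starRingEnd ℂ ((n 0 : ℂ) + Complex.I * n 1) := by
    simp [sub_eq_add_neg]
  rw [this, RCLike.norm_conj]
  exact div_self_le_one _

/-- The terms of the Neumann series of the equation `g = f + a * (beurling g)`. -/
def neumann (a f : Freq → ℂ) : ℕ → Freq → ℂ
  | 0 => f
  | j + 1 => conv a fun n => beurling n * neumann a f j n

lemma wnorm_beurling_le (δ : ℝ≥0) (k : ℕ) (c : Freq → ℂ) :
    wnorm δ k (fun n => beurling n * c n) ≤ wnorm δ k c := by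
  refine ENNReal.tsum_le_tsum fun n => ?_
  gcongr
  rw [enorm_mul]
  exact mul_le_of_le_one_left (zero_le) (enorm_beurling_le n)

lemma wnorm_neumann_le (δ : ℝ≥0) (k : ℕ) (a f : Freq → ℂ) (j : ℕ) :
    wnorm δ k (neumann a f j) ≤ wnorm δ k a ^ j * wnorm δ k f := by
  induction j with
  | zero => simp [neumann]
  | succ j ih =>
    calc wnorm δ k (neumann a f (j + 1))
        ≤ wnorm δ k a * wnorm δ k (fun n => beurling n * neumann a f j n) := wnorm_conv_le _ _ _ _
      _ ≤ wnorm δ k a * (wnorm δ k a ^ j * wnorm δ k f) := by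
        gcongr
        exact (wnorm_beurling_le _ _ _).trans ih
      _ = _ := by ring

lemma tsum_wnorm_neumann_le (δ : ℝ≥0) (k : ℕ) (a f : Freq → ℂ) :
    ∑' j, wnorm δ k (neumann a f j) ≤ (1 - wnorm δ k a)⁻¹ * wnorm δ k f := by
  rw [← ENNReal.tsum_geometric, ← ENNReal.tsum_mul_right]
  exact ENNReal.tsum_le_tsum fun j => wnorm_neumann_le δ k a f j

lemma wnorm_tsum_le (δ : ℝ≥0) (k : ℕ) (g : ℕ → Freq → ℂ) :
    wnorm δ k (fun n => ∑' j, g j n) ≤ ∑' j, wnorm δ k (g j) := by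
  unfold wnorm
  rw [ENNReal.tsum_comm]
  refine ENNReal.tsum_le_tsum fun n => ?_
  rw [ENNReal.tsum_mul_right]
  gcongr
  exact enorm_tsum_le_tsum_enorm

/-- The sum of the Neumann series. -/
def neumannSum (a f : Freq → ℂ) (n : Freq) : ℂ := ∑' j, neumann a f j n

lemma rapidDecay_neumann {a f : Freq → ℂ} (ha : RapidDecay a) (hf : RapidDecay f) (j : ℕ) :
    RapidDecay (neumann a f j) := fun k =>
  ne_top_of_le_ne_top (ENNReal.mul_ne_top (ENNReal.pow_ne_top (ha k)) (hf k))
    (wnorm_neumann_le 1 k a f j)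

lemma RapidDecay.beurling {c : Freq → ℂ} (hc : RapidDecay c) :
    RapidDecay fun n => beurling n * c n := fun k =>
  ne_top_of_le_ne_top (hc k) (wnorm_beurling_le 1 k c)

lemma rapidDecay_neumannSum {a f : Freq → ℂ} (ha : RapidDecay a) (hf : RapidDecay f)
    (h1 : wnorm 1 0 a < 1) : RapidDecay (neumannSum a f) := by
  intro k
  obtain ⟨δ, h0, hδ, hlt⟩ := ha.exists_wnorm_lt_one h1 k
  refine ne_top_of_le_ne_top ?_ (wnorm_one_le h0 hδ k _)
  refine ENNReal.mul_ne_top ENNReal.coe_ne_top (ne_top_of_le_ne_top ?_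
    ((wnorm_tsum_le δ k (neumann a f)).trans (tsum_wnorm_neumann_le δ k a f)))
  refine ENNReal.mul_ne_top (ENNReal.inv_ne_top.2 (tsub_pos_of_lt hlt).ne') ?_
  exact ne_top_of_le_ne_top (hf k) (wnorm_mono hδ k f)

lemma hasSum_series_tsum (g : ℕ → Freq → ℂ) (hg : ∑' j, wnorm 1 0 (g j) ≠ ⊤) (z : ℂ) :
    HasSum (fun j => series (g j) z) (series (fun n => ∑' j, g j n) z) := by
  have hs : Summable fun p : Freq × ℕ => g p.2 p.1 * mode p.1 z := by
    refine Summable.of_norm (tsum_enorm_ne_top_iff_summable_norm.1 ?_)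
    rw [ENNReal.tsum_prod (f := fun n j => ‖g j n * mode n z‖ₑ), ENNReal.tsum_comm]
    refine ne_top_of_le_ne_top hg (le_of_eq ?_)
    refine tsum_congr fun j => tsum_congr fun n => ?_
    rw [weight_zero, mul_one, ← ofReal_norm, ← ofReal_norm, norm_mul, norm_mode, mul_one]
  have hs' : Summable fun p : ℕ × Freq => g p.1 p.2 * mode p.2 z :=
    (Equiv.prodComm ℕ Freq).summable_iff.2 hs
  have h := hs'.prod.hasSum
  have e : series (fun n => ∑' j, g j n) z = ∑' j, ∑' n, g j n * mode n z := by
    rw [← Summable.tsum_comm (f := fun j n => g j n * mode n z) hs']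
    exact tsum_congr fun n => tsum_mul_right.symm
  rw [e]
  exact h

lemma series_neumannSum {a f : Freq → ℂ} (ha : RapidDecay a) (hf : RapidDecay f)
    (h1 : wnorm 1 0 a < 1) (z : ℂ) :
    series (neumannSum a f) z
      = series a z * series (fun n => beurling n * neumannSum a f n) z + series f z := by
  have hfin : ∑' j, wnorm 1 0 (neumann a f j) ≠ ⊤ :=
    ne_top_of_le_ne_top (ENNReal.mul_ne_top (ENNReal.inv_ne_top.2 (tsub_pos_of_lt h1).ne') (hf 0))
      (tsum_wnorm_neumann_le 1 0 a f)
  have hA := hasSum_series_tsum (neumann a f) hfin z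
  have hB := hasSum_series_tsum (fun j n => beurling n * neumann a f j n)
    (ne_top_of_le_ne_top hfin (ENNReal.tsum_le_tsum fun j => wnorm_beurling_le 1 0 _)) z
  simp only [tsum_mul_left] at hB
  have hC := hB.mul_left (series a z)
  have hD : (fun j => series a z * series (fun n => beurling n * neumann a f j n) z)
      = fun j => series (neumann a f (j + 1)) z := by
    funext j
    exact (series_conv ha (rapidDecay_neumann ha hf j).beurling z).symm
  rw [hD] at hC
  have hE := (hasSum_nat_add_iff (f := fun j => series (neumann a f j) z) 1).1 hC
  rw [Finset.sum_range_one] at hE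
  exact hA.unique hE

lemma dz_eq_of_hasFDerivAt {f : ℂ → ℂ} {z p q : ℂ} (h : HasFDerivAt f (p • reL + q • imL) z) :
    dz f z = (p - Complex.I * q) / 2 := by
  simp [dz, h.fderiv, reL_apply, imL_apply]

lemma dzbar_eq_of_hasFDerivAt {f : ℂ → ℂ} {z p q : ℂ} (h : HasFDerivAt f (p • reL + q • imL) z) :
    dzbar f z = (p + Complex.I * q) / 2 := by
  simp [dzbar, h.fderiv, reL_apply, imL_apply]

lemma norm_series_le {c : Freq → ℂ} (z : ℂ) : ‖series c z‖ₑ ≤ wnorm 1 0 c := by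
  refine enorm_tsum_le_tsum_enorm.trans (le_of_eq (tsum_congr fun n => ?_))
  rw [weight_zero, mul_one, ← ofReal_norm, ← ofReal_norm, norm_mul, norm_mode, mul_one]

lemma freq_complex_ne_zero {n : Freq} (hn : n ≠ 0) : (n 0 : ℂ) + Complex.I * n 1 ≠ 0 := by
  intro h
  apply hn
  have h0 : n 0 = 0 := by simpa using congrArg Complex.re h
  have h1 : n 1 = 0 := by simpa using congrArg Complex.im h
  ext i
  fin_cases i <;> simpa

lemma one_le_norm_freq_complex {n : Freq} (hn : n ≠ 0) : 1 ≤ ‖(n 0 : ℂ) + Complex.I * n 1‖ := by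
  have h : ‖(n 0 : ℂ) + Complex.I * n 1‖ ^ 2 = ((n 0 ^ 2 + n 1 ^ 2 : ℤ) : ℝ) := by
    rw [Complex.sq_norm, Complex.normSq_apply]; simp; ring
  have h2 : 0 < n 0 ^ 2 + n 1 ^ 2 := by
    have : (0 : ℝ) < ((n 0 ^ 2 + n 1 ^ 2 : ℤ) : ℝ) := by
      rw [← h]; exact pow_pos (norm_pos_iff.2 (freq_complex_ne_zero hn)) 2
    exact_mod_cast this
  have h3 : (1 : ℝ) ≤ ‖(n 0 : ℂ) + Complex.I * n 1‖ ^ 2 := by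
    rw [h]; exact_mod_cast h2
  exact (one_le_sq_iff₀ (norm_nonneg _)).1 h3

/-- Solution of the inhomogeneous Beltrami equation `u_z̄ = μ u_z + F` when the Fourier
coefficients of `μ` have small `ℓ¹`-norm. -/
theorem exists_beltrami_series {a f : Freq → ℂ} (ha : RapidDecay a) (hf : RapidDecay f)
    (h1 : wnorm 1 0 a < 1) :
    ∃ u : ℂ → ℂ, ContDiff ℝ ∞ u ∧ (∀ z, dzbar u z = series a z * dz u z + series f z) ∧
      ∀ z, ‖dz u z‖ₑ ≤ (1 - wnorm 1 0 a)⁻¹ * wnorm 1 0 f := by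
  set g := neumannSum a f with hgdef
  have hg : RapidDecay g := rapidDecay_neumannSum ha hf h1
  set v : Freq → ℂ := fun n => g n / (π * Complex.I * (n 0 + Complex.I * n 1)) with hvdef
  have hpi : (π : ℂ) ≠ 0 := Complex.ofReal_ne_zero.2 Real.pi_ne_zero
  have hv : RapidDecay v := by
    refine hg.of_le 1 0 fun n => ?_
    rw [weight_zero, mul_one, ENNReal.coe_one, one_mul, ← ofReal_norm, ← ofReal_norm]
    refine ENNReal.ofReal_le_ofReal ?_
    simp only [hvdef]
    rw [norm_div]
    by_cases hn : n = 0
    · subst hn; simp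
    · refine div_le_self (norm_nonneg _) ?_
      rw [norm_mul, norm_mul, Complex.norm_I, Complex.norm_real, Real.norm_of_nonneg Real.pi_pos.le]
      have := one_le_norm_freq_complex hn
      have h3 : (1 : ℝ) ≤ π := by linarith [Real.pi_gt_three]
      calc (1 : ℝ) = 1 * 1 * 1 := by norm_num
        _ ≤ π * 1 * ‖(n 0 : ℂ) + Complex.I * n 1‖ := by gcongr
  let u : ℂ → ℂ := fun z => series v z + g 0 * (reL z - Complex.I * imL z)
  have hu : ∀ z, HasFDerivAt u ((series (coeffD 0 v) z + g 0) • reL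
      + (series (coeffD 1 v) z - g 0 * Complex.I) • imL) z := by
    intro z
    refine ((hv.hasFDerivAt_series z).add
      ((reL.hasFDerivAt.sub (imL.hasFDerivAt.const_mul Complex.I)).const_mul (g 0))).congr_fderiv ?_
    ext w
    simp
    ring
  have hzb : ∀ z, dzbar u z = series g z := by
    intro z
    rw [dzbar_eq_of_hasFDerivAt (hu z)]
    have h0 := (hv.coeffD 0).summable_mul_mode z
    have h1 := ((hv.coeffD 1).summable_mul_mode z).mul_left Complex.I
    have hz : Summable fun n : Freq => (Pi.single 0 (g 0) : Freq → ℂ) n * mode n z :=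
      summable_of_ne_finset_zero (s := {0}) fun n hn => by
        rw [Pi.single_eq_of_ne (by simpa using hn), zero_mul]
    have e0 : g 0 = ∑' n : Freq, (Pi.single 0 (g 0) : Freq → ℂ) n * mode n z := by
      rw [tsum_eq_single 0 fun n hn => by rw [Pi.single_eq_of_ne hn, zero_mul]]
      simp [mode, phase]
    have e1 : (series (coeffD 0 v) z + g 0 + Complex.I * (series (coeffD 1 v) z - g 0 * Complex.I))
        / 2 = (series (coeffD 0 v) z + Complex.I * series (coeffD 1 v) z) / 2 + g 0 := by
      linear_combination (-(g 0) / 2) * Complex.I_mul_I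
    rw [e1, e0]
    unfold series
    rw [← tsum_mul_left, ← h0.tsum_add h1, ← tsum_div_const, ← ((h0.add h1).div_const 2).tsum_add hz]
    refine tsum_congr fun n => ?_
    by_cases hn : n = 0
    · subst hn; simp [coeffD]
    · rw [Pi.single_eq_of_ne hn, zero_mul, add_zero]
      have := freq_complex_ne_zero hn
      simp only [coeffD, hvdef]
      field_simp
  have hz : ∀ z, dz u z = series (fun n => beurling n * g n) z := by
    intro z
    rw [dz_eq_of_hasFDerivAt (hu z)]
    have h0 := (hv.coeffD 0).summable_mul_mode z
    have h1 := ((hv.coeffD 1).summable_mul_mode z).mul_left Complex.I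
    have e1 : (series (coeffD 0 v) z + g 0 - Complex.I * (series (coeffD 1 v) z - g 0 * Complex.I))
        / 2 = (series (coeffD 0 v) z - Complex.I * series (coeffD 1 v) z) / 2 := by
      linear_combination ((g 0) / 2) * Complex.I_mul_I
    rw [e1]
    unfold series
    rw [← tsum_mul_left, ← h0.tsum_sub h1, ← tsum_div_const]
    refine tsum_congr fun n => ?_
    by_cases hn : n = 0
    · subst hn; simp [coeffD, beurling]
    · have := freq_complex_ne_zero hn
      simp only [coeffD, hvdef, beurling]
      field_simp
  refine ⟨u, ?_, fun z => ?_, fun z => ?_⟩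
  · exact hv.contDiff_series.add (contDiff_const.mul
      (reL.contDiff.sub (contDiff_const.mul imL.contDiff)))
  · rw [hzb, hz]; exact series_neumannSum ha hf h1 z
  · rw [hz]
    exact (norm_series_le z).trans ((wnorm_beurling_le 1 0 g).trans
      ((wnorm_tsum_le 1 0 _).trans (tsum_wnorm_neumann_le 1 0 a f)))

/-! ### Fourier coefficients of smooth periodic functions -/

section Torus

open MeasureTheory

/-- The Haar probability measure on the circle, the convention of `UnitAddTorus.mFourierCoeff`. -/
local instance : MeasureSpace UnitAddCircle := ⟨AddCircle.haarAddCircle⟩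

local instance : Measure.IsAddHaarMeasure (volume : Measure UnitAddCircle) :=
  inferInstanceAs (Measure.IsAddHaarMeasure AddCircle.haarAddCircle)

local instance : IsProbabilityMeasure (volume : Measure UnitAddCircle) :=
  inferInstanceAs (IsProbabilityMeasure AddCircle.haarAddCircle)

/-- Functions on the plane that are periodic with respect to the Gaussian integers. -/
def LatticePeriodic (F : ℂ → ℂ) : Prop :=
  ∀ (n : Freq) (z : ℂ), F (z + ((n 0 : ℝ) + (n 1 : ℝ) * Complex.I)) = F z

/-- The point of the plane with given real coordinates. -/
def planePt (x : Fin 2 → ℝ) : ℂ := x 0 + x 1 * Complex.I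

lemma continuous_planePt : Continuous planePt := by
  unfold planePt; fun_prop

/-- The function on the torus induced by a periodic function. -/
def torusLift (F : ℂ → ℂ) (t : UnitAddTorus (Fin 2)) : ℂ := F (planePt fun i => (t i).out)

/-- The point of the torus below a point of `ℝ²`. -/
def torusPt (x : Fin 2 → ℝ) : UnitAddTorus (Fin 2) := fun i => (x i : UnitAddCircle)

lemma torusLift_torusPt {F : ℂ → ℂ} (hF : LatticePeriodic F) (x : Fin 2 → ℝ) :
    torusLift F (torusPt x) = F (planePt x) := by
  have h : ∀ i, ∃ n : ℤ, n • (1 : ℝ) = Quotient.out (torusPt x i) - x i := by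
    intro i
    rw [← AddCircle.coe_eq_zero_iff, AddCircle.coe_sub]
    have : ((Quotient.out (torusPt x i) : ℝ) : UnitAddCircle) = torusPt x i :=
      Quotient.out_eq' (torusPt x i)
    rw [this]
    exact sub_self _
  choose n hn using h
  rw [← hF n (planePt x), torusLift]
  congr 1
  have h0 := hn 0
  have h1 := hn 1
  simp only [zsmul_eq_mul, mul_one] at h0 h1
  rw [h0, h1]
  simp only [planePt]
  push_cast
  ring

lemma surjective_torusPt : Function.Surjective torusPt := fun t =>
  ⟨fun i => (t i).out, funext fun i => Quotient.out_eq' (t i)⟩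

lemma isOpenQuotientMap_torusPt : IsOpenQuotientMap torusPt :=
  IsOpenQuotientMap.piMap (f := fun (_ : Fin 2) (x : ℝ) => (x : UnitAddCircle))
    fun _ => QuotientAddGroup.isOpenQuotientMap_mk

lemma continuous_torusLift {F : ℂ → ℂ} (hF : LatticePeriodic F) (hc : Continuous F) :
    Continuous (torusLift F) := by
  rw [← isOpenQuotientMap_torusPt.continuous_comp_iff]
  rw [show torusLift F ∘ torusPt = F ∘ planePt from funext fun x => torusLift_torusPt hF x]
  exact hc.comp continuous_planePt

/-- The directions of the two coordinates of the plane. -/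
def planeDir : Fin 2 → ℂ := ![1, Complex.I]

/-- The partial derivatives of a function on the plane. -/
def partialD (j : Fin 2) (F : ℂ → ℂ) (z : ℂ) : ℂ := fderiv ℝ F z (planeDir j)

lemma LatticePeriodic.partialD {F : ℂ → ℂ} (hF : LatticePeriodic F) (j : Fin 2) :
    LatticePeriodic (partialD j F) := by
  intro n z
  unfold NullHyp.partialD
  rw [← fderiv_comp_add_right, funext fun y => hF n y]

lemma contDiff_partialD {F : ℂ → ℂ} (hF : ContDiff ℝ ∞ F) (j : Fin 2) :
    ContDiff ℝ ∞ (partialD j F) :=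
  (hF.fderiv_right (m := ∞) (by simp)).clm_apply contDiff_const

lemma LatticePeriodic.exists_bound {F : ℂ → ℂ} (hF : LatticePeriodic F) (hc : Continuous F) :
    ∃ B, ∀ z, ‖F z‖ ≤ B := by
  refine ⟨‖(⟨torusLift F, continuous_torusLift hF hc⟩ : C(UnitAddTorus (Fin 2), ℂ))‖, fun z => ?_⟩
  have := ContinuousMap.norm_coe_le_norm
    (⟨torusLift F, continuous_torusLift hF hc⟩ : C(UnitAddTorus (Fin 2), ℂ)) (torusPt ![z.re, z.im])
  simpa [torusLift_torusPt hF, planePt, Complex.re_add_im] using this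

/-- The Fourier coefficients of a periodic function. -/
def periodicCoeff (F : ℂ → ℂ) (n : Freq) : ℂ := UnitAddTorus.mFourierCoeff (torusLift F) n

lemma mFourier_torusPt (n : Freq) (x : Fin 2 → ℝ) :
    UnitAddTorus.mFourier n (torusPt x) = mode n (planePt x) := by
  simp only [UnitAddTorus.mFourier, ContinuousMap.coe_mk, torusPt, Fin.prod_univ_two,
    fourier_coe_apply]
  rw [← Complex.exp_add, mode, phase_apply]
  simp [planePt]

lemma norm_periodicCoeff_le {F : ℂ → ℂ} {B : ℝ} (hB : ∀ z, ‖F z‖ ≤ B) (n : Freq) :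
    ‖periodicCoeff F n‖ ≤ B := by
  have := norm_integral_le_of_norm_le_const (μ := (volume : Measure (UnitAddTorus (Fin 2))))
    (f := fun t => UnitAddTorus.mFourier (-n) t • torusLift F t) (C := B)
    (Filter.Eventually.of_forall fun t => ?_)
  · simpa [periodicCoeff, UnitAddTorus.mFourierCoeff] using this
  · rw [norm_smul]
    have h1 : ‖UnitAddTorus.mFourier (-n) t‖ ≤ 1 :=
      (ContinuousMap.norm_coe_le_norm _ t).trans UnitAddTorus.mFourier_norm.le
    calc _ ≤ 1 * B := by gcongr; exact hB _
      _ = B := one_mul B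

/-- Differentiation multiplies the Fourier coefficients by the frequency: differentiate the
coefficients of the translates of the function. -/
lemma periodicCoeff_partialD {F : ℂ → ℂ} (hF : LatticePeriodic F) (hs : ContDiff ℝ ∞ F)
    (j : Fin 2) (n : Freq) :
    periodicCoeff (partialD j F) n = 2 * π * Complex.I * n j * periodicCoeff F n := by
  have hcF := continuous_torusLift hF hs.continuous
  have hcD := continuous_torusLift (hF.partialD j) (contDiff_partialD hs j).continuous
  obtain ⟨B, hB⟩ := (hF.partialD j).exists_bound (contDiff_partialD hs j).continuous
  let sh : ℝ → UnitAddTorus (Fin 2) := fun h => torusPt (Pi.single j h)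
  have hsh : ∀ (h : ℝ) x, torusPt x + sh h = torusPt (x + Pi.single j h) := fun h x => rfl
  have hpl : ∀ (h : ℝ) x, planePt (x + Pi.single j h) = planePt x + h • planeDir j := by
    intro h x
    fin_cases j <;> simp [planePt, planeDir] <;> ring
  have hint : ∀ G : UnitAddTorus (Fin 2) → ℂ, Continuous G →
      Integrable (fun t => UnitAddTorus.mFourier (-n) t • G t) := fun G hG =>
    (((UnitAddTorus.mFourier (-n)).continuous.smul hG).integrable_of_hasCompactSupport
      (HasCompactSupport.of_compactSpace _))
  have key := hasDerivAt_integral_of_dominated_loc_of_deriv_le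
    (μ := (volume : Measure (UnitAddTorus (Fin 2)))) (x₀ := (0 : ℝ)) (s := Set.univ)
    (F := fun h t => UnitAddTorus.mFourier (-n) t • torusLift F (t + sh h))
    (F' := fun h t => UnitAddTorus.mFourier (-n) t • torusLift (partialD j F) (t + sh h))
    (bound := fun _ => B) Filter.univ_mem
    (Filter.Eventually.of_forall fun h =>
      (hint _ (hcF.comp (continuous_add_const _))).aestronglyMeasurable)
    (hint _ (hcF.comp (continuous_add_const _)))
    (hint _ (hcD.comp (continuous_add_const _))).aestronglyMeasurable
    (Filter.Eventually.of_forall fun t h _ => ?_) (integrable_const B)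
    (Filter.Eventually.of_forall fun t h _ => ?_)
  · have h0 : sh 0 = 0 := by simp [sh]; rfl
    have hd := key.2
    simp only [h0, add_zero] at hd
    have htr : ∀ h : ℝ, ∫ t, UnitAddTorus.mFourier (-n) t • torusLift F (t + sh h)
        = mode n (h • planeDir j) * periodicCoeff F n := by
      intro h
      rw [periodicCoeff, UnitAddTorus.mFourierCoeff,
        ← integral_add_right_eq_self (fun t => UnitAddTorus.mFourier (-n) t • torusLift F t) (sh h),
        ← integral_const_mul]
      refine integral_congr_ae (Filter.Eventually.of_forall fun t => ?_)
      obtain ⟨x, rfl⟩ := surjective_torusPt t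
      simp only [smul_eq_mul]
      rw [hsh, mFourier_torusPt, mFourier_torusPt, hpl, mode, mode, mode, map_add,
        ← mul_assoc, ← Complex.exp_add]
      congr 2
      simp only [phase_apply, Pi.neg_apply, Int.cast_neg]
      ring
    simp only [htr] at hd
    have hd2 : HasDerivAt (fun h : ℝ => mode n (h • planeDir j) * periodicCoeff F n)
        (2 * π * Complex.I * n j * periodicCoeff F n) 0 := by
      have h1 : HasDerivAt (fun h : ℝ => h • planeDir j) (planeDir j) 0 := by
        simpa using (hasDerivAt_id (0 : ℝ)).smul_const (planeDir j)
      have h2 := ((hasFDerivAt_mode n ((0 : ℝ) • planeDir j)).comp_hasDerivAt (0 : ℝ) h1).mul_const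
        (periodicCoeff F n)
      refine h2.congr_deriv ?_
      fin_cases j <;> simp [mode, phase_apply, planeDir]
    exact hd.unique hd2
  · rw [norm_smul]
    have h1 : ‖UnitAddTorus.mFourier (-n) t‖ ≤ 1 :=
      (ContinuousMap.norm_coe_le_norm _ t).trans UnitAddTorus.mFourier_norm.le
    calc _ ≤ 1 * B := by gcongr; exact hB _
      _ = B := one_mul B
  · obtain ⟨x, rfl⟩ := surjective_torusPt t
    simp only [hsh]
    rw [torusLift_torusPt (hF.partialD j), hpl]
    refine HasDerivAt.fun_const_smul _ ?_
    have h1 : HasDerivAt (fun h : ℝ => planePt x + h • planeDir j) (planeDir j) h := by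
      simpa using ((hasDerivAt_id h).smul_const (planeDir j)).const_add (planePt x)
    have h2 := ((hs.differentiable (by simp)) (planePt x + h • planeDir j)).hasFDerivAt.comp_hasDerivAt
      h h1
    refine h2.congr_of_eventuallyEq (Filter.Eventually.of_forall fun h' => ?_)
    simp only [torusLift_torusPt hF, hpl, Function.comp_def]

lemma hasSum_periodicCoeff {F : ℂ → ℂ} (hF : LatticePeriodic F) (hs : Continuous F)
    (hr : RapidDecay (periodicCoeff F)) (z : ℂ) : series (periodicCoeff F) z = F z := by
  have h := UnitAddTorus.hasSum_mFourier_series_apply_of_summable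
    (f := ⟨torusLift F, continuous_torusLift hF hs⟩) hr.summable.of_norm (torusPt ![z.re, z.im])
  have h1 : planePt ![z.re, z.im] = z := by simp [planePt, Complex.re_add_im]
  simp only [mFourier_torusPt, ContinuousMap.coe_mk, torusLift_torusPt hF, h1, smul_eq_mul] at h
  exact h.tsum_eq

end Torus

lemma LatticePeriodic.iterate_partialD {F : ℂ → ℂ} (hF : LatticePeriodic F) (j : Fin 2) (k : ℕ) :
    LatticePeriodic ((NullHyp.partialD j)^[k] F) := by
  induction k with
  | zero => exact hF
  | succ k ih => rw [Function.iterate_succ_apply']; exact ih.partialD j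

lemma contDiff_iterate_partialD {F : ℂ → ℂ} (hF : ContDiff ℝ ∞ F) (j : Fin 2) (k : ℕ) :
    ContDiff ℝ ∞ ((partialD j)^[k] F) := by
  induction k with
  | zero => exact hF
  | succ k ih => rw [Function.iterate_succ_apply']; exact contDiff_partialD ih j

lemma periodicCoeff_iterate_partialD {F : ℂ → ℂ} (hF : LatticePeriodic F) (hs : ContDiff ℝ ∞ F)
    (j : Fin 2) (k : ℕ) (n : Freq) :
    periodicCoeff ((partialD j)^[k] F) n = (2 * π * Complex.I * n j) ^ k * periodicCoeff F n := by
  induction k with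
  | zero => simp
  | succ k ih =>
    rw [Function.iterate_succ_apply', periodicCoeff_partialD (hF.iterate_partialD j k)
      (contDiff_iterate_partialD hs j k), ih]
    ring

/-- Polynomial decay of the Fourier coefficients in terms of the pure partial derivatives. -/
lemma weight_mul_norm_periodicCoeff_le {F : ℂ → ℂ} (hF : LatticePeriodic F) (hs : ContDiff ℝ ∞ F)
    (k : ℕ) {B : ℝ} (h0 : ∀ z, ‖F z‖ ≤ B) (hj : ∀ j z, ‖(partialD j)^[k] F z‖ ≤ B) (n : Freq) :
    (1 + ‖n‖) ^ k * ‖periodicCoeff F n‖ ≤ 2 ^ k * B := by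
  have hB0 := norm_periodicCoeff_le h0 n
  rcases le_total ‖n‖ 1 with hn | hn
  · calc (1 + ‖n‖) ^ k * ‖periodicCoeff F n‖ ≤ (1 + 1) ^ k * B := by gcongr
      _ = 2 ^ k * B := by norm_num
  · obtain ⟨j, hj'⟩ : ∃ j, ‖n‖ = ‖n j‖ := by
      obtain ⟨j, hj⟩ := Finite.exists_max fun i => ‖n i‖
      exact ⟨j, le_antisymm ((pi_norm_le_iff_of_nonneg (norm_nonneg _)).2 hj) (norm_le_pi_norm n j)⟩
    have hB := norm_periodicCoeff_le (hj j) n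
    rw [periodicCoeff_iterate_partialD hF hs, norm_mul, norm_pow] at hB
    have h1 : 1 + ‖n‖ ≤ 2 * ‖(2 * π * Complex.I * n j : ℂ)‖ := by
      have : ‖(2 * π * Complex.I * n j : ℂ)‖ = 2 * π * ‖n‖ := by
        rw [hj']
        simp [Int.norm_eq_abs, Real.pi_pos.le]
      rw [this]
      nlinarith [Real.pi_gt_three]
    calc (1 + ‖n‖) ^ k * ‖periodicCoeff F n‖
        ≤ (2 * ‖(2 * π * Complex.I * n j : ℂ)‖) ^ k * ‖periodicCoeff F n‖ := by gcongr
      _ = 2 ^ k * (‖(2 * π * Complex.I * n j : ℂ)‖ ^ k * ‖periodicCoeff F n‖) := by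
        rw [mul_pow]; ring
      _ ≤ 2 ^ k * B := by gcongr

/-- The sum of the inverse cubic weights over all frequencies. -/
def freqConst : ℝ≥0∞ := ∑' n, (weight 1 3 n)⁻¹

lemma freqConst_ne_top : freqConst ≠ ⊤ := by
  have h := EisensteinSeries.summable_one_div_norm_rpow (k := 3) (by norm_num)
  have h1 : Summable fun n : Freq => ((1 + ‖n‖) ^ 3)⁻¹ := by
    have h2 : Summable fun n : Freq => (if n = 0 then 1 else 0) + ‖n‖ ^ (-3 : ℝ) := by
      refine Summable.add ?_ h
      exact summable_of_ne_finset_zero (s := {0}) fun n hn => if_neg (by simpa using hn)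
    refine Summable.of_nonneg_of_le (fun n => by positivity) (fun n => ?_) h2
    by_cases hn : n = 0
    · subst hn
      simp only [norm_zero, add_zero, one_pow, inv_one, if_true, le_add_iff_nonneg_right]
      positivity
    · rw [if_neg hn, zero_add, Real.rpow_neg (norm_nonneg _)]
      have : 0 < ‖n‖ := norm_pos_iff.2 hn
      have e : ‖n‖ ^ (3 : ℝ) = ‖n‖ ^ (3 : ℕ) := by norm_cast
      rw [e]
      gcongr
      linarith
  have h3 := tsum_enorm_ne_top_iff_summable_norm.2 h1.norm
  refine ne_top_of_le_ne_top h3 (le_of_eq ?_)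
  refine tsum_congr fun n => ?_
  unfold weight
  rw [← ofReal_norm, Real.norm_of_nonneg (by positivity), ENNReal.ofReal_inv_of_pos (by positivity)]
  congr 1
  rw [ENNReal.ofReal, ENNReal.coe_inj, ← NNReal.coe_inj]
  rw [Real.coe_toNNReal _ (by positivity)]
  simp

lemma wnorm_periodicCoeff_le {F : ℂ → ℂ} (hF : LatticePeriodic F) (hs : ContDiff ℝ ∞ F)
    (k : ℕ) {B : ℝ} (h0 : ∀ z, ‖F z‖ ≤ B) (hj : ∀ j z, ‖(partialD j)^[k + 3] F z‖ ≤ B) :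
    wnorm 1 k (periodicCoeff F) ≤ ENNReal.ofReal (2 ^ (k + 3) * B) * freqConst := by
  unfold wnorm freqConst
  rw [← ENNReal.tsum_mul_left]
  refine ENNReal.tsum_le_tsum fun n => ?_
  rw [← div_eq_mul_inv, ENNReal.le_div_iff_mul_le (Or.inl (by simp [weight]))
    (Or.inl (by simp [weight])), mul_assoc, ← weight_add]
  have h := weight_mul_norm_periodicCoeff_le hF hs (k + 3) h0 hj n
  refine le_trans (le_of_eq ?_) (ENNReal.ofReal_le_ofReal h)
  rw [ENNReal.ofReal_mul (by positivity), mul_comm, ofReal_norm]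
  congr 1
  unfold weight
  rw [ENNReal.ofReal, ENNReal.coe_inj, ← NNReal.coe_inj, Real.coe_toNNReal _ (by positivity)]
  simp

lemma rapidDecay_periodicCoeff {F : ℂ → ℂ} (hF : LatticePeriodic F) (hs : ContDiff ℝ ∞ F) :
    RapidDecay (periodicCoeff F) := by
  intro k
  obtain ⟨B, hB⟩ := hF.exists_bound hs.continuous
  choose C hC using fun j => (hF.iterate_partialD j (k + 3)).exists_bound
    (contDiff_iterate_partialD hs j (k + 3)).continuous
  refine ne_top_of_le_ne_top (ENNReal.mul_ne_top ENNReal.ofReal_ne_top freqConst_ne_top)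
    (wnorm_periodicCoeff_le hF hs k (B := max B (max (C 0) (C 1)))
      (fun z => (hB z).trans (le_max_left _ _)) fun j z => (hC j z).trans ?_)
  fin_cases j <;> simp

/-! ### Local solvability of the Beltrami equation -/

/-- A function that is smooth near a point agrees near this point with a smooth function on the
whole space. -/
lemma exists_contDiff_eventuallyEq {E F : Type*} [NormedAddCommGroup E] [NormedSpace ℝ E]
    [FiniteDimensional ℝ E] [NormedAddCommGroup F] [NormedSpace ℝ F] {f : E → F} {U : Set E}
    (hU : IsOpen U) (hf : ContDiffOn ℝ ∞ f U) {x : E} (hx : x ∈ U) :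
    ∃ g : E → F, ContDiff ℝ ∞ g ∧ g =ᶠ[nhds x] f := by
  obtain ⟨r, hr, hrU⟩ := Metric.nhds_basis_closedBall.mem_iff.1 (hU.mem_nhds hx)
  let b : ContDiffBump x := ⟨r / 2, r, by positivity, by linarith⟩
  refine ⟨fun y => b y • f y, ?_, ?_⟩
  · rw [contDiff_iff_contDiffAt]
    intro y
    by_cases hy : y ∈ Metric.closedBall x r
    · exact b.contDiff.contDiffAt.smul (hf.contDiffAt (hU.mem_nhds (hrU hy)))
    · have h0 : (fun y => b y • f y) =ᶠ[nhds y] fun _ => 0 := by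
        filter_upwards [Metric.isClosed_closedBall.isOpen_compl.mem_nhds hy] with z hz
        have : b z = 0 := b.zero_of_le_dist (by
          simp only [Set.mem_compl_iff, Metric.mem_closedBall, not_le] at hz
          exact hz.le)
        rw [this, zero_smul]
      exact contDiffAt_const.congr_of_eventuallyEq h0
  · filter_upwards [b.eventuallyEq_one] with y hy
    rw [hy, Pi.one_apply, one_smul]

/-- There is a smooth periodic function on the line that is the identity near the origin. -/
lemma exists_periodic_coordinate :
    ∃ p : ℝ → ℝ, ContDiff ℝ ∞ p ∧ (∀ (n : ℤ) x, p (x + n) = p x) ∧ p =ᶠ[nhds 0] id := by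
  have hs : ContDiffOn ℝ ∞ Real.arcsin (Set.Ioo (-1) 1) := fun x hx =>
    (Real.contDiffAt_arcsin hx.1.ne' hx.2.ne).contDiffWithinAt
  obtain ⟨a, ha, hae⟩ := exists_contDiff_eventuallyEq isOpen_Ioo hs (x := 0) (by norm_num)
  refine ⟨fun x => (2 * π)⁻¹ * a (Real.sin (2 * π * x)), ?_, fun n x => ?_, ?_⟩
  · exact contDiff_const.mul (ha.comp (Real.contDiff_sin.comp (contDiff_const.mul contDiff_id)))
  · have : 2 * π * (x + n) = 2 * π * x + n * (2 * π) := by ring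
    simp only [this, Real.sin_add_int_mul_two_pi]
  · have hc : Filter.Tendsto (fun x : ℝ => Real.sin (2 * π * x)) (nhds 0) (nhds 0) := by
      have : Continuous fun x : ℝ => Real.sin (2 * π * x) := by fun_prop
      simpa using this.tendsto 0
    have hc' : Filter.Tendsto (fun x : ℝ => 2 * π * x) (nhds 0) (nhds 0) := by
      have : Continuous fun x : ℝ => 2 * π * x := by fun_prop
      simpa using this.tendsto 0
    have hI : Set.Ioo (-(π / 2)) (π / 2) ∈ nhds (0 : ℝ) :=
      Ioo_mem_nhds (by linarith [Real.pi_pos]) (by linarith [Real.pi_pos])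
    filter_upwards [hc.eventually hae, hc'.eventually hI] with x h1 h2
    rw [h1, Real.arcsin_sin h2.1.le h2.2.le, id]
    have := Real.pi_pos
    field_simp

/-- There is a smooth map from the plane to itself that is periodic with respect to the Gaussian
integers and is the identity near the origin. -/
lemma exists_periodic_plane_map :
    ∃ P : ℂ → ℂ, ContDiff ℝ ∞ P ∧
      (∀ (n : Freq) (z : ℂ), P (z + ((n 0 : ℝ) + (n 1 : ℝ) * Complex.I)) = P z) ∧
      P =ᶠ[nhds 0] id := by
  obtain ⟨p, hp, hper, hid⟩ := exists_periodic_coordinate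
  refine ⟨fun z => (p z.re : ℂ) + p z.im * Complex.I, ?_, fun n z => ?_, ?_⟩
  · have h1 : ContDiff ℝ ∞ fun z : ℂ => (p z.re : ℂ) :=
      Complex.ofRealCLM.contDiff.comp (hp.comp Complex.reCLM.contDiff)
    have h2 : ContDiff ℝ ∞ fun z : ℂ => (p z.im : ℂ) :=
      Complex.ofRealCLM.contDiff.comp (hp.comp Complex.imCLM.contDiff)
    exact h1.add (h2.mul contDiff_const)
  · simp [hper]
  · have h1 := (Complex.continuous_re.tendsto 0).eventually hid
    have h2 := (Complex.continuous_im.tendsto 0).eventually hid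
    filter_upwards [h1, h2] with z h1 h2
    simp [h1, h2, Complex.re_add_im]

/-- Every point of the plane is congruent modulo the Gaussian integers to a point of a fixed
ball. -/
lemma exists_freq_add_mem_closedBall (z : ℂ) :
    ∃ n : Freq, z + ((n 0 : ℝ) + (n 1 : ℝ) * Complex.I) ∈ Metric.closedBall (0 : ℂ) 2 := by
  refine ⟨![-⌊z.re⌋, -⌊z.im⌋], ?_⟩
  rw [mem_closedBall_zero_iff]
  refine (Complex.norm_le_abs_re_add_abs_im _).trans ?_
  have h1 := Int.fract_nonneg z.re
  have h2 := (Int.fract_lt_one z.re).le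
  have h3 := Int.fract_nonneg z.im
  have h4 := (Int.fract_lt_one z.im).le
  simp [← sub_eq_add_neg, abs_of_nonneg h1, abs_of_nonneg h3]
  linarith

/-- The derivatives along the plane of a smooth family of functions depend smoothly on the
parameter. -/
lemma exists_contDiff_iterate_partialD {Φ : ℝ × ℂ → ℂ} (hΦ : ContDiff ℝ ∞ Φ) (j : Fin 2) (k : ℕ) :
    ∃ Ψ : ℝ × ℂ → ℂ, ContDiff ℝ ∞ Ψ ∧ ∀ ε z, (partialD j)^[k] (fun z => Φ (ε, z)) z = Ψ (ε, z) := by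
  induction k with
  | zero => exact ⟨Φ, hΦ, fun _ _ => rfl⟩
  | succ k ih =>
    obtain ⟨Ψ, hΨ, h⟩ := ih
    refine ⟨fun x => fderiv ℝ Ψ x (0, planeDir j),
      (hΨ.fderiv_right (m := ∞) (by simp)).clm_apply contDiff_const, fun ε z => ?_⟩
    rw [Function.iterate_succ_apply', show (partialD j)^[k] (fun z => Φ (ε, z))
      = fun z => Ψ (ε, z) from funext (h ε), partialD]
    have h1 : HasFDerivAt (fun z : ℂ => (ε, z)) (ContinuousLinearMap.inr ℝ ℝ ℂ) z :=
      hasFDerivAt_prodMk_right ε z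
    have h2 := ((hΨ.differentiable (by simp)) (ε, z)).hasFDerivAt.comp z h1
    have h3 := congrArg (fun L => L (planeDir j)) h2.fderiv
    simpa [Function.comp_def] using h3

/-- A smooth function that vanishes at the origin becomes, after rescaling and periodization, a
periodic function with small Fourier coefficients. -/
lemma exists_scale_wnorm_lt {μ P : ℂ → ℂ} (hμ : ContDiff ℝ ∞ μ) (h0 : μ 0 = 0)
    (hP : ContDiff ℝ ∞ P)
    (hper : ∀ (n : Freq) (z : ℂ), P (z + ((n 0 : ℝ) + (n 1 : ℝ) * Complex.I)) = P z)
    {η : ℝ≥0∞} (hη : 0 < η) :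
    ∃ ε : ℝ, 0 < ε ∧ wnorm 1 0 (periodicCoeff fun z => μ (ε • P z)) < η := by
  set Φ : ℝ × ℂ → ℂ := fun x => μ (x.1 • P x.2) with hΦd
  have hΦ : ContDiff ℝ ∞ Φ := hμ.comp (contDiff_fst.smul (hP.comp contDiff_snd))
  have hperΦ : ∀ ε, LatticePeriodic fun z => Φ (ε, z) := fun ε n z => by
    simp only [hΦd, hper]
  -- uniform smallness of a family of periodic functions that vanishes for `ε = 0`
  have hunif : ∀ Ψ : ℝ × ℂ → ℂ, ContDiff ℝ ∞ Ψ → (∀ z, Ψ (0, z) = 0) →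
      (∀ ε, LatticePeriodic fun z => Ψ (ε, z)) → ∀ B : ℝ, 0 < B →
      ∀ᶠ ε in nhds (0 : ℝ), ∀ z, ‖Ψ (ε, z)‖ ≤ B := by
    intro Ψ hΨ hΨ0 hΨp B hB
    have hK := (isCompact_closedBall (0 : ℂ) 2).eventually_forall_of_forall_eventually
      (x₀ := (0 : ℝ)) (P := fun ε z => ‖Ψ (ε, z)‖ < B) fun z _ => by
        have hc : Continuous fun x : ℝ × ℂ => ‖Ψ x‖ := hΨ.continuous.norm
        exact (hc.tendsto (0, z)).eventually_lt_const (by simpa [hΨ0] using hB)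
    filter_upwards [hK] with ε hε z
    obtain ⟨n, hn⟩ := exists_freq_add_mem_closedBall z
    have := hΨp ε n z
    simp only at this
    rw [← this]
    exact (hε _ hn).le
  obtain ⟨B, hB, hBη⟩ : ∃ B : ℝ, 0 < B ∧ ENNReal.ofReal (2 ^ (0 + 3) * B) * freqConst < η := by
    have ht : Filter.Tendsto (fun B : ℝ => ENNReal.ofReal (2 ^ (0 + 3) * B) * freqConst) (nhds 0)
        (nhds (ENNReal.ofReal (2 ^ (0 + 3) * 0) * freqConst)) := by
      refine ENNReal.Tendsto.mul_const ?_ (Or.inr freqConst_ne_top)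
      refine ENNReal.tendsto_ofReal ?_
      exact (continuous_const.mul continuous_id).tendsto 0
    have hev := (ht.eventually_lt_const (u := η) (by simpa using hη)).filter_mono
      (nhdsWithin_le_nhds (s := Set.Ioi 0))
    obtain ⟨B, h1, h2⟩ := (hev.and self_mem_nhdsWithin).exists
    exact ⟨B, h2, h1⟩
  choose Ψ hΨ hΨe using fun j => exists_contDiff_iterate_partialD hΦ j (0 + 3)
  have hz : (fun z : ℂ => Φ (0, z)) = fun _ => 0 := by funext z; simp [hΦd, h0]
  have hit : ∀ (j : Fin 2) (k : ℕ), (partialD j)^[k] (fun _ : ℂ => (0 : ℂ)) = fun _ => 0 := by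
    intro j k
    induction k with
    | zero => rfl
    | succ k ih => rw [Function.iterate_succ_apply', ih]; funext z; simp [partialD]
  have e0 := hunif Φ hΦ (fun z => congrFun hz z) hperΦ B hB
  have e1 : ∀ j, ∀ᶠ ε in nhds (0 : ℝ), ∀ z, ‖Ψ j (ε, z)‖ ≤ B := by
    intro j
    refine hunif (Ψ j) (hΨ j) (fun z => ?_) (fun ε => ?_) B hB
    · rw [← hΨe, hz, hit]
    · rw [← funext (hΨe j ε)]
      exact (hperΦ ε).iterate_partialD j _
  have hev := ((e0.and ((e1 0).and (e1 1))).filter_mono (nhdsWithin_le_nhds (s := Set.Ioi 0)))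
  obtain ⟨ε, ⟨h1, h2, h3⟩, h4⟩ := (hev.and self_mem_nhdsWithin).exists
  refine ⟨ε, h4, lt_of_le_of_lt (wnorm_periodicCoeff_le (hperΦ ε)
    (hΦ.comp (contDiff_const.prodMk contDiff_id)) 0 h1 fun j z => ?_) hBη⟩
  rw [hΨe]
  fin_cases j
  · exact h2 z
  · exact h3 z

lemma dz_dzbar_comp_smul {u : ℂ → ℂ} (hu : Differentiable ℝ u) {c : ℝ} (hc : c ≠ 0) (z : ℂ) :
    dz (fun z => c⁻¹ • u (c • z)) z = dz u (c • z) ∧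
      dzbar (fun z => c⁻¹ • u (c • z)) z = dzbar u (c • z) := by
  have h1 : HasFDerivAt (fun z : ℂ => c • z) (c • ContinuousLinearMap.id ℝ ℂ) z :=
    (hasFDerivAt_id z).const_smul c
  have h2 := ((hu (c • z)).hasFDerivAt.comp z h1).const_smul c⁻¹
  have h3 : ∀ v, fderiv ℝ (fun z => c⁻¹ • u (c • z)) z v = fderiv ℝ u (c • z) v := by
    intro v
    have := congrArg (fun L => L v) h2.fderiv
    simp only [smul_apply, ContinuousLinearMap.comp_apply,
      ContinuousLinearMap.id_apply, map_smul, smul_smul, inv_mul_cancel₀ hc, one_smul] at this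
    exact this
  constructor
  · simp only [dz, h3]
  · simp only [dzbar, h3]

/-- Local solvability of the inhomogeneous Beltrami equation `u_z̄ = μ u_z + f` with smooth
coefficients near a zero of `μ`, with a bound on the derivative of the solution if `f = μ`. -/
theorem exists_beltrami_solution {μ f : ℂ → ℂ} (hμ : ContDiff ℝ ∞ μ) (hf : ContDiff ℝ ∞ f)
    (h0 : μ 0 = 0) :
    ∃ u : ℂ → ℂ, ContDiff ℝ ∞ u ∧ (∀ᶠ z in nhds 0, dzbar u z = μ z * dz u z + f z) ∧
      (f = μ → ‖dz u 0‖ < 1) := by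
  obtain ⟨P, hP, hper, hid⟩ := exists_periodic_plane_map
  obtain ⟨ε, hε, hlt⟩ := exists_scale_wnorm_lt hμ h0 hP hper (η := 1 / 3)
    (ENNReal.div_pos one_ne_zero (by simp))
  have hlt1 : wnorm 1 0 (periodicCoeff fun z => μ (ε • P z)) < 1 :=
    hlt.trans_le (ENNReal.div_le_of_le_mul (by norm_num))
  have hsm : ∀ {g : ℂ → ℂ}, ContDiff ℝ ∞ g → ContDiff ℝ ∞ fun z => g (ε • P z) := fun hg =>
    hg.comp (hP.const_smul ε)
  have hpe : ∀ g : ℂ → ℂ, LatticePeriodic fun z => g (ε • P z) := fun g n z => by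
    simp only [hper]
  have hRμ := rapidDecay_periodicCoeff (hpe μ) (hsm hμ)
  have hRf := rapidDecay_periodicCoeff (hpe f) (hsm hf)
  obtain ⟨u, hu, heq, hbd⟩ := exists_beltrami_series hRμ hRf hlt1
  have hε' : ε⁻¹ ≠ 0 := inv_ne_zero hε.ne'
  have hdiff := hu.differentiable (n := ∞) (by simp)
  refine ⟨fun z => (ε⁻¹)⁻¹ • u (ε⁻¹ • z), (hu.comp
    (contDiff_id.const_smul ε⁻¹)).const_smul _, ?_, ?_⟩
  · have hc : Filter.Tendsto (fun z : ℂ => ε⁻¹ • z) (nhds 0) (nhds 0) := by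
      have : Continuous fun z : ℂ => ε⁻¹ • z := continuous_const_smul _
      simpa using this.tendsto 0
    filter_upwards [hc.eventually hid] with z hz
    rw [(dz_dzbar_comp_smul hdiff hε' z).1, (dz_dzbar_comp_smul hdiff hε' z).2, heq,
      hasSum_periodicCoeff (hpe μ) (hsm hμ).continuous hRμ,
      hasSum_periodicCoeff (hpe f) (hsm hf).continuous hRf, hz, id, smul_smul,
      mul_inv_cancel₀ hε.ne', one_smul]
  · rintro rfl
    rw [(dz_dzbar_comp_smul hdiff hε' 0).1]
    have h1 := hbd (ε⁻¹ • 0)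
    have h2 : (1 - wnorm 1 0 (periodicCoeff fun z => f (ε • P z)))⁻¹
        * wnorm 1 0 (periodicCoeff fun z => f (ε • P z)) < 1 := by
      set x := wnorm 1 0 (periodicCoeff fun z => f (ε • P z))
      rw [mul_comm, ← div_eq_mul_inv]
      refine ENNReal.div_lt_of_lt_mul ?_
      rw [one_mul, lt_tsub_iff_right]
      calc x + x < 1 / 3 + 1 / 3 := ENNReal.add_lt_add hlt hlt
        _ = 2 / 3 := by rw [← ENNReal.add_div]; norm_num
        _ ≤ 1 := ENNReal.div_le_of_le_mul (by norm_num)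
    have h3 := h1.trans_lt h2
    rw [← ofReal_norm, ENNReal.ofReal_lt_one] at h3
    exact h3

/-! ### Local diffeomorphisms and flows of smooth vector fields -/

/-- The smooth inverse function theorem, with a neighbourhood on which the inverse is smooth. -/
theorem exists_smooth_local_inverse {E F : Type*} [NormedAddCommGroup E] [NormedSpace ℝ E]
    [CompleteSpace E] [NormedAddCommGroup F] [NormedSpace ℝ F] {f : E → F} {U : Set E}
    (hU : IsOpen U) (hf : ContDiffOn ℝ ∞ f U) {a : E} (ha : a ∈ U) (f' : E ≃L[ℝ] F)
    (hf' : HasFDerivAt f (f' : E →L[ℝ] F) a) :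
    ∃ e : OpenPartialHomeomorph E F, a ∈ e.source ∧ e.source ⊆ U ∧ (e : E → F) = f ∧
      ContDiffOn ℝ ∞ e.symm e.target := by
  have hfa : ContDiffAt ℝ ∞ f a := hf.contDiffAt (hU.mem_nhds ha)
  let e₀ := hfa.toOpenPartialHomeomorph f hf' (by simp)
  have hs : a ∈ e₀.source := hfa.mem_toOpenPartialHomeomorph_source hf' (by simp)
  have he₀ : (e₀ : E → F) = f := rfl
  set W : Set E := U ∩ {x | fderiv ℝ f x ∈ Set.range ((↑) : (E ≃L[ℝ] F) → E →L[ℝ] F)} with hW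
  have hWn : W ∈ nhds a := by
    refine Filter.inter_mem (hU.mem_nhds ha) ?_
    have hc : ContinuousAt (fderiv ℝ f) a := (hfa.fderiv_right (m := 0) (by simp)).continuousAt
    exact hc (ContinuousLinearEquiv.isOpen.mem_nhds ⟨f', hf'.fderiv.symm⟩)
  obtain ⟨V, hVW, hV, haV⟩ := mem_nhds_iff.1 hWn
  refine ⟨e₀.restrOpen V hV, ⟨hs, haV⟩, fun x hx => (hVW hx.2).1, rfl, ?_⟩
  intro y hy
  have hy' : e₀.symm y ∈ V := by
    have := (e₀.restrOpen V hV).map_target hy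
    exact this.2
  obtain ⟨L, hL⟩ := (hVW hy').2
  have hcd : ContDiffAt ℝ ∞ f (e₀.symm y) := hf.contDiffAt (hU.mem_nhds (hVW hy').1)
  refine ((e₀.restrOpen V hV).contDiffAt_symm (f₀' := L) hy ?_ hcd).contDiffWithinAt
  rw [hL]
  exact (hcd.differentiableAt (by simp)).hasFDerivAt

section Nemytskii

open unitInterval

variable {E F : Type} [NormedAddCommGroup E] [NormedSpace ℝ E]
  [NormedAddCommGroup F] [NormedSpace ℝ F]

/-- Constant curves. -/
def constCurve (E : Type) [NormedAddCommGroup E] [NormedSpace ℝ E] : E →L[ℝ] C(I, E) :=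
  LinearMap.mkContinuous
    { toFun := fun x => ContinuousMap.const I x
      map_add' := fun _ _ => rfl
      map_smul' := fun _ _ => rfl } 1 fun x => by
    rw [one_mul]
    exact (ContinuousMap.norm_le _ (norm_nonneg _)).2 fun s => le_rfl

/-- Pointwise application of a curve of linear maps to a curve of vectors. -/
def curveApply (E F : Type) [NormedAddCommGroup E] [NormedSpace ℝ E]
    [NormedAddCommGroup F] [NormedSpace ℝ F] :
    C(I, E →L[ℝ] F) →L[ℝ] C(I, E) →L[ℝ] C(I, F) :=
  LinearMap.mkContinuous₂
    (LinearMap.mk₂ ℝ (fun (A : C(I, E →L[ℝ] F)) (h : C(I, E)) =>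
        (⟨fun s => A s (h s), A.continuous.clm_apply h.continuous⟩ : C(I, F)))
      (fun _ _ _ => rfl) (fun _ _ _ => rfl) (fun _ _ _ => by ext; simp)
      (fun _ _ _ => by ext; simp)) 1 fun A h => by
    rw [one_mul]
    refine (ContinuousMap.norm_le _ (by positivity)).2 fun s => ?_
    exact ((A s).le_opNorm _).trans (by gcongr <;> exact ContinuousMap.norm_coe_le_norm _ s)

lemma curveApply_apply (A : C(I, E →L[ℝ] F)) (h : C(I, E)) (s : I) :
    curveApply E F A h s = A s (h s) := rfl

/-- Composition with `f` is differentiable on continuous curves for the sup norm, the derivative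
being pointwise application of `fderiv ℝ f` along the curve. -/
lemma hasFDerivAt_comp_curve {f : E → F} (hf : ContDiff ℝ ∞ f) (γ : C(I, E)) :
    HasFDerivAt (fun γ : C(I, E) => (⟨f, hf.continuous⟩ : C(E, F)).comp γ)
      (curveApply E F ((⟨fderiv ℝ f, (hf.continuous_fderiv (by simp))⟩ :
        C(E, E →L[ℝ] F)).comp γ)) γ := by
  rw [hasFDerivAt_iff_isLittleO_nhds_zero, Asymptotics.isLittleO_iff]
  intro c hc
  set N : C(I, E) → C(I, E →L[ℝ] F) := fun γ =>
    (⟨fderiv ℝ f, (hf.continuous_fderiv (by simp))⟩ : C(E, E →L[ℝ] F)).comp γ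
  have hN : Continuous N := ContinuousMap.continuous_postcomp _
  obtain ⟨δ, hδ, hball⟩ := (Metric.continuousAt_iff (f := N) (a := γ)).1 hN.continuousAt c hc
  filter_upwards [Metric.ball_mem_nhds (0 : C(I, E)) hδ] with h hh
  rw [mem_ball_zero_iff] at hh
  refine (ContinuousMap.norm_le _ (by positivity)).2 fun s => ?_
  have hseg : ∀ x ∈ segment ℝ (γ s) (γ s + h s), ‖fderiv ℝ f x - fderiv ℝ f (γ s)‖ ≤ c := by
    intro x hx
    rw [segment_eq_image'] at hx
    obtain ⟨t, ht, rfl⟩ := hx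
    have hd : dist (γ + t • h) γ < δ := by
      rw [dist_eq_norm, add_sub_cancel_left, norm_smul, Real.norm_of_nonneg ht.1]
      exact (mul_le_of_le_one_left (norm_nonneg _) ht.2).trans_lt hh
    have h1 := ContinuousMap.dist_apply_le_dist (f := N (γ + t • h)) (g := N γ) s
    rw [dist_eq_norm] at h1
    simpa [N] using h1.trans (hball hd).le
  have hmv := Convex.norm_image_sub_le_of_norm_fderiv_le' (𝕜 := ℝ) (f := f)
    (fun x _ => (hf.differentiable (by simp)) x) hseg
    (convex_segment _ _) (left_mem_segment ℝ _ _) (right_mem_segment ℝ _ _)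
  simp only [add_sub_cancel_left] at hmv
  exact hmv.trans (by gcongr; exact ContinuousMap.norm_coe_le_norm h s)

/-- Composition with a smooth map is a smooth operation on continuous curves. -/
lemma contDiff_comp_curve {f : E → F} (hf : ContDiff ℝ ∞ f) :
    ContDiff ℝ ∞ (fun γ : C(I, E) => (⟨f, hf.continuous⟩ : C(E, F)).comp γ) := by
  rw [contDiff_infty]
  intro k
  induction k generalizing F with
  | zero => exact contDiff_zero.2 (ContinuousMap.continuous_postcomp _)
  | succ k ih =>
    push_cast
    rw [contDiff_succ_iff_fderiv]
    refine ⟨fun γ => (hasFDerivAt_comp_curve hf γ).differentiableAt, by simp, ?_⟩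
    rw [show fderiv ℝ (fun γ : C(I, E) => (⟨f, hf.continuous⟩ : C(E, F)).comp γ)
      = fun γ => curveApply E F ((⟨fderiv ℝ f, (hf.continuous_fderiv (by simp))⟩ :
        C(E, E →L[ℝ] F)).comp γ) from funext fun γ => (hasFDerivAt_comp_curve hf γ).fderiv]
    exact (ContinuousLinearMap.contDiff (E := C(I, E →L[ℝ] F)) (F := C(I, E) →L[ℝ] C(I, F))
      (curveApply E F)).comp (ih (hf.fderiv_right (m := ∞) (by simp)))

variable [CompleteSpace E]

/-- The primitive of a curve that vanishes at the initial time. -/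
def curvePrimitive (E : Type) [NormedAddCommGroup E] [NormedSpace ℝ E] [CompleteSpace E] :
    C(I, E) →L[ℝ] C(I, E) :=
  LinearMap.mkContinuous
    { toFun := fun γ => ⟨fun s => ∫ τ in (0 : ℝ)..s, γ.IccExtend zero_le_one τ, by
        have : Continuous fun s : ℝ => ∫ τ in (0 : ℝ)..s, γ.IccExtend zero_le_one τ :=
          intervalIntegral.continuous_primitive
            (fun a b => (ContinuousMap.continuous _).intervalIntegrable a b) 0
        exact this.comp continuous_subtype_val⟩
      map_add' := fun γ η => by
        ext s
        exact intervalIntegral.integral_add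
          ((γ.continuous.comp continuous_projIcc).intervalIntegrable _ _)
          ((η.continuous.comp continuous_projIcc).intervalIntegrable _ _)
      map_smul' := fun c γ => by
        ext s
        exact intervalIntegral.integral_smul c _ } 1 fun γ => by
    rw [one_mul]
    refine (ContinuousMap.norm_le _ (norm_nonneg _)).2 fun s => ?_
    refine (intervalIntegral.norm_integral_le_of_norm_le_const (C := ‖γ‖) fun τ _ =>
      ContinuousMap.norm_coe_le_norm γ _).trans ?_
    rw [sub_zero, abs_of_nonneg s.2.1]
    exact mul_le_of_le_one_right (norm_nonneg _) s.2.2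

lemma curvePrimitive_apply (γ : C(I, E)) (s : I) :
    curvePrimitive E γ s = ∫ τ in (0 : ℝ)..s, γ (Set.projIcc 0 1 zero_le_one τ) := rfl

end Nemytskii

section Flow

open unitInterval

variable {E : Type} [NormedAddCommGroup E] [NormedSpace ℝ E]

/-- The defect of a curve as a solution on `[0, 1]` of the equation `γ' = t v(γ)`, `γ(0) = x`. -/
def flowDefect [CompleteSpace E] (v : C(E, E)) (q : (ℝ × E) × C(I, E)) : C(I, E) :=
  q.2 - constCurve E q.1.2 - q.1.1 • curvePrimitive E (v.comp q.2)

lemma flowDefect_eq_zero_iff [CompleteSpace E] (v : C(E, E)) (t : ℝ) (x : E) (γ : C(I, E)) :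
    flowDefect v ((t, x), γ) = 0 ↔
      ∀ s : I, γ s = x + t • ∫ τ in (0 : ℝ)..s, v (γ (Set.projIcc 0 1 zero_le_one τ)) := by
  rw [flowDefect, sub_sub, sub_eq_zero, DFunLike.ext_iff]
  rfl

/-- Local solutions of an ordinary differential equation depend smoothly on time and on the
initial value.  The solution is found by the inverse function theorem in the space of curves. -/
theorem exists_smooth_flow [CompleteSpace E] {v : E → E} (hv : ContDiff ℝ ∞ v) (x₀ : E) :
    ∃ (Fl : ℝ × E → E) (U : Set (ℝ × E)), IsOpen U ∧ (0, x₀) ∈ U ∧ ContDiffOn ℝ ∞ Fl U ∧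
      (∀ x, (0, x) ∈ U → Fl (0, x) = x) ∧
      ∀ p ∈ U, HasDerivAt (fun t => Fl (t, p.2)) (v (Fl p)) p.1 := by
  set vc : C(E, E) := ⟨v, hv.continuous⟩
  set γ₀ : C(I, E) := constCurve E x₀
  let Ψ : (ℝ × E) × C(I, E) → (ℝ × E) × C(I, E) := fun q => (q.1, flowDefect vc q)
  have hN : ContDiff ℝ ∞ fun q : (ℝ × E) × C(I, E) => curvePrimitive E (vc.comp q.2) :=
    (curvePrimitive E).contDiff.comp ((contDiff_comp_curve hv).comp contDiff_snd)
  have hΨ : ContDiff ℝ ∞ Ψ := by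
    refine contDiff_fst.prodMk ?_
    exact (contDiff_snd.sub ((constCurve E).contDiff.comp (contDiff_snd.comp contDiff_fst))).sub
      ((contDiff_fst.comp contDiff_fst).smul hN)
  let a : (ℝ × E) × C(I, E) := ((0, x₀), γ₀)
  let L : (ℝ × E) →L[ℝ] C(I, E) := -((constCurve E).comp (ContinuousLinearMap.snd ℝ ℝ E))
    - (ContinuousLinearMap.fst ℝ ℝ E).smulRight (curvePrimitive E (vc.comp γ₀))
  let Ψ' : ((ℝ × E) × C(I, E)) ≃L[ℝ] ((ℝ × E) × C(I, E)) :=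
    (ContinuousLinearEquiv.refl ℝ (ℝ × E)).skewProd (ContinuousLinearEquiv.refl ℝ C(I, E)) L
  have hΨ' : HasFDerivAt Ψ (Ψ' : (ℝ × E) × C(I, E) →L[ℝ] (ℝ × E) × C(I, E)) a := by
    have h1 : HasFDerivAt (fun q : (ℝ × E) × C(I, E) => q.2) (ContinuousLinearMap.snd ℝ _ _) a :=
      hasFDerivAt_snd
    have h2 : HasFDerivAt (fun q : (ℝ × E) × C(I, E) => constCurve E q.1.2)
      ((constCurve E).comp ((ContinuousLinearMap.snd ℝ ℝ E).comp
        (ContinuousLinearMap.fst ℝ _ C(I, E)))) a :=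
      ((constCurve E).comp ((ContinuousLinearMap.snd ℝ ℝ E).comp
        (ContinuousLinearMap.fst ℝ _ C(I, E)))).hasFDerivAt
    have h3 : HasFDerivAt (fun q : (ℝ × E) × C(I, E) => q.1.1)
      ((ContinuousLinearMap.fst ℝ ℝ E).comp (ContinuousLinearMap.fst ℝ _ C(I, E))) a :=
      ((ContinuousLinearMap.fst ℝ ℝ E).comp (ContinuousLinearMap.fst ℝ _ C(I, E))).hasFDerivAt
    have h4 := h3.smul ((hN.differentiable (by simp)) a).hasFDerivAt
    have h5 := hasFDerivAt_fst.prodMk ((h1.sub h2).sub h4)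
    refine h5.congr_fderiv ?_
    refine ContinuousLinearMap.ext fun w => ?_
    refine Prod.ext rfl ?_
    simp only [Ψ', L, a, ContinuousLinearMap.prod_apply, sub_apply,
      ContinuousLinearEquiv.coe_coe, ContinuousLinearEquiv.skewProd_apply,
      ContinuousLinearEquiv.refl_apply, neg_apply,
      ContinuousLinearMap.comp_apply, ContinuousLinearMap.smulRight_apply,
      ContinuousLinearMap.coe_fst', ContinuousLinearMap.coe_snd', zero_smul, zero_add]
    abel
  obtain ⟨e, hae, -, heΨ, hesm⟩ := exists_smooth_local_inverse isOpen_univ hΨ.contDiffOn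
    (Set.mem_univ a) Ψ' hΨ'
  have hΨa : Ψ a = ((0, x₀), 0) := by
    refine Prod.ext rfl ?_
    simp [Ψ, a, flowDefect, γ₀]
  -- the solution curve with parameters `p`, as long as the local inverse is defined
  let sol : ℝ × E → C(I, E) := fun p => (e.symm (p, 0)).2
  let T : Set (ℝ × E) := {p | (p, (0 : C(I, E))) ∈ e.target}
  have hTo : IsOpen T := e.open_target.preimage (Continuous.prodMk continuous_id continuous_const)
  have haT : (0, x₀) ∈ T := by
    have := e.map_source hae
    rw [heΨ, hΨa] at this
    exact this
  have hsol : ContDiffOn ℝ ∞ sol T := by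
    refine contDiff_snd.comp_contDiffOn (hesm.comp ?_ fun p hp => hp)
    exact (contDiff_id.prodMk contDiff_const).contDiffOn
  have hsol_mem : ∀ p ∈ T, (p, sol p) ∈ e.source ∧ flowDefect vc (p, sol p) = 0 := by
    intro p hp
    have h1 := e.map_target hp
    have h2 := e.right_inv hp
    rw [heΨ] at h2
    have h3 : (e.symm (p, 0)).1 = p := congrArg Prod.fst h2
    have h4 : e.symm (p, 0) = (p, sol p) := Prod.ext h3 rfl
    rw [h4] at h1 h2
    exact ⟨h1, congrArg Prod.snd h2⟩
  have hsol_unique : ∀ p ∈ T, ∀ γ : C(I, E), (p, γ) ∈ e.source → flowDefect vc (p, γ) = 0 →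
      γ = sol p := by
    intro p hp γ h1 h2
    have h3 : e (p, γ) = e (p, sol p) := by
      rw [heΨ]
      simp only [Ψ, h2, (hsol_mem p hp).2]
    exact congrArg Prod.snd (e.injOn h1 (hsol_mem p hp).1 h3)
  have hsol0 : sol (0, x₀) = γ₀ := by
    refine (hsol_unique _ haT γ₀ hae ?_).symm
    exact congrArg Prod.snd hΨa
  obtain ⟨δ, hδ, hball⟩ := Metric.isOpen_iff.1 e.open_source a hae
  have hn1 : {p | p ∈ T ∧ dist (sol p) γ₀ < δ} ∈ nhds ((0 : ℝ), x₀) := by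
    refine Filter.inter_mem (hTo.mem_nhds haT) ?_
    have hc : ContinuousAt sol (0, x₀) := (hsol.contDiffAt (hTo.mem_nhds haT)).continuousAt
    have := hc (Metric.ball_mem_nhds _ hδ)
    rwa [hsol0] at this
  obtain ⟨r, hr, hrn⟩ := Metric.mem_nhds_iff.1
    (Filter.inter_mem hn1 (Metric.ball_mem_nhds ((0 : ℝ), x₀) hδ))
  have hbox : ∀ p ∈ Metric.ball ((0 : ℝ), x₀) r, ∀ s ∈ Set.Icc (0 : ℝ) 1,
      (p.1 * s, p.2) ∈ Metric.ball ((0 : ℝ), x₀) r := by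
    intro p hp s hs
    rw [Metric.mem_ball, Prod.dist_eq, max_lt_iff] at hp ⊢
    refine ⟨lt_of_le_of_lt ?_ hp.1, hp.2⟩
    simp only [dist_zero_right, norm_mul]
    exact mul_le_of_le_one_right (norm_nonneg _) (by rw [Real.norm_of_nonneg hs.1]; exact hs.2)
  have hscale : ∀ p ∈ Metric.ball ((0 : ℝ), x₀) r, ∀ s : I, sol (p.1 * s, p.2) 1 = sol p s := by
    intro p hp s
    let η : C(I, E) := ⟨fun s' => sol p (s * s'), by fun_prop⟩
    have hη : η = sol (p.1 * s, p.2) := by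
      have hmem := hrn (hbox p hp s s.2)
      refine hsol_unique _ hmem.1.1 η (hball ?_) ?_
      · rw [Metric.mem_ball, Prod.dist_eq, max_lt_iff]
        refine ⟨hmem.2, lt_of_le_of_lt ?_ (hrn hp).1.2⟩
        refine (ContinuousMap.dist_le dist_nonneg).2 fun s' => ?_
        exact ContinuousMap.dist_apply_le_dist (f := sol p) (g := γ₀) (s * s')
      · rw [flowDefect_eq_zero_iff]
        intro s'
        have h1 := (flowDefect_eq_zero_iff vc p.1 p.2 (sol p)).1 (hsol_mem p (hrn hp).1.1).2 (s * s')
        have h2 := intervalIntegral.smul_integral_comp_mul_left (a := 0) (b := (s' : ℝ))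
          (fun τ => vc (sol p (Set.projIcc 0 1 zero_le_one τ))) (s : ℝ)
        rw [mul_zero] at h2
        change sol p (s * s') = _
        rw [h1, Set.Icc.coe_mul, ← h2, smul_smul]
        congr 2
        refine intervalIntegral.integral_congr fun τ hτ => ?_
        rw [Set.uIcc_of_le s'.2.1] at hτ
        have hτ1 : τ ∈ Set.Icc (0 : ℝ) 1 := ⟨hτ.1, hτ.2.trans s'.2.2⟩
        have hτ2 : (s : ℝ) * τ ∈ Set.Icc (0 : ℝ) 1 := unitInterval.mul_mem s.2 hτ1
        simp only [η, ContinuousMap.coe_mk]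
        rw [Set.projIcc_of_mem _ hτ1, Set.projIcc_of_mem _ hτ2]
        rfl
    rw [← hη]
    simp [η]
  let Fl : ℝ × E → E := fun p => sol p 1
  let ev : C(I, E) →L[ℝ] E := ContinuousMap.evalCLM ℝ (1 : I)
  have hFl : ContDiffOn ℝ ∞ Fl (Metric.ball ((0 : ℝ), x₀) r) :=
    ev.contDiff.comp_contDiffOn (hsol.mono fun p hp => (hrn hp).1.1)
  have hint : ∀ p ∈ Metric.ball ((0 : ℝ), x₀) r,
      Fl p = p.2 + ∫ τ in (0 : ℝ)..p.1, v (Fl (τ, p.2)) := by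
    intro p hp
    have h1 := (flowDefect_eq_zero_iff vc p.1 p.2 (sol p)).1 (hsol_mem p (hrn hp).1.1).2 1
    have h2 := intervalIntegral.smul_integral_comp_mul_left (a := 0) (b := 1)
      (fun τ => v (Fl (τ, p.2))) p.1
    rw [mul_zero, mul_one] at h2
    change sol p 1 = _
    rw [h1, ← h2]
    congr 2
    refine intervalIntegral.integral_congr fun τ hτ => ?_
    simp only [Set.Icc.coe_one] at hτ
    rw [Set.uIcc_of_le zero_le_one] at hτ
    have := hscale p hp ⟨τ, hτ⟩
    simp only [Fl, Set.projIcc_of_mem _ hτ]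
    rw [this]
    rfl
  refine ⟨Fl, Metric.ball (0, x₀) r, Metric.isOpen_ball, Metric.mem_ball_self hr, hFl, ?_, ?_⟩
  · intro x hx
    have := hint (0, x) hx
    simpa using this
  · intro p hp
    have hline : ∀ t ∈ Metric.ball (0 : ℝ) r, (t, p.2) ∈ Metric.ball ((0 : ℝ), x₀) r := by
      intro t ht
      rw [Metric.mem_ball, Prod.dist_eq, max_lt_iff] at hp ⊢
      exact ⟨ht, hp.2⟩
    have hp1 : p.1 ∈ Metric.ball (0 : ℝ) r := by
      rw [Metric.mem_ball, Prod.dist_eq, max_lt_iff] at hp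
      exact hp.1
    have hcont : ContinuousOn (fun τ => v (Fl (τ, p.2))) (Metric.ball (0 : ℝ) r) :=
      hv.continuous.comp_continuousOn (hFl.continuousOn.comp
        (Continuous.prodMk continuous_id continuous_const).continuousOn hline)
    have hsub : Set.uIcc 0 p.1 ⊆ Metric.ball (0 : ℝ) r := by
      have : Convex ℝ (Metric.ball (0 : ℝ) r) := convex_ball _ _
      rw [← segment_eq_uIcc]
      exact this.segment_subset (Metric.mem_ball_self hr) hp1
    have h1 := intervalIntegral.integral_hasDerivAt_right
      (hcont.mono hsub).intervalIntegrable
      (hcont.stronglyMeasurableAtFilter Metric.isOpen_ball _ hp1)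
      (hcont.continuousAt (Metric.isOpen_ball.mem_nhds hp1))
    refine (h1.const_add p.2).congr_of_eventuallyEq ?_
    filter_upwards [Metric.isOpen_ball.mem_nhds hp1] with t ht
    exact hint (t, p.2) (hline t ht)

/-- Integrals with smooth parameters are smooth. -/
theorem exists_smooth_primitive {F : Type} [NormedAddCommGroup F] [NormedSpace ℝ F]
    [CompleteSpace F] {f : ℝ × E → F} (hf : ContDiff ℝ ∞ f) :
    ∃ H : ℝ × E → F, ContDiff ℝ ∞ H ∧
      ∀ p : ℝ × E, HasDerivAt (fun t => H (t, p.2)) (f p) p.1 := by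
  let line : ℝ × E → C(I, ℝ × E) := fun p => ⟨fun s => ((s : ℝ) * p.1, p.2), by fun_prop⟩
  have hline : ContDiff ℝ ∞ line := by
    let l : (ℝ × E) →L[ℝ] C(I, ℝ × E) := LinearMap.mkContinuous
      { toFun := line
        map_add' := fun p q => by ext s <;> simp [line, mul_add]
        map_smul' := fun c p => by ext s <;> simp [line]; ring } 1 fun p => by
      rw [one_mul]
      refine (ContinuousMap.norm_le _ (norm_nonneg _)).2 fun s => ?_
      rw [Prod.norm_def, Prod.norm_def]
      refine max_le_max ?_ le_rfl
      simp only [line, LinearMap.coe_mk, AddHom.coe_mk, ContinuousMap.coe_mk, norm_mul]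
      exact mul_le_of_le_one_left (norm_nonneg _) (by
        rw [Real.norm_of_nonneg s.2.1]; exact s.2.2)
    exact l.contDiff
  let H : ℝ × E → F := fun p =>
    p.1 • curvePrimitive F ((⟨f, hf.continuous⟩ : C(ℝ × E, F)).comp (line p)) 1
  have hH : ContDiff ℝ ∞ H := by
    refine contDiff_fst.smul ?_
    exact (ContinuousMap.evalCLM ℝ (1 : I)).contDiff.comp ((curvePrimitive F).contDiff.comp
      ((contDiff_comp_curve hf).comp hline))
  have hint : ∀ p : ℝ × E, H p = ∫ τ in (0 : ℝ)..p.1, f (τ, p.2) := by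
    intro p
    have h2 := intervalIntegral.smul_integral_comp_mul_left (a := 0) (b := 1)
      (fun τ => f (τ, p.2)) p.1
    rw [mul_zero, mul_one] at h2
    rw [← h2]
    simp only [H, curvePrimitive_apply, Set.Icc.coe_one]
    congr 1
    refine intervalIntegral.integral_congr fun τ hτ => ?_
    rw [Set.uIcc_of_le zero_le_one] at hτ
    simp only [Set.projIcc_of_mem _ hτ, ContinuousMap.comp_apply, ContinuousMap.coe_mk, line,
      mul_comm]
  refine ⟨H, hH, fun p => ?_⟩
  have hc : Continuous fun τ => f (τ, p.2) :=
    hf.continuous.comp (Continuous.prodMk continuous_id continuous_const)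
  refine (intervalIntegral.integral_hasDerivAt_right (hc.intervalIntegrable 0 p.1)
    (hc.stronglyMeasurableAtFilter _ _) hc.continuousAt).congr_of_eventuallyEq ?_
  exact Filter.Eventually.of_forall fun t => hint (t, p.2)

end Flow

/-! ### Exterior derivatives and pull-backs of one-forms -/

section FormsCalculus

variable {E : Type*} [NormedAddCommGroup E] [NormedSpace ℝ E]
variable {N : Type*} [TopologicalSpace N] [ChartedSpace E N]
variable {E' : Type*} [NormedAddCommGroup E'] [NormedSpace ℝ E']
variable {N' : Type*} [TopologicalSpace N'] [ChartedSpace E' N']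

/-- The exterior derivative of a one-form on a vector space, as an antisymmetrised derivative. -/
def curl (A : E → E →L[ℝ] ℂ) (x u v : E) : ℂ := fderiv ℝ A x u v - fderiv ℝ A x v u

theorem curl_congr {A B : E → E →L[ℝ] ℂ} {x : E} (h : A =ᶠ[nhds x] B) : curl A x = curl B x := by
  funext u v
  simp only [curl, h.fderiv_eq]

/-- `d` commutes with pull-back: the second derivative of `g` is symmetric and drops out. -/
theorem curl_pullback {B : E' → E' →L[ℝ] ℂ} {g : E → E'} {x : E}
    (hB : DifferentiableAt ℝ B (g x)) (hg : ContDiffAt ℝ 2 g x) (u v : E) :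
    curl (fun y => (B (g y)).comp (fderiv ℝ g y)) x u v
      = curl B (g x) (fderiv ℝ g x u) (fderiv ℝ g x v) := by
  have h1 : HasFDerivAt g (fderiv ℝ g x) x := (hg.differentiableAt (by norm_num)).hasFDerivAt
  have h2 : DifferentiableAt ℝ (fderiv ℝ g) x :=
    (hg.fderiv_right (m := 1) (by norm_num)).differentiableAt (by norm_num)
  have h3 := (hB.hasFDerivAt.comp x h1).clm_comp h2.hasFDerivAt
  have hs : IsSymmSndFDerivAt ℝ g x := hg.isSymmSndFDerivAt (by simp)
  have h4 := hs u v
  simp only [curl]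
  erw [h3.fderiv]
  simp [h4]

theorem extDeriv_ofSubsingleton {A : E → E →L[ℝ] ℂ} {x : E} (h : DifferentiableAt ℝ A x)
    (u v : E) :
    extDeriv (fun y : E => ContinuousAlternatingMap.ofSubsingleton ℝ E ℂ (0 : Fin 1) (A y)) x
      ![u, v] = curl A x u v := by
  set L := ContinuousAlternatingMap.ofSubsingletonLIE (𝕜 := ℝ) (E := E) (F := ℂ) (0 : Fin 1)
  have hd : HasFDerivAt (fun y : E => L (A y))
      ((L.toContinuousLinearEquiv : _ →L[ℝ] _).comp (fderiv ℝ A x)) x :=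
    L.toContinuousLinearEquiv.toContinuousLinearMap.hasFDerivAt.comp _ h.hasFDerivAt
  change extDeriv (fun y : E => L (A y)) x ![u, v] = _
  rw [extDeriv, hd.fderiv, ContinuousAlternatingMap.alternatizeUncurryFin_apply]
  simp [Fin.sum_univ_succ, curl, L, Fin.removeNth, ContinuousAlternatingMap.ofSubsingletonLIE,
    sub_eq_add_neg]

theorem extD_eq_curl {α : OneForm E N} {p : N}
    (h : DifferentiableAt ℝ (chartRep (chartAt E p) α) (chartAt E p p)) :
    extD α p = fun u v => curl (chartRep (chartAt E p) α) (chartAt E p p)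
      (mfderiv 𝓘(ℝ, E) 𝓘(ℝ, E) (chartAt E p) p u)
      (mfderiv 𝓘(ℝ, E) 𝓘(ℝ, E) (chartAt E p) p v) := by
  funext u v
  exact extDeriv_ofSubsingleton h _ _

/-- Smoothness of a one-form at a point, in the preferred chart. -/
def SmoothFormAt (α : OneForm E N) (p : N) : Prop :=
  ContDiffAt ℝ ∞ (chartRep (chartAt E p) α) (chartAt E p p)

/-- In charts, the pull-back of a form along a manifold map is the pull-back along the map written
in those charts. -/
theorem chartRep_pullForm [IsManifold 𝓘(ℝ, E) ∞ N] [IsManifold 𝓘(ℝ, E') ∞ N']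
    {f : N → N'} {W : Set N} (hW : IsOpen W) {p : N} (hp : p ∈ W)
    (hf : ContMDiffOn 𝓘(ℝ, E) 𝓘(ℝ, E') ∞ f W) (α : OneForm E' N') :
    chartRep (chartAt E p) (pullForm f α) =ᶠ[nhds (chartAt E p p)] fun x =>
      (chartRep (chartAt E' (f p)) α
        ((chartAt E' (f p) ∘ f ∘ (chartAt E p).symm) x)).comp
      (fderiv ℝ (chartAt E' (f p) ∘ f ∘ (chartAt E p).symm) x) := by
  set c := chartAt E p with hc
  set c' := chartAt E' (f p) with hc'
  have hcp : p ∈ c.source := mem_chart_source E p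
  have hfp : ContinuousAt f p := (hf.contMDiffAt (hW.mem_nhds hp)).continuousAt
  have hN : c.source ∩ W ∩ f ⁻¹' c'.source ∈ nhds p :=
    Filter.inter_mem (Filter.inter_mem (c.open_source.mem_nhds hcp) (hW.mem_nhds hp))
      (hfp.preimage_mem_nhds (c'.open_source.mem_nhds (mem_chart_source E' (f p))))
  have hcs : Filter.Tendsto c.symm (nhds (c p)) (nhds p) := by
    have := c.continuousAt_symm (c.map_source hcp)
    rwa [ContinuousAt, c.left_inv hcp] at this
  filter_upwards [hcs hN, c.open_target.mem_nhds (c.map_source hcp)] with x hx hxt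
  obtain ⟨⟨-, hxW⟩, hxc'⟩ := hx
  have m1 : MDifferentiableAt 𝓘(ℝ, E) 𝓘(ℝ, E) c.symm x :=
    mdifferentiableAt_atlas_symm (chart_mem_atlas E p) hxt
  have m2 : MDifferentiableAt 𝓘(ℝ, E) 𝓘(ℝ, E') f (c.symm x) :=
    (hf.contMDiffAt (hW.mem_nhds hxW)).mdifferentiableAt (by norm_num)
  have m3 : MDifferentiableAt 𝓘(ℝ, E') 𝓘(ℝ, E') c' (f (c.symm x)) :=
    mdifferentiableAt_atlas (chart_mem_atlas E' (f p)) hxc'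
  have hq : c'.symm (c' (f (c.symm x))) = f (c.symm x) := c'.left_inv hxc'
  have m4 : MDifferentiableAt 𝓘(ℝ, E') 𝓘(ℝ, E') c'.symm (c' (f (c.symm x))) :=
    mdifferentiableAt_atlas_symm (chart_mem_atlas E' (f p)) (c'.map_source hxc')
  have gen : ∀ (a : N' → E' →L[ℝ] ℂ) {q q' : N'}, q = q' → a q = a q' :=
    fun a _ _ h => congrArg a h
  have hα : (α (c'.symm (c' (f (c.symm x)))) : E' →L[ℝ] ℂ) = (α (f (c.symm x)) : E' →L[ℝ] ℂ) :=
    gen α hq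
  have hid : (mfderiv 𝓘(ℝ, E') 𝓘(ℝ, E') c'.symm (c' (f (c.symm x)))).comp
      (mfderiv 𝓘(ℝ, E') 𝓘(ℝ, E') c' (f (c.symm x))) = ContinuousLinearMap.id ℝ _ :=
    (mdifferentiable_of_mem_atlas (chart_mem_atlas E' (f p))).symm_comp_deriv hxc'
  have hch : fderiv ℝ (c' ∘ f ∘ c.symm) x =
      (mfderiv 𝓘(ℝ, E') 𝓘(ℝ, E') c' (f (c.symm x))).comp
        ((mfderiv 𝓘(ℝ, E) 𝓘(ℝ, E') f (c.symm x)).comp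
          (mfderiv 𝓘(ℝ, E) 𝓘(ℝ, E) c.symm x)) := by
    rw [← mfderiv_eq_fderiv, mfderiv_comp x m3 (m2.comp x m1), mfderiv_comp x m2 m1]
    rfl
  ext u
  have hid' := fun v => congrArg (fun T : E' →L[ℝ] E' => T v) hid
  simp only [chartRep, pullForm, hch]
  have e1 := hid' (mfderiv 𝓘(ℝ, E) 𝓘(ℝ, E') f (c.symm x) (mfderiv 𝓘(ℝ, E) 𝓘(ℝ, E) c.symm x u))
  have e2 := congrArg (fun T : E' →L[ℝ] ℂ => T (mfderiv 𝓘(ℝ, E) 𝓘(ℝ, E') f (c.symm x)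
    (mfderiv 𝓘(ℝ, E) 𝓘(ℝ, E) c.symm x u))) hα
  refine e2.symm.trans ?_
  exact congrArg (fun v => (α (c'.symm (c' (f (c.symm x)))) : E' →L[ℝ] ℂ) v) e1.symm

theorem contDiffAt_inCharts [IsManifold 𝓘(ℝ, E) ∞ N] [IsManifold 𝓘(ℝ, E') ∞ N']
    {f : N → N'} {p : N} (hf : ContMDiffAt 𝓘(ℝ, E) 𝓘(ℝ, E') ∞ f p) :
    ContDiffAt ℝ ∞ (chartAt E' (f p) ∘ f ∘ (chartAt E p).symm) (chartAt E p p) := by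
  have := (contMDiffAt_iff.1 hf).2
  simpa [← contDiffWithinAt_univ] using this

theorem SmoothFormAt.pullForm [IsManifold 𝓘(ℝ, E) ∞ N] [IsManifold 𝓘(ℝ, E') ∞ N']
    {f : N → N'} {W : Set N} (hW : IsOpen W) {p : N} (hp : p ∈ W)
    (hf : ContMDiffOn 𝓘(ℝ, E) 𝓘(ℝ, E') ∞ f W) {α : OneForm E' N'}
    (hα : SmoothFormAt (E := E') α (f p)) : SmoothFormAt (E := E) (pullForm f α) p := by
  have hg := contDiffAt_inCharts (hf.contMDiffAt (hW.mem_nhds hp))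
  have h1 := chartRep_pullForm hW hp hf α
  refine ContDiffAt.congr_of_eventuallyEq ?_ h1
  refine ContDiffAt.clm_comp (ContDiffAt.comp (g := chartRep (chartAt E' (f p)) α) _ ?_ hg) (hg.fderiv_right (by simp))
  unfold SmoothFormAt at hα
  simpa [(chartAt E p).left_inv (mem_chart_source E p)] using hα

/-- The exterior derivative, defined through the preferred chart at each point, is natural. For `f`
the inverse of a chart this makes it computable in any chart. -/
theorem extD_pullForm [IsManifold 𝓘(ℝ, E) ∞ N] [IsManifold 𝓘(ℝ, E') ∞ N']
    {f : N → N'} {W : Set N} (hW : IsOpen W) {p : N} (hp : p ∈ W)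
    (hf : ContMDiffOn 𝓘(ℝ, E) 𝓘(ℝ, E') ∞ f W) {α : OneForm E' N'}
    (hα : SmoothFormAt α (f p)) (u v : TangentSpace 𝓘(ℝ, E) p) :
    extD (NullHyp.pullForm f α) p u v = extD α (f p)
      (mfderiv 𝓘(ℝ, E) 𝓘(ℝ, E') f p u) (mfderiv 𝓘(ℝ, E) 𝓘(ℝ, E') f p v) := by
  have hs := SmoothFormAt.pullForm hW hp hf hα
  have hfp := hf.contMDiffAt (hW.mem_nhds hp)
  have hg := contDiffAt_inCharts hfp
  have hl : (chartAt E p).symm (chartAt E p p) = p :=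
    (chartAt E p).left_inv (mem_chart_source E p)
  have hgp : (chartAt E' (f p) ∘ f ∘ (chartAt E p).symm) (chartAt E p p) = chartAt E' (f p) (f p) := by
    simp [hl]
  rw [extD_eq_curl (hα.differentiableAt (by simp)), extD_eq_curl (hs.differentiableAt (by simp)),
    curl_congr (chartRep_pullForm hW hp hf α)]
  beta_reduce
  refine (curl_pullback (B := chartRep (chartAt E' (f p)) α)
    (by rw [hgp]; exact hα.differentiableAt (by simp))
    (hg.of_le (by norm_cast)) _ _).trans ?_
  rw [hgp]
  have key : ∀ u, fderiv ℝ (chartAt E' (f p) ∘ f ∘ (chartAt E p).symm) (chartAt E p p)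
      (mfderiv 𝓘(ℝ, E) 𝓘(ℝ, E) (chartAt E p) p u) =
      mfderiv 𝓘(ℝ, E') 𝓘(ℝ, E') (chartAt E' (f p)) (f p) (mfderiv 𝓘(ℝ, E) 𝓘(ℝ, E') f p u) := by
    intro u
    have m0 : MDifferentiableAt 𝓘(ℝ, E) 𝓘(ℝ, E) (chartAt E p) p :=
      mdifferentiableAt_atlas (chart_mem_atlas E p) (mem_chart_source E p)
    have m2 : MDifferentiableAt 𝓘(ℝ, E) 𝓘(ℝ, E') f p := hfp.mdifferentiableAt (by norm_num)
    have m3 : MDifferentiableAt 𝓘(ℝ, E') 𝓘(ℝ, E') (chartAt E' (f p)) (f p) :=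
      mdifferentiableAt_atlas (chart_mem_atlas E' (f p)) (mem_chart_source E' (f p))
    have m1 : MDifferentiableAt 𝓘(ℝ, E) 𝓘(ℝ, E') (chartAt E' (f p) ∘ f ∘ (chartAt E p).symm)
        (chartAt E p p) := (hg.differentiableAt (by simp)).mdifferentiableAt
    have e : (chartAt E' (f p) ∘ f ∘ (chartAt E p).symm) ∘ chartAt E p =ᶠ[nhds p]
        chartAt E' (f p) ∘ f := by
      filter_upwards [(chartAt E p).open_source.mem_nhds (mem_chart_source E p)] with q hq
      simp [(chartAt E p).left_inv hq]
    have e1 := mfderiv_comp p m1 m0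
    have e2 := mfderiv_comp p m3 m2
    rw [e.mfderiv_eq, e2, mfderiv_eq_fderiv] at e1
    exact (congrArg (fun T : E →L[ℝ] E' => T u) e1).symm
  exact congrArg₂ _ (key u) (key v)

theorem chartRep_self (A : E → E →L[ℝ] ℂ) (x : E) :
    chartRep (N := E) (chartAt E x) A = A := by
  funext y
  simp only [chartRep, chartAt_self_eq]
  have : mfderiv 𝓘(ℝ, E) 𝓘(ℝ, E) (OpenPartialHomeomorph.refl E).symm y
    = ContinuousLinearMap.id ℝ E := mfderiv_id
  rw [this]
  ext u
  rfl

theorem smoothFormAt_iff_contDiffAt {A : E → E →L[ℝ] ℂ} {x : E} :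
    SmoothFormAt (N := E) A x ↔ ContDiffAt ℝ ∞ A x := by
  unfold SmoothFormAt
  rw [chartRep_self]
  rfl

theorem extD_self {A : E → E →L[ℝ] ℂ} {x : E} (h : DifferentiableAt ℝ A x) :
    extD (N := E) A x = curl A x := by
  have e := chartRep_self A x
  have e' : (chartAt E x : E → E) x = x := rfl
  refine (extD_eq_curl (N := E) (α := A) (p := x) (by rw [e, e']; exact h)).trans ?_
  rw [e]
  funext u v
  have e2 : mfderiv 𝓘(ℝ, E) 𝓘(ℝ, E) (chartAt E x) x = ContinuousLinearMap.id ℝ E := mfderiv_id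
  rw [e2]
  rfl

theorem dFun_self (f : E → ℂ) (x : E) : dFun (E := E) f x = fderiv ℝ f x := mfderiv_eq_fderiv

theorem pullForm_self (f : E → E') (α : E' → E' →L[ℝ] ℂ) (x : E) :
    pullForm (E := E) (N' := E') f α x = (α (f x)).comp (fderiv ℝ f x) := by
  unfold pullForm
  rw [mfderiv_eq_fderiv]
  rfl

theorem pullForm_comp {E'' : Type*} [NormedAddCommGroup E''] [NormedSpace ℝ E'']
    {N'' : Type*} [TopologicalSpace N''] [ChartedSpace E'' N''] {g : N' → N''} {f : N → N'} {p : N}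
    (hg : MDifferentiableAt 𝓘(ℝ, E') 𝓘(ℝ, E'') g (f p))
    (hf : MDifferentiableAt 𝓘(ℝ, E) 𝓘(ℝ, E') f p) (α : OneForm E'' N'') :
    pullForm (E := E) (g ∘ f) α p = pullForm (E := E) f (pullForm (E := E') g α) p := by
  unfold pullForm
  rw [mfderiv_comp p hg hf]
  rfl

theorem pullForm_dFun {f : N → N'} {g : N' → ℂ} {p : N}
    (hg : MDifferentiableAt 𝓘(ℝ, E') 𝓘(ℝ, ℂ) g (f p))
    (hf : MDifferentiableAt 𝓘(ℝ, E) 𝓘(ℝ, E') f p) :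
    pullForm (E := E) f (dFun (E := E') g) p = dFun (E := E) (g ∘ f) p := by
  unfold pullForm dFun
  rw [mfderiv_comp p hg hf]
  rfl

end FormsCalculus

/-! ### Data with vanishing `Γ41`, `Ψ0` and `Ψ1` -/

section CurlCalculus

variable {E : Type*} [NormedAddCommGroup E] [NormedSpace ℝ E]

theorem curl_add {A B : E → E →L[ℝ] ℂ} {x : E} (hA : DifferentiableAt ℝ A x)
    (hB : DifferentiableAt ℝ B x) (u v : E) :
    curl (fun y => A y + B y) x u v = curl A x u v + curl B x u v := by
  simp only [curl, fderiv_fun_add hA hB, _root_.add_apply]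
  ring

theorem curl_sub {A B : E → E →L[ℝ] ℂ} {x : E} (hA : DifferentiableAt ℝ A x)
    (hB : DifferentiableAt ℝ B x) (u v : E) :
    curl (fun y => A y - B y) x u v = curl A x u v - curl B x u v := by
  simp only [curl, fderiv_fun_sub hA hB, _root_.sub_apply]
  ring

theorem curl_smul {f : E → ℂ} {A : E → E →L[ℝ] ℂ} {x : E} (hf : DifferentiableAt ℝ f x)
    (hA : DifferentiableAt ℝ A x) (u v : E) :
    curl (fun y => f y • A y) x u v
      = fderiv ℝ f x u * A x v - fderiv ℝ f x v * A x u + f x * curl A x u v := by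
  have := (hf.hasFDerivAt.smul hA.hasFDerivAt).fderiv
  simp only [curl]
  erw [this]
  simp
  ring

theorem curl_const_smul {A : E → E →L[ℝ] ℂ} {x : E} (hA : DifferentiableAt ℝ A x) (c : ℂ)
    (u v : E) : curl (fun y => c • A y) x u v = c * curl A x u v := by
  simp only [curl, fderiv_fun_const_smul hA, _root_.smul_apply, smul_eq_mul]
  ring

theorem curl_const (A : E →L[ℝ] ℂ) (x u v : E) : curl (fun _ => A) x u v = 0 := by
  simp [curl]

theorem hasFDerivAt_conjCov {A : E → E →L[ℝ] ℂ} {x : E} (hA : DifferentiableAt ℝ A x) :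
    HasFDerivAt (fun y => conjCov (A y))
      ((ContinuousLinearMap.compL ℝ E ℂ ℂ (Complex.conjCLE : ℂ →L[ℝ] ℂ)).comp (fderiv ℝ A x)) x :=
  (ContinuousLinearMap.compL ℝ E ℂ ℂ (Complex.conjCLE : ℂ →L[ℝ] ℂ)).hasFDerivAt.comp x
    hA.hasFDerivAt

theorem contDiff_conjCov : ContDiff ℝ ∞ (fun A : E →L[ℝ] ℂ => conjCov A) :=
  (ContinuousLinearMap.compL ℝ E ℂ ℂ (Complex.conjCLE : ℂ →L[ℝ] ℂ)).contDiff

theorem curl_conjCov {A : E → E →L[ℝ] ℂ} {x : E} (hA : DifferentiableAt ℝ A x) (u v : E) :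
    curl (fun y => conjCov (A y)) x u v = starRingEnd ℂ (curl A x u v) := by
  simp only [curl, (hasFDerivAt_conjCov hA).fderiv]
  simp

theorem curl_fderiv {f : E → ℂ} {x : E} (hf : ContDiffAt ℝ ∞ f x) (u v : E) :
    curl (fderiv ℝ f) x u v = 0 := by
  have := (hf.of_le (m := 2) (by norm_cast)).isSymmSndFDerivAt (by simp) u v
  simp [curl, this]

@[simp] theorem conjCov_apply {V : Type*} [AddCommGroup V] [Module ℝ V] [TopologicalSpace V]
    (a : V →L[ℝ] ℂ) (v : V) : conjCov a v = starRingEnd ℂ (a v) := rfl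

theorem wedge_apply {V : Type*} [AddCommGroup V] [Module ℝ V] [TopologicalSpace V]
    (a b : V →L[ℝ] ℂ) (u v : V) : (a ⋏ b) u v = a u * b v - a v * b u := rfl

end CurlCalculus

section ReducedData

/-- Coframe, connection forms and Weyl scalars on (an open subset of) `ℝ × ℂ` in the situation
`Γ41 = 0`, `Ψ0 = Ψ1 = 0`. -/
structure ReducedData where
  M : ℝ × ℂ → ℝ × ℂ →L[ℝ] ℂ
  K : ℝ × ℂ → ℝ × ℂ →L[ℝ] ℂ
  Γ12 : ℝ × ℂ → ℝ × ℂ →L[ℝ] ℂ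
  Γ34 : ℝ × ℂ → ℝ × ℂ →L[ℝ] ℂ
  Γ23 : ℝ × ℂ → ℝ × ℂ →L[ℝ] ℂ
  Ψ2 : ℝ × ℂ → ℂ
  Ψ3 : ℝ × ℂ → ℂ

namespace ReducedData

/-- Reduced data as frame data. -/
def toFrameData (D : ReducedData) : FrameData (ℝ × ℂ) (ℝ × ℂ) where
  M := D.M
  K := D.K
  Γ12 := D.Γ12
  Γ34 := D.Γ34
  Γ23 := D.Γ23
  Γ41 := fun _ => (0 : ℝ × ℂ →L[ℝ] ℂ)
  Ψ0 := fun _ => 0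
  Ψ1 := fun _ => 0
  Ψ2 := D.Ψ2
  Ψ3 := D.Ψ3

/-- The structure equations for reduced data, with all terms in `Γ41`, `Ψ0`, `Ψ1` dropped. -/
structure IsSolutionOn (D : ReducedData) (R : ℝ) (U : Set (ℝ × ℂ)) : Prop where
  contDiff_M : ContDiffOn ℝ ∞ D.M U
  contDiff_K : ContDiffOn ℝ ∞ D.K U
  contDiff_Γ12 : ContDiffOn ℝ ∞ D.Γ12 U
  contDiff_Γ34 : ContDiffOn ℝ ∞ D.Γ34 U
  contDiff_Γ23 : ContDiffOn ℝ ∞ D.Γ23 U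
  real_K : ∀ x ∈ U, ∀ u, starRingEnd ℂ (D.K x u) = D.K x u
  real_Γ34 : ∀ x ∈ U, ∀ u, starRingEnd ℂ (D.Γ34 x u) = D.Γ34 x u
  imag_Γ12 : ∀ x ∈ U, ∀ u, starRingEnd ℂ (D.Γ12 x u) = -D.Γ12 x u
  nondegenerate : ∀ x ∈ U, ∀ u, D.M x u = 0 → D.K x u = 0 → u = 0
  curl_M : ∀ x ∈ U, ∀ u v, curl D.M x u v = (D.Γ12 x ⋏ D.M x) u v
  curl_K : ∀ x ∈ U, ∀ u v, curl D.K x u v = -(conjCov (D.Γ23 x) ⋏ D.M x) u v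
    - (D.Γ23 x ⋏ conjCov (D.M x)) u v + (D.Γ34 x ⋏ D.K x) u v
  curl_Γ23 : ∀ x ∈ U, ∀ u v, curl D.Γ23 x u v = ((D.Γ12 x + D.Γ34 x) ⋏ D.Γ23 x) u v
    - D.Ψ3 x * (D.M x ⋏ conjCov (D.M x)) u v
    + (D.Ψ2 x + (R : ℂ) / 12) * (D.K x ⋏ D.M x) u v
  curl_Γs : ∀ x ∈ U, ∀ u v, curl D.Γ12 x u v + curl D.Γ34 x u v
    = 2 * (D.Ψ2 x - (R : ℂ) / 24) * (D.M x ⋏ conjCov (D.M x)) u v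

/-- Pull-back of reduced data. -/
def pull (D : ReducedData) (g : ℝ × ℂ → ℝ × ℂ) : ReducedData where
  M := fun x => (D.M (g x)).comp (fderiv ℝ g x)
  K := fun x => (D.K (g x)).comp (fderiv ℝ g x)
  Γ12 := fun x => (D.Γ12 (g x)).comp (fderiv ℝ g x)
  Γ34 := fun x => (D.Γ34 (g x)).comp (fderiv ℝ g x)
  Γ23 := fun x => (D.Γ23 (g x)).comp (fderiv ℝ g x)
  Ψ2 := fun x => D.Ψ2 (g x)
  Ψ3 := fun x => D.Ψ3 (g x)

theorem toFrameData_pull (D : ReducedData) (g : ℝ × ℂ → ℝ × ℂ) :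
    (D.pull g).toFrameData = D.toFrameData.pullback g := by
  have e1 : ∀ A : ℝ × ℂ → ℝ × ℂ →L[ℝ] ℂ, (fun x => (A (g x)).comp (fderiv ℝ g x))
      = pullForm (E := ℝ × ℂ) (N := ℝ × ℂ) (N' := ℝ × ℂ) g A :=
    fun A => funext fun x => (pullForm_self g A x).symm
  have e2 : pullForm (E := ℝ × ℂ) (N := ℝ × ℂ) (N' := ℝ × ℂ) g
      (fun _ => (0 : ℝ × ℂ →L[ℝ] ℂ)) = fun _ => (0 : ℝ × ℂ →L[ℝ] ℂ) := by
    rw [← e1]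
    funext x
    simp
  unfold pull toFrameData FrameData.pullback
  simp only [e1, e2]

theorem IsSolutionOn.mono {D : ReducedData} {R : ℝ} {U V : Set (ℝ × ℂ)} (h : D.IsSolutionOn R U)
    (hV : V ⊆ U) : D.IsSolutionOn R V where
  contDiff_M := h.contDiff_M.mono hV
  contDiff_K := h.contDiff_K.mono hV
  contDiff_Γ12 := h.contDiff_Γ12.mono hV
  contDiff_Γ34 := h.contDiff_Γ34.mono hV
  contDiff_Γ23 := h.contDiff_Γ23.mono hV
  real_K x hx := h.real_K x (hV hx)
  real_Γ34 x hx := h.real_Γ34 x (hV hx)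
  imag_Γ12 x hx := h.imag_Γ12 x (hV hx)
  nondegenerate x hx := h.nondegenerate x (hV hx)
  curl_M x hx := h.curl_M x (hV hx)
  curl_K x hx := h.curl_K x (hV hx)
  curl_Γ23 x hx := h.curl_Γ23 x (hV hx)
  curl_Γs x hx := h.curl_Γs x (hV hx)

/-- The structure equations are natural; injectivity of the differential keeps the coframe
nondegenerate. -/
theorem IsSolutionOn.pull {D : ReducedData} {R : ℝ} {U W : Set (ℝ × ℂ)} (h : D.IsSolutionOn R U)
    (hU : IsOpen U) (hW : IsOpen W) {g : ℝ × ℂ → ℝ × ℂ} (hg : ContDiffOn ℝ ∞ g W)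
    (hgU : Set.MapsTo g W U) (hinj : ∀ x ∈ W, Function.Injective (fderiv ℝ g x)) :
    (D.pull g).IsSolutionOn R W := by
  have hd : ContDiffOn ℝ ∞ (fderiv ℝ g) W := hg.fderiv_of_isOpen hW (by simp)
  have hs : ∀ {A : ℝ × ℂ → ℝ × ℂ →L[ℝ] ℂ}, ContDiffOn ℝ ∞ A U →
      ContDiffOn ℝ ∞ (fun x => (A (g x)).comp (fderiv ℝ g x)) W :=
    fun hA => (hA.comp hg hgU).clm_comp hd
  have hc : ∀ {A : ℝ × ℂ → ℝ × ℂ →L[ℝ] ℂ}, ContDiffOn ℝ ∞ A U → ∀ x ∈ W, ∀ u v,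
      curl (fun x => (A (g x)).comp (fderiv ℝ g x)) x u v
        = curl A (g x) (fderiv ℝ g x u) (fderiv ℝ g x v) := by
    intro A hA x hx u v
    exact curl_pullback ((hA.contDiffAt (hU.mem_nhds (hgU hx))).differentiableAt (by simp))
      ((hg.contDiffAt (hW.mem_nhds hx)).of_le (by norm_cast)) u v
  constructor
  · exact hs h.contDiff_M
  · exact hs h.contDiff_K
  · exact hs h.contDiff_Γ12
  · exact hs h.contDiff_Γ34
  · exact hs h.contDiff_Γ23
  · exact fun x hx u => h.real_K _ (hgU hx) _
  · exact fun x hx u => h.real_Γ34 _ (hgU hx) _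
  · exact fun x hx u => h.imag_Γ12 _ (hgU hx) _
  · intro x hx u h1 h2
    have := h.nondegenerate _ (hgU hx) _ h1 h2
    exact hinj x hx (this.trans (map_zero _).symm)
  · exact fun x hx u v => (hc h.contDiff_M x hx u v).trans (h.curl_M _ (hgU hx) _ _)
  · exact fun x hx u v => (hc h.contDiff_K x hx u v).trans (h.curl_K _ (hgU hx) _ _)
  · exact fun x hx u v => (hc h.contDiff_Γ23 x hx u v).trans (h.curl_Γ23 _ (hgU hx) _ _)
  · exact fun x hx u v => (congrArg₂ _ (hc h.contDiff_Γ12 x hx u v)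
      (hc h.contDiff_Γ34 x hx u v)).trans (h.curl_Γs _ (hgU hx) _ _)

/-- The frame transformation with `A e^{iφ} = e^h`. -/
def gauge (D : ReducedData) (h z : ℝ × ℂ → ℂ) : ReducedData where
  M := fun x => Complex.exp (Complex.I * (h x).im) • D.M x
  K := fun x => (Real.exp (h x).re : ℂ) •
    (D.K x + z x • conjCov (D.M x) + starRingEnd ℂ (z x) • D.M x)
  Γ12 := fun x => D.Γ12 x + Complex.I • fderiv ℝ (fun y => ((h y).im : ℂ)) x
  Γ34 := fun x => D.Γ34 x + fderiv ℝ (fun y => ((h y).re : ℂ)) x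
  Γ23 := fun x => Complex.exp (h x) • (D.Γ23 x + z x • (D.Γ12 x + D.Γ34 x) - fderiv ℝ z x)
  Ψ2 := D.Ψ2
  Ψ3 := fun x => Complex.exp (h x) * (D.Ψ3 x - 3 * z x * D.Ψ2 x)

/-- The structure equations are gauge invariant. -/
theorem IsSolutionOn.gauge {D : ReducedData} {R : ℝ} {U : Set (ℝ × ℂ)} (hD : D.IsSolutionOn R U)
    (hU : IsOpen U) {h z : ℝ × ℂ → ℂ} (hh : ContDiff ℝ ∞ h) (hz : ContDiff ℝ ∞ z) :
    (D.gauge h z).IsSolutionOn R U := by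
  have cre : ContDiff ℝ ∞ (fun y => ((h y).re : ℂ)) :=
    Complex.ofRealCLM.contDiff.comp (Complex.reCLM.contDiff.comp hh)
  have cim : ContDiff ℝ ∞ (fun y => ((h y).im : ℂ)) :=
    Complex.ofRealCLM.contDiff.comp (Complex.imCLM.contDiff.comp hh)
  have cexp : ContDiff ℝ ∞ (Complex.exp : ℂ → ℂ) := Complex.contDiff_exp
  have cei : ContDiff ℝ ∞ (fun x => Complex.exp (Complex.I * (h x).im)) :=
    cexp.comp (contDiff_const.mul cim)
  have cer : ContDiff ℝ ∞ (fun x => (Real.exp (h x).re : ℂ)) := by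
    simp only [Complex.ofReal_exp]
    exact cexp.comp cre
  have ceh : ContDiff ℝ ∞ (fun x => Complex.exp (h x)) := cexp.comp hh
  have czb : ContDiff ℝ ∞ (fun x => starRingEnd ℂ (z x)) :=
    (Complex.conjCLE : ℂ →L[ℝ] ℂ).contDiff.comp hz
  have cMb : ContDiffOn ℝ ∞ (fun x => conjCov (D.M x)) U := contDiff_conjCov.comp_contDiffOn hD.contDiff_M
  have dre : ContDiff ℝ ∞ (fderiv ℝ (fun y => ((h y).re : ℂ))) := cre.fderiv_right (by simp)
  have dim : ContDiff ℝ ∞ (fderiv ℝ (fun y => ((h y).im : ℂ))) := cim.fderiv_right (by simp)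
  have dzz : ContDiff ℝ ∞ (fderiv ℝ z) := hz.fderiv_right (by simp)
  have da : ∀ {F : Type} [NormedAddCommGroup F] [NormedSpace ℝ F] {A : ℝ × ℂ → F},
      ContDiffOn ℝ ∞ A U → ∀ x ∈ U, DifferentiableAt ℝ A x :=
    fun hA x hx => (hA.contDiffAt (hU.mem_nhds hx)).differentiableAt (by simp)
  have da' : ∀ {F : Type} [NormedAddCommGroup F] [NormedSpace ℝ F] {A : ℝ × ℂ → F},
      ContDiff ℝ ∞ A → ∀ x, DifferentiableAt ℝ A x :=
    fun hA x => hA.contDiffAt.differentiableAt (by simp)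
  have czM : ContDiffOn ℝ ∞ (fun x => z x • conjCov (D.M x)) U := hz.contDiffOn.smul cMb
  have czbM : ContDiffOn ℝ ∞ (fun x => starRingEnd ℂ (z x) • D.M x) U :=
    czb.contDiffOn.smul hD.contDiff_M
  have cKz : ContDiffOn ℝ ∞ (fun x => D.K x + z x • conjCov (D.M x)) U := hD.contDiff_K.add czM
  have cs : ContDiffOn ℝ ∞ (fun x => D.Γ12 x + D.Γ34 x) U := hD.contDiff_Γ12.add hD.contDiff_Γ34
  have czs : ContDiffOn ℝ ∞ (fun x => z x • (D.Γ12 x + D.Γ34 x)) U := hz.contDiffOn.smul cs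
  have cgz : ContDiffOn ℝ ∞ (fun x => D.Γ23 x + z x • (D.Γ12 x + D.Γ34 x)) U :=
    hD.contDiff_Γ23.add czs
  have cidim : ContDiffOn ℝ ∞ (fun x => Complex.I • fderiv ℝ (fun y => ((h y).im : ℂ)) x) U :=
    dim.contDiffOn.const_smul _
  have cK : ContDiffOn ℝ ∞
      (fun x => D.K x + z x • conjCov (D.M x) + starRingEnd ℂ (z x) • D.M x) U :=
    cKz.add czbM
  have cΓ : ContDiffOn ℝ ∞ (fun x => D.Γ23 x + z x • (D.Γ12 x + D.Γ34 x) - fderiv ℝ z x) U :=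
    cgz.sub dzz.contDiffOn
  have fre : ∀ x u, fderiv ℝ (fun y => ((h y).re : ℂ)) x u = ((fderiv ℝ h x u).re : ℂ) := by
    intro x u
    have := (Complex.ofRealCLM.comp Complex.reCLM).hasFDerivAt.comp x (da' hh x).hasFDerivAt
    rw [show (fun y => ((h y).re : ℂ)) = (Complex.ofRealCLM.comp Complex.reCLM) ∘ h from rfl,
      this.fderiv]
    rfl
  have fim : ∀ x u, fderiv ℝ (fun y => ((h y).im : ℂ)) x u = ((fderiv ℝ h x u).im : ℂ) := by
    intro x u
    have := (Complex.ofRealCLM.comp Complex.imCLM).hasFDerivAt.comp x (da' hh x).hasFDerivAt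
    rw [show (fun y => ((h y).im : ℂ)) = (Complex.ofRealCLM.comp Complex.imCLM) ∘ h from rfl,
      this.fderiv]
    rfl
  have fzb : ∀ x u, fderiv ℝ (fun y => starRingEnd ℂ (z y)) x u
      = starRingEnd ℂ (fderiv ℝ z x u) := by
    intro x u
    have := (Complex.conjCLE : ℂ →L[ℝ] ℂ).hasFDerivAt.comp x (da' hz x).hasFDerivAt
    rw [show (fun y => starRingEnd ℂ (z y)) = (Complex.conjCLE : ℂ →L[ℝ] ℂ) ∘ z from rfl,
      this.fderiv]
    rfl
  have fexp : ∀ {f : ℝ × ℂ → ℂ}, ContDiff ℝ ∞ f → ∀ x u, fderiv ℝ (fun y => Complex.exp (f y)) x u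
      = Complex.exp (f x) * fderiv ℝ f x u := by
    intro f hf x u
    rw [((da' hf x).hasFDerivAt.cexp).fderiv]
    simp
  have fei : ∀ x u, fderiv ℝ (fun x => Complex.exp (Complex.I * (h x).im)) x u
      = Complex.exp (Complex.I * (h x).im) * (Complex.I * fderiv ℝ (fun y => ((h y).im : ℂ)) x u) := by
    intro x u
    rw [fexp (contDiff_const.mul cim), fderiv_const_mul (da' cim x)]
    simp
  have fer : ∀ x u, fderiv ℝ (fun x => (Real.exp (h x).re : ℂ)) x u
      = (Real.exp (h x).re : ℂ) * fderiv ℝ (fun y => ((h y).re : ℂ)) x u := by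
    intro x u
    simp only [Complex.ofReal_exp]
    rw [fexp cre]
  have heh : ∀ x, Complex.exp (h x)
      = (Real.exp (h x).re : ℂ) * Complex.exp (Complex.I * (h x).im) := by
    intro x
    rw [Complex.ofReal_exp, ← Complex.exp_add, mul_comm Complex.I, Complex.re_add_im]
  have hei : ∀ x, starRingEnd ℂ (Complex.exp (Complex.I * (h x).im))
      * Complex.exp (Complex.I * (h x).im) = 1 := by
    intro x
    rw [← Complex.exp_conj, ← Complex.exp_add]
    simp
  constructor
  · exact cei.contDiffOn.smul hD.contDiff_M
  · exact cer.contDiffOn.smul cK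
  · exact hD.contDiff_Γ12.add cidim
  · exact hD.contDiff_Γ34.add dre.contDiffOn
  · exact ceh.contDiffOn.smul cΓ
  · intro x hx u
    have := hD.real_K x hx u
    simp only [NullHyp.ReducedData.gauge, _root_.add_apply, _root_.smul_apply, smul_eq_mul,
      conjCov_apply, map_add, map_mul, Complex.conj_ofReal, Complex.conj_conj, this]
    ring
  · intro x hx u
    have := hD.real_Γ34 x hx u
    simp [NullHyp.ReducedData.gauge, this, fre]
  · intro x hx u
    have := hD.imag_Γ12 x hx u
    simp [NullHyp.ReducedData.gauge, this, fim]
    ring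
  · intro x hx u h1 h2
    have hM : D.M x u = 0 := by
      simpa [NullHyp.ReducedData.gauge] using h1
    refine hD.nondegenerate x hx u hM ?_
    simpa [NullHyp.ReducedData.gauge, hM] using h2
  · intro x hx u v
    have h1 := hD.curl_M x hx u v
    have h2 := curl_smul (da' cei x) (da hD.contDiff_M x hx) u v
    simp only [NullHyp.ReducedData.gauge] at *
    rw [h2, h1, fei, fei]
    simp only [wedge_apply, _root_.add_apply, _root_.smul_apply, smul_eq_mul]
    ring
  · intro x hx u v
    have h1 := hD.curl_M x hx u v
    have h3 := hD.curl_K x hx u v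
    have i1 := hD.imag_Γ12 x hx u
    have i2 := hD.imag_Γ12 x hx v
    have i3 := hD.real_Γ34 x hx u
    have i4 := hD.real_Γ34 x hx v
    have e1 := curl_smul (da' cer x) (da cK x hx) u v
    have e2 := curl_add (da cKz x hx) (da czbM x hx) u v
    have e3 := curl_add (da hD.contDiff_K x hx) (da czM x hx) u v
    have e4 := curl_smul (da' hz x) (da cMb x hx) u v
    have e5 := curl_smul (da' czb x) (da hD.contDiff_M x hx) u v
    have e6 := curl_conjCov (da hD.contDiff_M x hx) u v
    have e0 := hei x
    simp only [NullHyp.ReducedData.gauge]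
    rw [e1, e2, e3, e4, e5, e6, h1, h3, fer, fer, fzb, fzb, heh]
    simp only [wedge_apply, _root_.add_apply, _root_.sub_apply,
      _root_.smul_apply, smul_eq_mul, conjCov_apply, map_add, map_sub, map_mul,
      Complex.conj_ofReal, i1, i2, i3, i4]
    generalize starRingEnd ℂ (Complex.exp (Complex.I * (h x).im)) = qb at *
    generalize Complex.exp (Complex.I * (h x).im) = q at *
    linear_combination (Real.exp (h x).re : ℂ) *
      ((starRingEnd ℂ (D.Γ23 x u) + starRingEnd ℂ (z x) * (-D.Γ12 x u + D.Γ34 x u)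
          - starRingEnd ℂ (fderiv ℝ z x u)) * D.M x v
        - (starRingEnd ℂ (D.Γ23 x v) + starRingEnd ℂ (z x) * (-D.Γ12 x v + D.Γ34 x v)
          - starRingEnd ℂ (fderiv ℝ z x v)) * D.M x u
        + (D.Γ23 x u + z x * (D.Γ12 x u + D.Γ34 x u) - fderiv ℝ z x u) * starRingEnd ℂ (D.M x v)
        - (D.Γ23 x v + z x * (D.Γ12 x v + D.Γ34 x v) - fderiv ℝ z x v)
          * starRingEnd ℂ (D.M x u)) * e0
  · intro x hx u v
    have h1 := hD.curl_Γ23 x hx u v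
    have h3 := hD.curl_Γs x hx u v
    have e1 := curl_smul (da' ceh x) (da cΓ x hx) u v
    have e2 := curl_sub (da cgz x hx) (da' dzz x) u v
    have e3 := curl_add (da hD.contDiff_Γ23 x hx) (da czs x hx) u v
    have e4 := curl_smul (da' hz x) (da cs x hx) u v
    have e5 := curl_add (da hD.contDiff_Γ12 x hx) (da hD.contDiff_Γ34 x hx) u v
    have e0 := hei x
    have hdh : ∀ u, fderiv ℝ h x u = ((fderiv ℝ h x u).re : ℂ) + Complex.I * (fderiv ℝ h x u).im :=
      fun u => by rw [mul_comm Complex.I, Complex.re_add_im]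
    simp only [NullHyp.ReducedData.gauge]
    rw [e1, e2, e3, e4, e5, h1, h3, curl_fderiv hz.contDiffAt, fexp hh, fexp hh, heh, hdh u, hdh v]
    simp only [wedge_apply, _root_.add_apply, _root_.sub_apply,
      _root_.smul_apply, smul_eq_mul, conjCov_apply, map_mul, fre, fim]
    generalize starRingEnd ℂ (Complex.exp (Complex.I * (h x).im)) = qb at *
    generalize Complex.exp (Complex.I * (h x).im) = q at *
    linear_combination (-1) * (D.M x u * starRingEnd ℂ (D.M x v)
      - D.M x v * starRingEnd ℂ (D.M x u)) * (Real.exp (h x).re : ℂ) * q *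
      (-(D.Ψ3 x - 3 * z x * D.Ψ2 x)) * e0
  · intro x hx u v
    have h3 := hD.curl_Γs x hx u v
    have e0 := hei x
    have e1 := curl_add (da hD.contDiff_Γ12 x hx) (da cidim x hx) u v
    have e2 := curl_add (da hD.contDiff_Γ34 x hx) (da dre.contDiffOn x hx) u v
    have e3 := curl_const_smul (da' dim x) Complex.I u v
    rw [curl_fderiv cim.contDiffAt] at e3
    rw [curl_fderiv cre.contDiffAt] at e2
    simp only [NullHyp.ReducedData.gauge]
    rw [e1, e2, e3]
    simp only [wedge_apply, _root_.smul_apply, smul_eq_mul, conjCov_apply, map_mul] at *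
    linear_combination h3 - 2 * (D.Ψ2 x - (R : ℂ) / 24) * (D.M x u * starRingEnd ℂ (D.M x v) - D.M x v * starRingEnd ℂ (D.M x u)) * e0
end ReducedData

end ReducedData

/-! ### Passage to charts -/

section Transport

/-- A nondegenerate pair consisting of a complex and a real covector on a three-dimensional space
takes all pairs of values. -/
theorem exists_frame_values {M K : ℝ × ℂ →L[ℝ] ℂ} (hK : ∀ u, starRingEnd ℂ (K u) = K u)
    (h : ∀ u, M u = 0 → K u = 0 → u = 0) (a : ℂ) (b : ℝ) : ∃ u, M u = a ∧ K u = b := by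
  let T : ℝ × ℂ →ₗ[ℝ] ℝ × ℂ := ((Complex.reCLM.comp K).prod M : ℝ × ℂ →L[ℝ] ℝ × ℂ).toLinearMap
  have hre : ∀ u, ((K u).re : ℂ) = K u := fun u => Complex.conj_eq_iff_re.1 (hK u)
  have hT : ∀ u, T u = ((K u).re, M u) := fun u => rfl
  have hinj : Function.Injective T := by
    rw [injective_iff_map_eq_zero]
    intro u hu
    rw [hT, Prod.mk_eq_zero] at hu
    refine h u hu.2 ?_
    rw [← hre, hu.1, Complex.ofReal_zero]
  obtain ⟨u, hu⟩ := LinearMap.surjective_of_injective hinj (b, a)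
  rw [hT, Prod.mk.injEq] at hu
  exact ⟨u, hu.2, by rw [← hre, hu.1]⟩

/-- The equation `0 = Γ41 ∧ M + Γ42 ∧ M̄` with `Γ41 = κ K` says that `κ K ∧ M` is imaginary, so
`κ = 0`. -/
theorem eq_zero_of_smul_wedge {M K : ℝ × ℂ →L[ℝ] ℂ} (hK : ∀ u, starRingEnd ℂ (K u) = K u)
    (h : ∀ u, M u = 0 → K u = 0 → u = 0) {κ : ℂ}
    (hκ : 0 = (κ • K) ⋏ M + conjCov (κ • K) ⋏ conjCov M) : κ = 0 := by
  obtain ⟨u, hu1, hu2⟩ := exists_frame_values hK h 1 0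
  obtain ⟨u', hu1', hu2'⟩ := exists_frame_values hK h Complex.I 0
  obtain ⟨v, hv1, hv2⟩ := exists_frame_values hK h 0 1
  have e1 := congrFun (congrFun hκ v) u
  have e2 := congrFun (congrFun hκ v) u'
  simp [wedge_apply, hu1, hu2, hu1', hu2', hv1, hv2] at e1 e2
  have e3 : κ * 2 = 0 := by
    linear_combination (-1) * e1 + Complex.I * e2 + (κ - starRingEnd ℂ κ) * Complex.I_sq
  simpa using e3

/-- The forms `M ∧ M̄` and `K ∧ M` are linearly independent. When `Γ14 = 0`, the equation for
`dΓ14` therefore gives `Ψ0 = Ψ1 = 0`. -/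
theorem eq_zero_of_wedge_combination {M K : ℝ × ℂ →L[ℝ] ℂ}
    (hK : ∀ u, starRingEnd ℂ (K u) = K u)
    (h : ∀ u, M u = 0 → K u = 0 → u = 0) {a b : ℂ}
    (hab : ∀ u v, 0 = a * (M ⋏ conjCov M) u v - b * (K ⋏ M) u v) : b = 0 ∧ a = 0 := by
  obtain ⟨u, hu1, hu2⟩ := exists_frame_values hK h 1 0
  obtain ⟨u', hu1', hu2'⟩ := exists_frame_values hK h Complex.I 0
  obtain ⟨v, hv1, hv2⟩ := exists_frame_values hK h 0 1
  have e1 := hab v u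
  have e2 := hab u u'
  simp [wedge_apply, hu1, hu2, hu1', hu2', hv1, hv2] at e1 e2
  refine ⟨e1, e2.resolve_right fun h => ?_⟩
  have : Complex.I * 2 = 0 := by linear_combination (-1) * h
  simp at this

section WedgeIdentities

variable {V : Type*} [AddCommGroup V] [Module ℝ V] [TopologicalSpace V]

theorem first_structure_M (g m k : V →L[ℝ] ℂ) (u v : V) :
    (-((-g) ⋏ m) - (0 : V →L[ℝ] ℂ) ⋏ k) u v = (g ⋏ m) u v := by
  simp [wedge_apply]
  ring

theorem first_structure_K (g m l k : V →L[ℝ] ℂ) (u v : V) :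
    ((-conjCov g) ⋏ m + (-g) ⋏ conjCov m + l ⋏ k) u v
      = -(conjCov g ⋏ m) u v - (g ⋏ conjCov m) u v + (l ⋏ k) u v := by
  simp [wedge_apply]
  ring

theorem second_structure_Γ14 (s m mb k : V →L[ℝ] ℂ) (a b : ℂ) (u v : V) :
    ((0 : V →L[ℝ] ℂ) ⋏ s + a • (m ⋏ mb) - b • (k ⋏ m)) u v
      = a * (m ⋏ mb) u v - b * (k ⋏ m) u v := by
  simp [wedge_apply]

theorem second_structure_Γs {P Q : V → V → ℂ} {g m mb k : V →L[ℝ] ℂ} {a : ℂ}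
    (h : (1 / 2 : ℂ) • (P + Q)
      = g ⋏ (0 : V →L[ℝ] ℂ) + a • (m ⋏ mb) - (0 : ℂ) • (k ⋏ m)) (u v : V) :
    P u v + Q u v = 2 * a * (m ⋏ mb) u v := by
  have := congrFun (congrFun h u) v
  simp [wedge_apply] at this
  rw [wedge_apply]
  linear_combination 2 * this

end WedgeIdentities

variable {N : Type*} [TopologicalSpace N] [ChartedSpace (ℝ × ℂ) N]

/-- An identity between forms expressed in a chart holds on the manifold. -/
theorem eq_pullForm_of_pullForm_symm {ψ : OpenPartialHomeomorph N (ℝ × ℂ)}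
    (hψ : ψ ∈ IsManifold.maximalAtlas 𝓘(ℝ, ℝ × ℂ) ∞ N) {q : N} (hq : q ∈ ψ.source)
    {α : OneForm (ℝ × ℂ) N} {β : OneForm (ℝ × ℂ) (ℝ × ℂ)}
    (h : pullForm (E := ℝ × ℂ) ψ.symm α (ψ q) = β (ψ q)) (u : TangentSpace 𝓘(ℝ, ℝ × ℂ) q) :
    α q u = β (ψ q) (mfderiv 𝓘(ℝ, ℝ × ℂ) 𝓘(ℝ, ℝ × ℂ) ψ q u) := by
  have m1 : MDifferentiableAt 𝓘(ℝ, ℝ × ℂ) 𝓘(ℝ, ℝ × ℂ) ψ q :=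
    (contMDiffAt_of_mem_maximalAtlas hψ hq).mdifferentiableAt (by simp)
  have m2 : MDifferentiableAt 𝓘(ℝ, ℝ × ℂ) 𝓘(ℝ, ℝ × ℂ) ψ.symm (ψ q) :=
    (contMDiffAt_symm_of_mem_maximalAtlas hψ (ψ.map_source hq)).mdifferentiableAt (by simp)
  have e1 := pullForm_comp m2 m1 α
  have e2 : (ψ.symm ∘ ψ : N → N) =ᶠ[nhds q] id := by
    filter_upwards [ψ.open_source.mem_nhds hq] with y hy using ψ.left_inv hy
  have e3 : pullForm (E := ℝ × ℂ) (ψ.symm ∘ ψ) α q u = α q u := by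
    have gen : ∀ (a : N → ℝ × ℂ →L[ℝ] ℂ) {q q' : N}, q = q' → a q = a q' :=
      fun a _ _ h => congrArg a h
    unfold pullForm
    rw [e2.mfderiv_eq, mfderiv_id]
    exact congrArg (fun T : ℝ × ℂ →L[ℝ] ℂ => T u) (gen α (ψ.left_inv hq))
  rw [← e3, e1]
  exact congrArg (fun T : ℝ × ℂ →L[ℝ] ℂ => T (mfderiv 𝓘(ℝ, ℝ × ℂ) 𝓘(ℝ, ℝ × ℂ) ψ q u)) h

/-- Gauge equivalence to a normal form may be checked in a chart. -/
theorem GaugeEquivNormalFormNear.of_chart [IsManifold 𝓘(ℝ, ℝ × ℂ) ∞ N]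
    {D : FrameData (ℝ × ℂ) N}
    {D' : FrameData (ℝ × ℂ) (ℝ × ℂ)} {ψ : OpenPartialHomeomorph N (ℝ × ℂ)}
    (hψ : ψ ∈ IsManifold.maximalAtlas 𝓘(ℝ, ℝ × ℂ) ∞ N) {p : N} (hp : p ∈ ψ.source)
    (hD : ∀ x ∈ ψ.target, (D.pullback ψ.symm).AgreeAt D' x) {R : ℝ}
    (h : GaugeEquivNormalFormNear D' R (ψ p)) : GaugeEquivNormalFormNear D R p := by
  obtain ⟨Φ, hΦ, hpΦ, A, φ, z, hA, hφ, hz, hApos, V, w, X, S, hV, hΦV, hw, hX, hS, hag⟩ := h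
  have hψs : ContMDiffOn 𝓘(ℝ, ℝ × ℂ) 𝓘(ℝ, ℝ × ℂ) ∞ ψ ψ.source :=
    contMDiffOn_of_mem_maximalAtlas hψ
  have hψt : ContMDiffOn 𝓘(ℝ, ℝ × ℂ) 𝓘(ℝ, ℝ × ℂ) ∞ ψ.symm ψ.target :=
    contMDiffOn_symm_of_mem_maximalAtlas hψ
  have hΦs : ContMDiffOn 𝓘(ℝ, ℝ × ℂ) 𝓘(ℝ, ℝ × ℂ) ∞ Φ Φ.source :=
    contMDiffOn_of_mem_maximalAtlas hΦ
  have hΦt : ContMDiffOn 𝓘(ℝ, ℝ × ℂ) 𝓘(ℝ, ℝ × ℂ) ∞ Φ.symm Φ.target :=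
    contMDiffOn_symm_of_mem_maximalAtlas hΦ
  have hsub1 : (ψ.trans Φ).source ⊆ ψ.source := fun q hq => hq.1
  have hsub2 : Set.MapsTo ψ (ψ.trans Φ).source Φ.source := fun q hq => hq.2
  refine ⟨ψ.trans Φ, ?_, ⟨hp, hpΦ⟩, A ∘ ψ, φ ∘ ψ, z ∘ ψ, hA.comp (hψs.mono hsub1) hsub2,
    hφ.comp (hψs.mono hsub1) hsub2, hz.comp (hψs.mono hsub1) hsub2, fun q hq => hApos _ hq.2,
    V, w, X, S, hV, fun x hx => hΦV x hx.1, hw, hX, hS, ?_⟩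
  · refine (ψ.trans Φ).mem_maximalAtlas_of_contMDiffOn ?_ ?_
    · exact hΦs.comp (hψs.mono hsub1) hsub2
    · exact hψt.comp (hΦt.mono fun x hx => hx.1) fun x hx => hx.2
  intro q hq
  have m1 : MDifferentiableAt 𝓘(ℝ, ℝ × ℂ) 𝓘(ℝ, ℝ × ℂ) ψ q :=
    (contMDiffAt_of_mem_maximalAtlas hψ hq.1).mdifferentiableAt (by simp)
  have m2 : MDifferentiableAt 𝓘(ℝ, ℝ × ℂ) 𝓘(ℝ, ℝ × ℂ) Φ (ψ q) :=
    (contMDiffAt_of_mem_maximalAtlas hΦ hq.2).mdifferentiableAt (by simp)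
  have mA : DifferentiableAt ℝ A (ψ q) := by
    have := (hA.contMDiffAt (Φ.open_source.mem_nhds hq.2))
    exact (contMDiffAt_iff_contDiffAt.1 this).differentiableAt (by simp)
  have mφ : DifferentiableAt ℝ φ (ψ q) := by
    have := (hφ.contMDiffAt (Φ.open_source.mem_nhds hq.2))
    exact (contMDiffAt_iff_contDiffAt.1 this).differentiableAt (by simp)
  have mz : DifferentiableAt ℝ z (ψ q) := by
    have := (hz.contMDiffAt (Φ.open_source.mem_nhds hq.2))
    exact (contMDiffAt_iff_contDiffAt.1 this).differentiableAt (by simp)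
  have dφ := pullForm_dFun (E := ℝ × ℂ) (g := fun q => (φ q : ℂ))
    (Complex.ofRealCLM.differentiableAt.comp _ mφ).mdifferentiableAt m1
  have dA := pullForm_dFun (E := ℝ × ℂ) (g := fun q => (Real.log (A q) : ℂ))
    (Complex.ofRealCLM.differentiableAt.comp _
      (mA.log (hApos _ hq.2).ne')).mdifferentiableAt m1
  have dzz := pullForm_dFun (E := ℝ × ℂ) (g := z) mz.mdifferentiableAt m1
  have dφ' := fun u => congrArg (fun T : ℝ × ℂ →L[ℝ] ℂ => T u) dφ
  have dA' := fun u => congrArg (fun T : ℝ × ℂ →L[ℝ] ℂ => T u) dA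
  have dz' := fun u => congrArg (fun T : ℝ × ℂ →L[ℝ] ℂ => T u) dzz
  obtain ⟨a1, a2, a3, a4, a5, a6, a7, a8, a9, a10⟩ := hD (ψ q) (ψ.map_source hq.1)
  have b1 := eq_pullForm_of_pullForm_symm hψ hq.1 a1
  have b2 := eq_pullForm_of_pullForm_symm hψ hq.1 a2
  have b3 := eq_pullForm_of_pullForm_symm hψ hq.1 a3
  have b4 := eq_pullForm_of_pullForm_symm hψ hq.1 a4
  have b5 := eq_pullForm_of_pullForm_symm hψ hq.1 a5
  have b6 := eq_pullForm_of_pullForm_symm hψ hq.1 a6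
  obtain ⟨c1, c2, c3, c4, c5, c6, c7, c8, c9, c10⟩ := hag (ψ q) hq.2
  have hl : ψ.symm (ψ q) = q := ψ.left_inv hq.1
  have key : ∀ {a : ℝ × ℂ →L[ℝ] ℂ} {β γ : OneForm (ℝ × ℂ) (ℝ × ℂ)},
      (∀ u : ℝ × ℂ, a u = (β (ψ q) : ℝ × ℂ →L[ℝ] ℂ) (mfderiv 𝓘(ℝ, ℝ × ℂ) 𝓘(ℝ, ℝ × ℂ) ψ q u)) →
      β (ψ q) = pullForm (E := ℝ × ℂ) Φ γ (ψ q) →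
      a = pullForm (E := ℝ × ℂ) (Φ ∘ ψ) γ q := by
    intro a β γ h1 h2
    rw [pullForm_comp m2 m1 γ]
    refine ContinuousLinearMap.ext fun u => (h1 u).trans ?_
    rw [h2]
    rfl
  have congr4 : ∀ (f : ℂ → ℂ → ℂ → ℂ → ℂ) {a a' b b' c c' d d' : ℂ}, a = a' → b = b' → c = c' →
      d = d' → f a b c d = f a' b' c' d' := by
    rintro f _ _ _ _ _ _ _ _ rfl rfl rfl rfl
    rfl
  simp only [FrameData.pullback, hl] at a7 a8 a9 a10
  refine ⟨key (fun u => ?_) c1, key (fun u => ?_) c2, key (fun u => ?_) c3,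
    key (fun u => ?_) c4, key (fun u => ?_) c5, key (fun u => ?_) c6, ?_, ?_, ?_, ?_⟩
  · exact congrArg (fun m : ℂ => Complex.exp (Complex.I * φ (ψ q)) * m) (b1 u)
  · exact congrArg₂ (fun m k : ℂ => (A (ψ q) : ℂ) * (k + z (ψ q) * starRingEnd ℂ m
      + starRingEnd ℂ (z (ψ q)) * m)) (b1 u) (b2 u)
  · exact congr4 (fun a b c _ => a + z (ψ q) * b - starRingEnd ℂ (z (ψ q)) * starRingEnd ℂ b
      + Complex.I * c) (b3 u) (b6 u) (dφ' u).symm (Eq.refl (0 : ℂ))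
  · exact congr4 (fun a b c _ => a + z (ψ q) * b + starRingEnd ℂ (z (ψ q)) * starRingEnd ℂ b
      + c) (b4 u) (b6 u) (dA' u).symm (Eq.refl (0 : ℂ))
  · exact congr4 (fun a b c d => (A (ψ q) : ℂ) * Complex.exp (Complex.I * φ (ψ q)) *
      (a + z (ψ q) * b - (z (ψ q)) ^ 2 * -c - d)) (b5 u)
      (congrArg₂ (fun a b : ℂ => a + b) (b3 u) (b4 u)) (b6 u) (dz' u).symm
  · exact congrArg (fun m : ℂ => ((A (ψ q) : ℂ) * Complex.exp (Complex.I * φ (ψ q)))⁻¹ * m) (b6 u)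
  · refine Eq.trans ?_ c7
    simp only [FrameData.gauge, a7, Function.comp_apply]
  · refine Eq.trans ?_ c8
    simp only [FrameData.gauge, a7, a8, Function.comp_apply]
  · refine Eq.trans ?_ c9
    simp only [FrameData.gauge, a7, a8, a9, Function.comp_apply]
  · refine Eq.trans ?_ c10
    simp only [FrameData.gauge, a7, a8, a9, a10, Function.comp_apply]

/-- The coordinate expression of a one-form. -/
def coordForm (c : OpenPartialHomeomorph N (ℝ × ℂ)) (α : OneForm (ℝ × ℂ) N) :
    ℝ × ℂ → ℝ × ℂ →L[ℝ] ℂ :=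
  pullForm (E := ℝ × ℂ) (N := ℝ × ℂ) c.symm α

/-- A solution with `σ = ρ = 0` also has `κ = Ψ0 = Ψ1 = 0`, hence is described in a chart by
reduced data. -/
theorem exists_reducedData_of_solution [IsManifold 𝓘(ℝ, ℝ × ℂ) ∞ N]
    {D : FrameData (ℝ × ℂ) N} {R : ℝ}
    (hD : D.IsNullEinsteinSolutionOn R Set.univ) {κ : N → ℂ}
    (hκ : ∀ p, D.Γ41 p = κ p • D.K p) (p : N) :
    ∃ D' : ReducedData, D'.IsSolutionOn R (chartAt (ℝ × ℂ) p).target ∧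
      ∀ x ∈ (chartAt (ℝ × ℂ) p).target,
        (D.pullback (chartAt (ℝ × ℂ) p).symm).AgreeAt D'.toFrameData x := by
  have hκ0 : ∀ q, κ q = 0 := by
    intro q
    have h2 := (hD.first q trivial).2.1
    simp only [FrameData.Γ42, hκ q] at h2
    exact eq_zero_of_smul_wedge (fun u => congrArg (fun T : ℝ × ℂ →L[ℝ] ℂ => T u)
      (hD.real q trivial).1) (hD.nondegenerate q trivial) h2
  have h41 : ∀ q, D.Γ41 q = 0 := fun q => by
    rw [hκ, hκ0]
    exact ContinuousLinearMap.ext fun u => zero_mul _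
  set c := chartAt (ℝ × ℂ) p with hc
  have hcs : ContMDiffOn 𝓘(ℝ, ℝ × ℂ) 𝓘(ℝ, ℝ × ℂ) ∞ c.symm c.target := contMDiffOn_chart_symm
  -- the coordinate expression of a smooth form
  have hsm : ∀ α : OneForm (ℝ × ℂ) N, SmoothFormOn α Set.univ →
      ContDiffOn ℝ ∞ (coordForm c α)
        c.target := by
    intro α hα x hx
    have := SmoothFormAt.pullForm c.open_target hx hcs (hα (c.symm x) trivial)
    exact (smoothFormAt_iff_contDiffAt.1 this).contDiffWithinAt
  have hcurl : ∀ α : OneForm (ℝ × ℂ) N, SmoothFormOn α Set.univ → ∀ x ∈ c.target,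
      ∀ u v : ℝ × ℂ, curl (coordForm c α) x u v
        = extD α (c.symm x) (mfderiv 𝓘(ℝ, ℝ × ℂ) 𝓘(ℝ, ℝ × ℂ) c.symm x u)
          (mfderiv 𝓘(ℝ, ℝ × ℂ) 𝓘(ℝ, ℝ × ℂ) c.symm x v) := by
    intro α hα x hx u v
    have h1 := extD_pullForm c.open_target hx hcs (hα (c.symm x) trivial) u v
    have h2 := extD_self (((hsm α hα).contDiffAt (c.open_target.mem_nhds hx)).differentiableAt
      (by simp))
    rw [← h1]
    exact (congrFun (congrFun h2 u) v).symm
  obtain ⟨sM, sK, s12, s34, s23, s41⟩ := hD.smooth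
  let D' : ReducedData :=
    { M := coordForm c D.M
      K := coordForm c D.K
      Γ12 := coordForm c D.Γ12
      Γ34 := coordForm c D.Γ34
      Γ23 := coordForm c D.Γ23
      Ψ2 := D.Ψ2 ∘ c.symm
      Ψ3 := D.Ψ3 ∘ c.symm }
  have hrK : ∀ x ∈ c.target, ∀ u, starRingEnd ℂ (D'.K x u) = D'.K x u := fun x hx u =>
    congrArg (fun T : ℝ × ℂ →L[ℝ] ℂ => T (mfderiv 𝓘(ℝ, ℝ × ℂ) 𝓘(ℝ, ℝ × ℂ) c.symm x u))
      (hD.real (c.symm x) trivial).1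
  have hinj : ∀ x ∈ c.target, Function.Injective
      (mfderiv 𝓘(ℝ, ℝ × ℂ) 𝓘(ℝ, ℝ × ℂ) c.symm x) := fun x hx =>
    (mdifferentiable_of_mem_atlas (chart_mem_atlas (ℝ × ℂ) p)).symm.mfderiv_injective hx
  have hnd : ∀ x ∈ c.target, ∀ u, D'.M x u = 0 → D'.K x u = 0 → u = 0 := by
    intro x hx u h1 h2
    have := hD.nondegenerate (c.symm x) trivial _ h1 h2
    exact hinj x hx (this.trans (map_zero _).symm)
  have h14 : ∀ q, D.Γ14 q = 0 := fun q => by simp only [FrameData.Γ14, h41, neg_zero]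
  have hext0 : ∀ q, extD D.Γ14 q = 0 := by
    intro q
    have h0 : chartRep (chartAt (ℝ × ℂ) q) D.Γ14 = fun _ => 0 := by
      funext x
      simp only [chartRep, h14]
      exact ContinuousLinearMap.zero_comp _
    rw [extD_eq_curl (by rw [h0]; exact differentiableAt_const _), h0]
    funext u v
    exact curl_const 0 _ _ _
  have hΨ : ∀ x ∈ c.target, D.Ψ0 (c.symm x) = 0 ∧ D.Ψ1 (c.symm x) = 0 := by
    intro x hx
    have h2 := (hD.second (c.symm x) trivial).2.1
    rw [hext0, h14] at h2
    refine eq_zero_of_wedge_combination (hrK x hx) (hnd x hx) fun u v => ?_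
    exact (congrFun (congrFun h2 (mfderiv 𝓘(ℝ, ℝ × ℂ) 𝓘(ℝ, ℝ × ℂ) c.symm x u))
      (mfderiv 𝓘(ℝ, ℝ × ℂ) 𝓘(ℝ, ℝ × ℂ) c.symm x v)).trans (second_structure_Γ14 _ _ _ _ _ _ _ _)
  have e41 : ∀ x, pullForm (E := ℝ × ℂ) (N := ℝ × ℂ) c.symm D.Γ41 x = 0 := by
    intro x
    simp only [pullForm, h41]
    exact ContinuousLinearMap.zero_comp _
  refine ⟨D', ?_, fun x hx => ⟨rfl, rfl, rfl, rfl, rfl, e41 x, (hΨ x hx).1, (hΨ x hx).2, rfl, rfl⟩⟩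
  constructor
  · exact hsm _ sM
  · exact hsm _ sK
  · exact hsm _ s12
  · exact hsm _ s34
  · exact hsm _ s23
  · exact hrK
  · exact fun x hx u =>
      congrArg (fun T : ℝ × ℂ →L[ℝ] ℂ => T (mfderiv 𝓘(ℝ, ℝ × ℂ) 𝓘(ℝ, ℝ × ℂ) c.symm x u))
        (hD.real (c.symm x) trivial).2.1
  · exact fun x hx u =>
      congrArg (fun T : ℝ × ℂ →L[ℝ] ℂ => T (mfderiv 𝓘(ℝ, ℝ × ℂ) 𝓘(ℝ, ℝ × ℂ) c.symm x u))
        (hD.real (c.symm x) trivial).2.2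
  · exact hnd
  · intro x hx u v
    have h1 := (hD.first (c.symm x) trivial).1
    have h24 : D.Γ24 (c.symm x) = 0 := by
      simp only [FrameData.Γ24, h41]
      exact ContinuousLinearMap.ext fun u => by simp
    rw [h24] at h1
    exact (hcurl _ sM x hx u v).trans ((congrFun (congrFun h1 _) _).trans
      (first_structure_M _ _ _ _ _))
  · intro x hx u v
    have h1 := (hD.first (c.symm x) trivial).2.2
    exact (hcurl _ sK x hx u v).trans ((congrFun (congrFun h1 _) _).trans
      (first_structure_K _ _ _ _ _ _))
  · intro x hx u v
    have h1 := (hD.second (c.symm x) trivial).1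
    exact (hcurl _ s23 x hx u v).trans (congrFun (congrFun h1 _) _)
  · intro x hx u v
    have h1 := (hD.second (c.symm x) trivial).2.2
    rw [h14, (hΨ x hx).2] at h1
    exact (congrArg₂ _ (hcurl _ s12 x hx u v) (hcurl _ s34 x hx u v)).trans
      (second_structure_Γs h1 _ _)

end Transport

/-! ### Wirtinger calculus and the normal form as a solution -/

section Wirtinger

theorem fderiv_eq_dz_add_dzbar (F : ℂ → ℂ) (ζ v : ℂ) :
    fderiv ℝ F ζ v = dz F ζ * v + dzbar F ζ * starRingEnd ℂ v := by
  have hv : v = v.re • (1 : ℂ) + v.im • Complex.I := by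
    rw [Complex.real_smul, Complex.real_smul, mul_one, Complex.re_add_im]
  have h1 : fderiv ℝ F ζ v = v.re * fderiv ℝ F ζ 1 + v.im * fderiv ℝ F ζ Complex.I := by
    conv_lhs => rw [hv, map_add, map_smul, map_smul, Complex.real_smul, Complex.real_smul]
  have h2 : v = v.re + v.im * Complex.I := (Complex.re_add_im v).symm
  have h3 : starRingEnd ℂ v = v.re - v.im * Complex.I := by
    apply Complex.ext <;> simp
  rw [h1, h3, dz, dzbar]
  linear_combination ((v.im : ℂ) * fderiv ℝ F ζ Complex.I) * Complex.I_sq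
    - ((fderiv ℝ F ζ 1 - Complex.I * fderiv ℝ F ζ Complex.I) / 2) * h2

theorem fderiv_cbar {F : ℂ → ℂ} {ζ : ℂ} (hF : DifferentiableAt ℝ F ζ) (v : ℂ) :
    fderiv ℝ (cbar F) ζ v = starRingEnd ℂ (fderiv ℝ F ζ v) := by
  have := (Complex.conjCLE : ℂ →L[ℝ] ℂ).hasFDerivAt.comp ζ hF.hasFDerivAt
  rw [show cbar F = (Complex.conjCLE : ℂ →L[ℝ] ℂ) ∘ F from rfl, this.fderiv]
  rfl

theorem dz_cbar {F : ℂ → ℂ} {ζ : ℂ} (hF : DifferentiableAt ℝ F ζ) :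
    dz (cbar F) ζ = starRingEnd ℂ (dzbar F ζ) := by
  simp [dz, dzbar, fderiv_cbar hF, map_ofNat, sub_eq_add_neg]

theorem dzbar_cbar {F : ℂ → ℂ} {ζ : ℂ} (hF : DifferentiableAt ℝ F ζ) :
    dzbar (cbar F) ζ = starRingEnd ℂ (dz F ζ) := by
  simp [dz, dzbar, fderiv_cbar hF, map_ofNat, sub_eq_add_neg]

theorem dzbar_congr {F G : ℂ → ℂ} {ζ : ℂ} (h : F =ᶠ[nhds ζ] G) : dzbar F ζ = dzbar G ζ := by
  simp only [dzbar, h.fderiv_eq]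

theorem contDiffOn_cbar {F : ℂ → ℂ} {V : Set ℂ} (hF : ContDiffOn ℝ ∞ F V) :
    ContDiffOn ℝ ∞ (cbar F) V :=
  (Complex.conjCLE : ℂ →L[ℝ] ℂ).contDiff.comp_contDiffOn hF

theorem contDiffOn_dz {F : ℂ → ℂ} {V : Set ℂ} (hV : IsOpen V) (hF : ContDiffOn ℝ ∞ F V) :
    ContDiffOn ℝ ∞ (dz F) V := by
  have h : ContDiffOn ℝ ∞ (fderiv ℝ F) V := hF.fderiv_of_isOpen hV (by simp)
  exact ((h.clm_apply contDiffOn_const).sub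
    (contDiffOn_const.mul (h.clm_apply contDiffOn_const))).div_const 2

theorem contDiffOn_dzbar {F : ℂ → ℂ} {V : Set ℂ} (hV : IsOpen V) (hF : ContDiffOn ℝ ∞ F V) :
    ContDiffOn ℝ ∞ (dzbar F) V := by
  have h : ContDiffOn ℝ ∞ (fderiv ℝ F) V := hF.fderiv_of_isOpen hV (by simp)
  exact ((h.clm_apply contDiffOn_const).add
    (contDiffOn_const.mul (h.clm_apply contDiffOn_const))).div_const 2

/-- The differential of a function of `ζ` alone. -/
theorem fderiv_comp_snd {F : ℂ → ℂ} {x : ℝ × ℂ} (hF : DifferentiableAt ℝ F x.2) (u : ℝ × ℂ) :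
    fderiv ℝ (fun y : ℝ × ℂ => F y.2) x u = fderiv ℝ F x.2 u.2 := by
  have := hF.hasFDerivAt.comp x (hasFDerivAt_snd (𝕜 := ℝ) (p := x))
  rw [show (fun y : ℝ × ℂ => F y.2) = F ∘ Prod.snd from rfl, this.fderiv]
  rfl

/-- The differential of a function on `ℝ × ℂ` that is affine in the real variable. -/
theorem fderiv_affine {F G : ℂ → ℂ} {x : ℝ × ℂ} (hF : DifferentiableAt ℝ F x.2)
    (hG : DifferentiableAt ℝ G x.2) (u : ℝ × ℂ) :
    fderiv ℝ (fun y : ℝ × ℂ => F y.2 + y.1 * G y.2) x u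
      = fderiv ℝ F x.2 u.2 + u.1 * G x.2 + x.1 * fderiv ℝ G x.2 u.2 := by
  have h1 := hF.hasFDerivAt.comp x (hasFDerivAt_snd (𝕜 := ℝ) (p := x))
  have h2 := hG.hasFDerivAt.comp x (hasFDerivAt_snd (𝕜 := ℝ) (p := x))
  have h3 := Complex.ofRealCLM.hasFDerivAt.comp x (hasFDerivAt_fst (𝕜 := ℝ) (p := x))
  have h4 := h1.add (h3.mul h2)
  have e : (fun y : ℝ × ℂ => F y.2 + y.1 * G y.2)
    = F ∘ Prod.snd + (Complex.ofRealCLM ∘ Prod.fst) * (G ∘ Prod.snd) := rfl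
  rw [e, h4.fderiv]
  simp
  ring

theorem curl_smul_dζ_add {f g : ℝ × ℂ → ℂ} {x : ℝ × ℂ} (hf : DifferentiableAt ℝ f x)
    (hg : DifferentiableAt ℝ g x) (u v : ℝ × ℂ) :
    curl (fun y => f y • dζ + g y • dζbar) x u v
      = fderiv ℝ f x u * v.2 - fderiv ℝ f x v * u.2
        + (fderiv ℝ g x u * starRingEnd ℂ v.2 - fderiv ℝ g x v * starRingEnd ℂ u.2) := by
  rw [curl_add (hf.smul_const _) (hg.smul_const _),
    curl_smul hf (differentiableAt_const _), curl_smul hg (differentiableAt_const _),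
    curl_const, curl_const]
  simp [dζ, dζbar]

end Wirtinger

section NormalForm

theorem zero_wedge {V : Type*} [AddCommGroup V] [Module ℝ V] [TopologicalSpace V]
    (a : V →L[ℝ] ℂ) : (0 : V →L[ℝ] ℂ) ⋏ a = 0 := by
  funext u v
  simp [wedge_apply]

theorem wedge_zero {V : Type*} [AddCommGroup V] [Module ℝ V] [TopologicalSpace V]
    (a : V →L[ℝ] ℂ) : a ⋏ (0 : V →L[ℝ] ℂ) = 0 := by
  funext u v
  simp [wedge_apply]

/-- The terms dropped from the structure equations of reduced data vanish. -/
theorem ReducedData.IsSolutionOn.toFrameData {D : ReducedData} {R : ℝ} {U : Set (ℝ × ℂ)}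
    (h : D.IsSolutionOn R U) (hU : IsOpen U) :
    D.toFrameData.IsNullEinsteinSolutionOn R U := by
  have hs : ∀ {A : ℝ × ℂ → ℝ × ℂ →L[ℝ] ℂ}, ContDiffOn ℝ ∞ A U →
      SmoothFormOn (N := ℝ × ℂ) A U := fun hA x hx =>
    smoothFormAt_iff_contDiffAt.2 (hA.contDiffAt (hU.mem_nhds hx))
  have hc : ∀ {A : ℝ × ℂ → ℝ × ℂ →L[ℝ] ℂ}, ContDiffOn ℝ ∞ A U → ∀ x ∈ U,
      extD (N := ℝ × ℂ) A x = curl A x := fun hA x hx =>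
    extD_self ((hA.contDiffAt (hU.mem_nhds hx)).differentiableAt (by simp))
  have h0 : ∀ x : ℝ × ℂ, conjCov (0 : ℝ × ℂ →L[ℝ] ℂ) = 0 := fun x =>
    ContinuousLinearMap.ext fun u => by simp
  constructor
  · exact ⟨hs h.contDiff_M, hs h.contDiff_K, hs h.contDiff_Γ12, hs h.contDiff_Γ34,
      hs h.contDiff_Γ23, hs contDiffOn_const⟩
  · exact fun x hx => ⟨ContinuousLinearMap.ext fun u => h.real_K x hx u,
      ContinuousLinearMap.ext fun u => h.real_Γ34 x hx u,
      ContinuousLinearMap.ext fun u => h.imag_Γ12 x hx u⟩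
  · exact h.nondegenerate
  · intro x hx
    refine ⟨?_, ?_, ?_⟩
    · refine (hc h.contDiff_M x hx).trans (funext fun u => funext fun v =>
        (h.curl_M x hx u v).trans ?_)
      change _ = (-((-D.Γ12 x) ⋏ D.M x) - (-conjCov (0 : ℝ × ℂ →L[ℝ] ℂ)) ⋏ D.K x) u v
      rw [h0 x, neg_zero, first_structure_M]
    · change (0 : ℝ × ℂ → ℝ × ℂ → ℂ)
        = (0 : ℝ × ℂ →L[ℝ] ℂ) ⋏ D.M x + conjCov (0 : ℝ × ℂ →L[ℝ] ℂ) ⋏ conjCov (D.M x)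
      rw [h0 x, zero_wedge, zero_wedge, add_zero]
    · refine (hc h.contDiff_K x hx).trans (funext fun u => funext fun v =>
        (h.curl_K x hx u v).trans ?_)
      exact (first_structure_K _ _ _ _ _ _).symm
  · intro x hx
    refine ⟨?_, ?_, ?_⟩
    · exact (hc h.contDiff_Γ23 x hx).trans (funext fun u => funext fun v =>
        (h.curl_Γ23 x hx u v))
    · have e : D.toFrameData.Γ14 = (fun _ => (0 : ℝ × ℂ →L[ℝ] ℂ)) := funext fun x => by
        change -(0 : ℝ × ℂ →L[ℝ] ℂ) = 0
        rw [neg_zero]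
      rw [e]
      refine (hc contDiffOn_const x hx).trans ?_
      change _ = (0 : ℝ × ℂ →L[ℝ] ℂ) ⋏ (D.Γ12 x + D.Γ34 x) + (0 : ℂ) • (D.M x ⋏ conjCov (D.M x))
        - (0 : ℂ) • (D.K x ⋏ D.M x)
      rw [zero_wedge, zero_smul, zero_smul, add_zero, sub_zero]
      exact funext fun u => funext fun v => curl_const _ _ _ _
    · refine funext fun u : ℝ × ℂ => funext fun v : ℝ × ℂ => ?_
      have e := h.curl_Γs x hx u v
      have e1 := congrFun (congrFun (hc h.contDiff_Γ12 x hx) u) v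
      have e2 := congrFun (congrFun (hc h.contDiff_Γ34 x hx) u) v
      rw [← e1, ← e2] at e
      change (1 / 2 : ℂ) * (extD (N := ℝ × ℂ) D.Γ12 x u v + extD (N := ℝ × ℂ) D.Γ34 x u v)
        = (D.Γ23 x ⋏ (-(0 : ℝ × ℂ →L[ℝ] ℂ))) u v + (D.Ψ2 x - (R : ℂ) / 24) * (D.M x ⋏ conjCov (D.M x)) u v
        - 0 * (D.K x ⋏ D.M x) u v
      rw [e, neg_zero, wedge_zero]
      change _ = 0 + _ - _
      ring

/-- The coefficient of `dζ` in the connection form `Γ23` of the normal form. -/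
def coefG (R : ℝ) (w X : ℂ → ℂ) (S : ℂ → ℝ) (r : ℝ) (ζ : ℂ) : ℂ :=
  coefC R w ζ * r + 1 / 2 * Complex.exp (-cbar w ζ) * (2 * (S ζ : ℂ) + coefT w X ζ)

/-- The normal form as reduced data, with the connection forms expanded in `dζ` and `dζbar`. -/
def reducedNormalForm (R : ℝ) (w X : ℂ → ℂ) (S : ℂ → ℝ) : ReducedData where
  M := normalM w
  K := normalK w X
  Γ12 := fun x => (-dz (cbar w) x.2) • dζ + dzbar w x.2 • dζbar
  Γ34 := fun x => (-dz (cbar w) x.2) • dζ + (-dzbar w x.2) • dζbar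
  Γ23 := fun x => coefG R w X S x.1 x.2 • dζ
  Ψ2 := (normalForm R w X S).Ψ2
  Ψ3 := fun x => Complex.exp (-(w x.2 + cbar w x.2)) *
    (dzbar (coefG R w X S x.1) x.2 - coefC R w x.2 * (cbar X x.2 + x.1 * dzbar w x.2))

/-- The expansion of the connection in `M, M̄, K` and the one in `dζ, dζbar` agree. -/
theorem toFrameData_reducedNormalForm (R : ℝ) (w X : ℂ → ℂ) (S : ℂ → ℝ) :
    (reducedNormalForm R w X S).toFrameData = normalForm R w X S := by
  have hM : ∀ x u : ℝ × ℂ, (normalM w x : ℝ × ℂ →L[ℝ] ℂ) u = Complex.exp (w x.2) * u.2 :=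
    fun x u => rfl
  have hcomb : ∀ (a₁ a₂ : ℝ × ℂ → ℂ) (x u : ℝ × ℂ),
      (normalComb w X a₁ a₂ (fun _ => 0) x : ℝ × ℂ →L[ℝ] ℂ) u
        = a₁ x * (Complex.exp (w x.2) * u.2)
          + a₂ x * (Complex.exp (cbar w x.2) * starRingEnd ℂ u.2) := by
    intro a₁ a₂ x u
    change a₁ x * (Complex.exp (w x.2) * u.2)
      + a₂ x * (starRingEnd ℂ (Complex.exp (w x.2) * u.2)) + 0 * _ = _
    rw [map_mul, ← Complex.exp_conj, zero_mul, add_zero]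
    rfl
  have he : ∀ a : ℂ, Complex.exp (-a) * Complex.exp a = 1 := fun a => by
    rw [← Complex.exp_add]; simp
  have e12 : (reducedNormalForm R w X S).Γ12 = (normalForm R w X S).Γ12 := by
    refine funext fun x => ContinuousLinearMap.ext fun u => ?_
    refine Eq.trans ?_ (hcomb _ _ x u).symm
    simp [reducedNormalForm, dζ, dζbar]
    linear_combination (dz (cbar w) x.2 * u.2) * he (w x.2)
      - (dzbar w x.2 * starRingEnd ℂ u.2) * he (cbar w x.2)
  have e34 : (reducedNormalForm R w X S).Γ34 = (normalForm R w X S).Γ34 := by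
    refine funext fun x => ContinuousLinearMap.ext fun u => ?_
    refine Eq.trans ?_ (hcomb _ _ x u).symm
    simp [reducedNormalForm, dζ, dζbar]
    linear_combination (dz (cbar w) x.2 * u.2) * he (w x.2)
      + (dzbar w x.2 * starRingEnd ℂ u.2) * he (cbar w x.2)
  have e23 : (reducedNormalForm R w X S).Γ23 = (normalForm R w X S).Γ23 := by
    refine funext fun x => ContinuousLinearMap.ext fun u => ?_
    refine Eq.trans ?_ (congrArg (fun a : ℂ => -a) (hcomb _ _ x u)).symm
    simp [reducedNormalForm, dζ, coefG]
    linear_combination (-((coefC R w x.2 * x.1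
      + ((S x.2 : ℂ) + 1 / 2 * coefT w X x.2) * Complex.exp (-cbar w x.2)) * u.2)) * he (w x.2)
  have e41 : (fun _ => (0 : ℝ × ℂ →L[ℝ] ℂ)) = (normalForm R w X S).Γ41 := by
    refine funext fun x => ContinuousLinearMap.ext fun u => ?_
    refine Eq.trans ?_ (congrArg (fun a : ℂ => -a) (hcomb _ _ x u)).symm
    simp
  unfold ReducedData.toFrameData
  rw [e12, e34, e23, e41]
  rfl

/-- The normal form solves the structure equations for arbitrary `w`, `X` and `S`. -/
theorem isSolutionOn_reducedNormalForm (R : ℝ) {V : Set ℂ} {w X : ℂ → ℂ} {S : ℂ → ℝ}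
    (hV : IsOpen V) (hw : ContDiffOn ℝ ∞ w V) (hX : ContDiffOn ℝ ∞ X V)
    (hS : ContDiffOn ℝ ∞ S V) :
    (reducedNormalForm R w X S).IsSolutionOn R (Set.univ ×ˢ V) := by
  have hcw := contDiffOn_cbar hw
  have hcX := contDiffOn_cbar hX
  have ha := contDiffOn_dz hV hcw
  have hb := contDiffOn_dzbar hV hw
  have hab := contDiffOn_dzbar hV ha
  have hexp : ∀ {F : ℂ → ℂ}, ContDiffOn ℝ ∞ F V → ContDiffOn ℝ ∞ (fun ζ => Complex.exp (F ζ)) V :=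
    fun hF => Complex.contDiff_exp.comp_contDiffOn hF
  have hC : ContDiffOn ℝ ∞ (coefC R w) V :=
    (contDiffOn_const.mul (hexp hw)).add (hab.mul (hexp hcw.neg))
  have hT : ContDiffOn ℝ ∞ (coefT w X) V :=
    (((contDiffOn_dzbar hV hX).sub (contDiffOn_dz hV hcX)).add (hb.mul hX)).sub (ha.mul hcX)
  have hG0 : ContDiffOn ℝ ∞
      (fun ζ => 1 / 2 * Complex.exp (-cbar w ζ) * (2 * (S ζ : ℂ) + coefT w X ζ)) V :=
    (contDiffOn_const.mul (hexp hcw.neg)).mul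
      ((contDiffOn_const.mul (Complex.ofRealCLM.contDiff.comp_contDiffOn hS)).add hT)
  have hsnd : ∀ {F : ℂ → ℂ}, ContDiffOn ℝ ∞ F V →
      ContDiffOn ℝ ∞ (fun x : ℝ × ℂ => F x.2) (Set.univ ×ˢ V) :=
    fun hF => hF.comp contDiff_snd.contDiffOn fun x hx => hx.2
  have hfst : ContDiffOn ℝ ∞ (fun x : ℝ × ℂ => (x.1 : ℂ)) (Set.univ ×ˢ V) :=
    (Complex.ofRealCLM.contDiff.comp contDiff_fst).contDiffOn
  have hU : IsOpen ((Set.univ : Set ℝ) ×ˢ V) := isOpen_univ.prod hV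
  have d2 : ∀ {F : ℂ → ℂ}, ContDiffOn ℝ ∞ F V → ∀ ζ ∈ V, DifferentiableAt ℝ F ζ :=
    fun hF ζ hζ => (hF.contDiffAt (hV.mem_nhds hζ)).differentiableAt (by simp)
  have d3 : ∀ {F : Type} [NormedAddCommGroup F] [NormedSpace ℝ F] {f : ℝ × ℂ → F},
      ContDiffOn ℝ ∞ f (Set.univ ×ˢ V) → ∀ x ∈ (Set.univ : Set ℝ) ×ˢ V, DifferentiableAt ℝ f x :=
    fun hF x hx => (hF.contDiffAt (hU.mem_nhds hx)).differentiableAt (by simp)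
  have hCr : ContDiffOn ℝ ∞ (fun x : ℝ × ℂ => coefC R w x.2) (Set.univ ×ˢ V) := hsnd hC
  have eG : ∀ x : ℝ × ℂ, coefG R w X S x.1 x.2
      = (1 / 2 * Complex.exp (-cbar w x.2) * (2 * (S x.2 : ℂ) + coefT w X x.2))
        + x.1 * coefC R w x.2 := fun x => by
    rw [coefG]; ring
  have hG : ContDiffOn ℝ ∞ (fun x : ℝ × ℂ => coefG R w X S x.1 x.2) (Set.univ ×ˢ V) := by
    simp only [eG]
    exact (hsnd hG0).add (hfst.mul hCr)
  have hKa : ContDiffOn ℝ ∞ (fun x : ℝ × ℂ => X x.2 + x.1 * dz (cbar w) x.2) (Set.univ ×ˢ V) :=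
    (hsnd hX).add (hfst.mul (hsnd ha))
  have hKb : ContDiffOn ℝ ∞ (fun x : ℝ × ℂ => cbar X x.2 + x.1 * dzbar w x.2) (Set.univ ×ˢ V) :=
    (hsnd hcX).add (hfst.mul (hsnd hb))
  have hn : ∀ {F : ℂ → ℂ}, ContDiffOn ℝ ∞ F V → ContDiffOn ℝ ∞ (fun ζ => -F ζ) V := fun h => h.neg
  have hKζ : ContDiffOn ℝ ∞ (fun x : ℝ × ℂ => (X x.2 + x.1 * dz (cbar w) x.2) • dζ
      + (cbar X x.2 + x.1 * dzbar w x.2) • dζbar) (Set.univ ×ˢ V) :=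
    (hKa.smul contDiffOn_const).add (hKb.smul contDiffOn_const)
  have eK : (reducedNormalForm R w X S).K = fun x => dr + ((X x.2 + x.1 * dz (cbar w) x.2) • dζ
      + (cbar X x.2 + x.1 * dzbar w x.2) • dζbar) := funext fun x => add_assoc _ _ _
  have sM : ContDiffOn ℝ ∞ (reducedNormalForm R w X S).M (Set.univ ×ˢ V) :=
    (hsnd (hexp hw)).smul contDiffOn_const
  have sK : ContDiffOn ℝ ∞ (reducedNormalForm R w X S).K (Set.univ ×ˢ V) := by
    rw [eK]
    exact contDiffOn_const.add hKζ
  have s12 : ContDiffOn ℝ ∞ (reducedNormalForm R w X S).Γ12 (Set.univ ×ˢ V) :=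
    ((hsnd (hn ha)).smul contDiffOn_const).add ((hsnd hb).smul contDiffOn_const)
  have s34 : ContDiffOn ℝ ∞ (reducedNormalForm R w X S).Γ34 (Set.univ ×ˢ V) :=
    ((hsnd (hn ha)).smul contDiffOn_const).add ((hsnd (hn hb)).smul contDiffOn_const)
  have s23 : ContDiffOn ℝ ∞ (reducedNormalForm R w X S).Γ23 (Set.univ ×ˢ V) :=
    hG.smul contDiffOn_const
  have cζ : ∀ u : ℝ × ℂ, dζ u = u.2 := fun u => rfl
  have cζb : ∀ u : ℝ × ℂ, dζbar u = starRingEnd ℂ u.2 := fun u => rfl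
  have cr : ∀ u : ℝ × ℂ, dr u = (u.1 : ℂ) := fun u => rfl
  have va : ∀ ζ ∈ V, dz (cbar w) ζ = starRingEnd ℂ (dzbar w ζ) := fun ζ hζ => dz_cbar (d2 hw ζ hζ)
  have ecb : ∀ ζ, Complex.exp (cbar w ζ) = starRingEnd ℂ (Complex.exp (w ζ)) := fun ζ => by
    rw [← Complex.exp_conj]; rfl
  have hE : ∀ ζ, Complex.exp (w ζ) ≠ 0 := fun ζ => Complex.exp_ne_zero _
  have hE' : ∀ ζ, starRingEnd ℂ (Complex.exp (w ζ)) ≠ 0 := fun ζ => by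
    rw [← ecb]; exact Complex.exp_ne_zero _
  have eneg : ∀ ζ, Complex.exp (-cbar w ζ) = (starRingEnd ℂ (Complex.exp (w ζ)))⁻¹ := fun ζ => by
    rw [Complex.exp_neg, ecb]
  have eneg2 : ∀ ζ, Complex.exp (-(w ζ + cbar w ζ))
      = (Complex.exp (w ζ))⁻¹ * (starRingEnd ℂ (Complex.exp (w ζ)))⁻¹ := fun ζ => by
    rw [neg_add, Complex.exp_add, Complex.exp_neg, eneg]
  have vMM : ∀ x u : ℝ × ℂ, (reducedNormalForm R w X S).M x u = Complex.exp (w x.2) * u.2 :=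
    fun x u => rfl
  have vK : ∀ x u : ℝ × ℂ, (reducedNormalForm R w X S).K x u = u.1
      + (X x.2 + x.1 * dz (cbar w) x.2) * u.2
      + (cbar X x.2 + x.1 * dzbar w x.2) * starRingEnd ℂ u.2 := fun x u => rfl
  have v12 : ∀ x u : ℝ × ℂ, (reducedNormalForm R w X S).Γ12 x u
      = -dz (cbar w) x.2 * u.2 + dzbar w x.2 * starRingEnd ℂ u.2 := fun x u => rfl
  have v34 : ∀ x u : ℝ × ℂ, (reducedNormalForm R w X S).Γ34 x u
      = -dz (cbar w) x.2 * u.2 + -dzbar w x.2 * starRingEnd ℂ u.2 := fun x u => rfl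
  have v23 : ∀ x u : ℝ × ℂ, (reducedNormalForm R w X S).Γ23 x u
      = coefG R w X S x.1 x.2 * u.2 := fun x u => rfl
  refine ⟨sM, sK, s12, s34, s23, ?_, ?_, ?_, ?_, ?_, ?_, ?_, ?_⟩
  · intro x hx u
    have e : cbar X x.2 = starRingEnd ℂ (X x.2) := rfl
    simp only [vK, va _ hx.2, e, map_add, map_mul, Complex.conj_conj, Complex.conj_ofReal]
    ring
  · intro x hx u
    simp only [v34, va _ hx.2, map_add, map_mul, map_neg, Complex.conj_conj]
    ring
  · intro x hx u
    simp only [v12, va _ hx.2, map_add, map_mul, map_neg, Complex.conj_conj]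
    ring
  · intro x hx u h1 h2
    rw [vMM] at h1
    have hu2 : u.2 = 0 := (mul_eq_zero.1 h1).resolve_left (hE _)
    rw [vK, hu2] at h2
    simp at h2
    exact Prod.ext h2 hu2
  · intro x hx u v
    have e1 := curl_smul (A := fun _ => dζ) (d3 (hsnd (hexp hw)) x hx) (differentiableAt_const _) u v
    have e2 : ∀ u : ℝ × ℂ, fderiv ℝ (fun x : ℝ × ℂ => Complex.exp (w x.2)) x u
        = Complex.exp (w x.2) * (dz w x.2 * u.2 + dzbar w x.2 * starRingEnd ℂ u.2) := by
      intro u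
      rw [fderiv_comp_snd (F := fun ζ => Complex.exp (w ζ)) (d2 (hexp hw) _ hx.2),
        (d2 hw _ hx.2).hasFDerivAt.cexp.fderiv, ← fderiv_eq_dz_add_dzbar]
      rfl
    rw [curl_const, e2, e2] at e1
    refine e1.trans ?_
    rw [wedge_apply, v12, v12, vMM, vMM, cζ, cζ]
    ring
  · intro x hx u v
    have e1 : curl (reducedNormalForm R w X S).K x u v = _ :=
      (congrArg (fun A : ℝ × ℂ → ℝ × ℂ →L[ℝ] ℂ => curl A x u v) eK).trans
        (curl_add (differentiableAt_const _) (d3 hKζ x hx) u v)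
    rw [curl_const, curl_smul_dζ_add (d3 hKa x hx) (d3 hKb x hx),
      fderiv_affine (d2 hX _ hx.2) (d2 ha _ hx.2), fderiv_affine (d2 hX _ hx.2) (d2 ha _ hx.2),
      fderiv_affine (d2 hcX _ hx.2) (d2 hb _ hx.2),
      fderiv_affine (d2 hcX _ hx.2) (d2 hb _ hx.2)] at e1
    simp only [fderiv_eq_dz_add_dzbar] at e1
    have hab' : dz (dzbar w) x.2 = starRingEnd ℂ (dzbar (dz (cbar w)) x.2) := by
      have h1 : dz (cbar w) =ᶠ[nhds x.2] cbar (dzbar w) := by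
        filter_upwards [hV.mem_nhds hx.2] with ζ hζ using va ζ hζ
      rw [dzbar_congr h1, dzbar_cbar (d2 hb _ hx.2), Complex.conj_conj]
    have hX' : dz (cbar X) x.2 = starRingEnd ℂ (dzbar X x.2) := dz_cbar (d2 hX _ hx.2)
    have e : cbar X x.2 = starRingEnd ℂ (X x.2) := rfl
    rw [e1]
    simp only [wedge_apply, conjCov_apply, vMM, vK, v34, v23, coefG, coefC, coefT, eneg, hab', hX',
      va _ hx.2, e, map_add, map_sub, map_mul, map_div₀, map_inv₀, Complex.conj_conj,
      Complex.conj_ofReal, map_ofNat, map_one]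
    have h1 := hE x.2
    have h2 := hE' x.2
    generalize starRingEnd ℂ (Complex.exp (w x.2)) = qb at *
    generalize Complex.exp (w x.2) = q at *
    field_simp
    ring
  · intro x hx u v
    have e1 : curl (reducedNormalForm R w X S).Γ23 x u v = _ :=
      curl_smul (A := fun _ => dζ) (d3 hG x hx) (differentiableAt_const _) u v
    have e2 : fderiv ℝ (fun x : ℝ × ℂ => coefG R w X S x.1 x.2) x
        = fderiv ℝ (fun x : ℝ × ℂ => (1 / 2 * Complex.exp (-cbar w x.2)
          * (2 * (S x.2 : ℂ) + coefT w X x.2)) + x.1 * coefC R w x.2) x := by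
      simp only [eG]
    rw [curl_const, e2,
      fderiv_affine (F := fun ζ => 1 / 2 * Complex.exp (-cbar w ζ)
        * (2 * (S ζ : ℂ) + coefT w X ζ)) (d2 hG0 _ hx.2) (d2 hC _ hx.2),
      fderiv_affine (F := fun ζ => 1 / 2 * Complex.exp (-cbar w ζ)
        * (2 * (S ζ : ℂ) + coefT w X ζ)) (d2 hG0 _ hx.2) (d2 hC _ hx.2)] at e1
    have e3 : ∀ u, fderiv ℝ (coefG R w X S x.1) x.2 u
        = fderiv ℝ (fun ζ => 1 / 2 * Complex.exp (-cbar w ζ)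
          * (2 * (S ζ : ℂ) + coefT w X ζ)) x.2 u + x.1 * fderiv ℝ (coefC R w) x.2 u := by
      intro u
      have h1 := (d2 hG0 _ hx.2).hasFDerivAt.add ((d2 hC _ hx.2).hasFDerivAt.const_mul (x.1 : ℂ))
      have h2 : coefG R w X S x.1 = (fun ζ => 1 / 2 * Complex.exp (-cbar w ζ)
          * (2 * (S ζ : ℂ) + coefT w X ζ)) + fun ζ => (x.1 : ℂ) * coefC R w ζ :=
        funext fun ζ => eG (x.1, ζ)
      rw [h2, h1.fderiv]
      rfl
    have e4 : dzbar (coefG R w X S x.1) x.2 = dzbar (fun ζ => 1 / 2 * Complex.exp (-cbar w ζ)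
          * (2 * (S ζ : ℂ) + coefT w X ζ)) x.2 + x.1 * dzbar (coefC R w) x.2 := by
      simp only [dzbar, e3]
      ring
    have p2 : (reducedNormalForm R w X S).Ψ2 x = (R : ℂ) / 24
      + dzbar (dz (cbar w)) x.2 * Complex.exp (-(w x.2 + cbar w x.2)) := rfl
    have p3 : (reducedNormalForm R w X S).Ψ3 x = Complex.exp (-(w x.2 + cbar w x.2)) *
      (dzbar (coefG R w X S x.1) x.2 - coefC R w x.2 * (cbar X x.2 + x.1 * dzbar w x.2)) := rfl
    have pC : coefC R w x.2 = (R : ℂ) / 8 * Complex.exp (w x.2)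
      + dzbar (dz (cbar w)) x.2 * Complex.exp (-cbar w x.2) := rfl
    rw [e1, p2, p3, e4]
    simp only [fderiv_eq_dz_add_dzbar]
    simp only [wedge_apply, conjCov_apply, _root_.add_apply, vMM, vK, v12, v34, v23, map_mul, eneg2,
      cζ]
    generalize coefG R w X S x.1 x.2 = g
    generalize dzbar (fun ζ => 1 / 2 * Complex.exp (-cbar w ζ)
          * (2 * (S ζ : ℂ) + coefT w X ζ)) x.2 = g0
    generalize dz (fun ζ => 1 / 2 * Complex.exp (-cbar w ζ)
          * (2 * (S ζ : ℂ) + coefT w X ζ)) x.2 = g1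
    generalize dzbar (coefC R w) x.2 = c0
    generalize dz (coefC R w) x.2 = c1
    rw [pC, eneg]
    have h1 := hE x.2
    have h2 := hE' x.2
    generalize starRingEnd ℂ (Complex.exp (w x.2)) = qb at *
    generalize Complex.exp (w x.2) = q at *
    field_simp
    ring
  · intro x hx u v
    have e1 := curl_smul_dζ_add (d3 (hsnd (hn ha)) x hx) (d3 (hsnd hb) x hx) u v
    have e2 := curl_smul_dζ_add (d3 (hsnd (hn ha)) x hx) (d3 (hsnd (hn hb)) x hx) u v
    have en : ∀ {F : ℂ → ℂ} (u : ℝ × ℂ), ContDiffOn ℝ ∞ F V →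
        fderiv ℝ (fun y : ℝ × ℂ => -F y.2) x u = -fderiv ℝ F x.2 u.2 := by
      intro F u hF
      rw [fderiv_comp_snd (F := fun ζ => -F ζ) (d2 (hn hF) _ hx.2), fderiv_fun_neg]
      rfl
    rw [en _ ha, en _ ha, fderiv_comp_snd (d2 hb _ hx.2), fderiv_comp_snd (d2 hb _ hx.2)] at e1
    rw [en _ ha, en _ ha, en _ hb, en _ hb] at e2
    have p2 : (reducedNormalForm R w X S).Ψ2 x = (R : ℂ) / 24
      + dzbar (dz (cbar w)) x.2 * Complex.exp (-(w x.2 + cbar w x.2)) := rfl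
    refine (congrArg₂ _ e1 e2).trans ?_
    rw [p2]
    simp only [fderiv_eq_dz_add_dzbar]
    simp only [wedge_apply, conjCov_apply, vMM, map_mul, eneg2]
    have h1 := hE x.2
    have h2 := hE' x.2
    generalize starRingEnd ℂ (Complex.exp (w x.2)) = qb at *
    generalize Complex.exp (w x.2) = q at *
    field_simp
    ring

end NormalForm

/-! ### Reading the normal form off the structure equations -/

section ReadingOff

theorem fderiv_clm_apply_const {E F G : Type*} [NormedAddCommGroup E] [NormedSpace ℝ E]
    [NormedAddCommGroup F] [NormedSpace ℝ F] [NormedAddCommGroup G] [NormedSpace ℝ G]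
    {A : E → F →L[ℝ] G} {x : E} (hA : DifferentiableAt ℝ A x) (u : E) (v : F) :
    fderiv ℝ A x u v = fderiv ℝ (fun y => A y v) x u := by
  rw [fderiv_clm_apply hA (differentiableAt_const v)]
  simp

theorem curl_eq_sub {A : ℝ × ℂ → ℝ × ℂ →L[ℝ] ℂ} {x : ℝ × ℂ} (hA : DifferentiableAt ℝ A x)
    (u v : ℝ × ℂ) :
    curl A x u v = fderiv ℝ (fun y => A y v) x u - fderiv ℝ (fun y => A y u) x v := by
  rw [curl, fderiv_clm_apply_const hA, fderiv_clm_apply_const hA]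

theorem mem_ball_prod_iff {ρ : ℝ} {x : ℝ × ℂ} :
    x ∈ Metric.ball (0 : ℝ × ℂ) ρ ↔ |x.1| < ρ ∧ ‖x.2‖ < ρ := by
  rw [mem_ball_zero_iff, Prod.norm_def, max_lt_iff, Real.norm_eq_abs]

/-- A function whose derivative along the first variable depends only on the second variable
is affine in the first variable. -/
theorem eq_affine_of_fderiv_fst {ρ : ℝ} {f : ℝ × ℂ → ℂ} {c : ℂ → ℂ}
    (hf : ∀ x ∈ Metric.ball (0 : ℝ × ℂ) ρ, DifferentiableAt ℝ f x)
    (h : ∀ x ∈ Metric.ball (0 : ℝ × ℂ) ρ, fderiv ℝ f x (1, 0) = c x.2) :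
    ∀ x ∈ Metric.ball (0 : ℝ × ℂ) ρ, f x = f (0, x.2) + x.1 * c x.2 := by
  intro x hx
  have hmem : ∀ t ∈ Set.Ioo (-ρ) ρ, (t, x.2) ∈ Metric.ball (0 : ℝ × ℂ) ρ := fun t ht =>
    mem_ball_prod_iff.2 ⟨abs_lt.2 ht, (mem_ball_prod_iff.1 hx).2⟩
  have hd : ∀ t ∈ Set.Ioo (-ρ) ρ, HasDerivAt (fun t : ℝ => f (t, x.2) - t * c x.2) 0 t := by
    intro t ht
    have h1 : HasDerivAt (fun t : ℝ => ((t, x.2) : ℝ × ℂ)) (1, 0) t :=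
      (hasDerivAt_id t).prodMk (hasDerivAt_const t x.2)
    have h2 := (hf _ (hmem t ht)).hasFDerivAt.comp_hasDerivAt t h1
    rw [h _ (hmem t ht)] at h2
    have h3 := h2.sub ((Complex.ofRealCLM.hasDerivAt (x := t)).mul_const (c x.2))
    convert! h3 using 1
    simp
  have hx1 : x.1 ∈ Set.Ioo (-ρ) ρ := abs_lt.1 (mem_ball_prod_iff.1 hx).1
  have hρ : 0 < ρ := lt_of_le_of_lt (abs_nonneg _) (mem_ball_prod_iff.1 hx).1
  have := isOpen_Ioo.is_const_of_deriv_eq_zero isPreconnected_Ioo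
    (fun t ht => (hd t ht).differentiableAt.differentiableWithinAt)
    (fun t ht => (hd t ht).deriv) hx1 (y := 0) ⟨by linarith, hρ⟩
  simp at this
  linear_combination this

/-- Data with `M = e^w dζ`, with `Γ12 + Γ34` and `Γ23` multiples of `dζ` and with `K(∂/∂r) = 1` are
in normal form. The equation for `dM` makes `w` independent of `r` and, since `Γ12` is imaginary and
`Γ34` real, determines both; the equation for `dK` gives `∂K/∂r` and the imaginary part of
`e^w̄ Γ23(∂/∂ζ)` at `r = 0`, whose real part is the free function `S`; the remaining equations fix
`Ψ2`, `∂Γ23/∂r` and `Ψ3`. -/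
theorem agreeAt_reducedNormalForm {D : ReducedData} {R ρ : ℝ}
    (hD : D.IsSolutionOn R (Metric.ball 0 ρ)) {W : ℝ × ℂ → ℂ}
    (hW : ContDiffOn ℝ ∞ W (Metric.ball 0 ρ))
    (hM : ∀ x ∈ Metric.ball (0 : ℝ × ℂ) ρ, ∀ u, D.M x u = Complex.exp (W x) * u.2)
    (hΓs : ∀ x ∈ Metric.ball (0 : ℝ × ℂ) ρ, ∀ u,
      D.Γ12 x u + D.Γ34 x u = (D.Γ12 x (0, 1) + D.Γ34 x (0, 1)) * u.2)
    (hΓ23 : ∀ x ∈ Metric.ball (0 : ℝ × ℂ) ρ, ∀ u, D.Γ23 x u = D.Γ23 x (0, 1) * u.2)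
    (hK : ∀ x ∈ Metric.ball (0 : ℝ × ℂ) ρ, D.K x (1, 0) = 1) :
    ∃ (w X : ℂ → ℂ) (S : ℂ → ℝ), ContDiffOn ℝ ∞ w (Metric.ball 0 ρ) ∧
      ContDiffOn ℝ ∞ X (Metric.ball 0 ρ) ∧ ContDiffOn ℝ ∞ S (Metric.ball 0 ρ) ∧
      ∀ x ∈ Metric.ball (0 : ℝ × ℂ) ρ,
        D.toFrameData.AgreeAt (normalForm R w X S) x := by
  have hB : IsOpen (Metric.ball (0 : ℝ × ℂ) ρ) := Metric.isOpen_ball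
  have hV : IsOpen (Metric.ball (0 : ℂ) ρ) := Metric.isOpen_ball
  have da : ∀ {F : Type} [NormedAddCommGroup F] [NormedSpace ℝ F] {A : ℝ × ℂ → F},
      ContDiffOn ℝ ∞ A (Metric.ball 0 ρ) → ∀ x ∈ Metric.ball (0 : ℝ × ℂ) ρ, DifferentiableAt ℝ A x :=
    fun hA x hx => (hA.contDiffAt (hB.mem_nhds hx)).differentiableAt (by simp)
  have d2 : ∀ {F : ℂ → ℂ}, ContDiffOn ℝ ∞ F (Metric.ball 0 ρ) →
      ∀ ζ ∈ Metric.ball (0 : ℂ) ρ, DifferentiableAt ℝ F ζ :=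
    fun hF ζ hζ => (hF.contDiffAt (hV.mem_nhds hζ)).differentiableAt (by simp)
  have mem0 : ∀ ζ ∈ Metric.ball (0 : ℂ) ρ, ((0, ζ) : ℝ × ℂ) ∈ Metric.ball (0 : ℝ × ℂ) ρ := by
    intro ζ hζ
    have h1 : ‖ζ‖ < ρ := mem_ball_zero_iff.1 hζ
    exact mem_ball_prod_iff.2 ⟨by simpa using lt_of_le_of_lt (norm_nonneg _) h1, h1⟩
  have mem2 : ∀ x ∈ Metric.ball (0 : ℝ × ℂ) ρ, x.2 ∈ Metric.ball (0 : ℂ) ρ := fun x hx =>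
    mem_ball_zero_iff.2 (mem_ball_prod_iff.1 hx).2
  have slice : ∀ {F : Type} [NormedAddCommGroup F] [NormedSpace ℝ F] {A : ℝ × ℂ → F},
      ContDiffOn ℝ ∞ A (Metric.ball 0 ρ) →
      ContDiffOn ℝ ∞ (fun ζ : ℂ => A (0, ζ)) (Metric.ball 0 ρ) := fun hA =>
    hA.comp ((contDiff_const (c := (0 : ℝ))).prodMk contDiff_id).contDiffOn mem0
  set s : ℝ × ℂ → ℂ := fun x => D.Γ12 x (0, 1) + D.Γ34 x (0, 1) with hs
  set G : ℝ × ℂ → ℂ := fun x => D.Γ23 x (0, 1) with hG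
  have cap : ∀ {A : ℝ × ℂ → ℝ × ℂ →L[ℝ] ℂ} (u : ℝ × ℂ), ContDiffOn ℝ ∞ A (Metric.ball 0 ρ) →
      ContDiffOn ℝ ∞ (fun x => A x u) (Metric.ball 0 ρ) := fun u hA =>
    hA.clm_apply contDiffOn_const
  have cs : ContDiffOn ℝ ∞ s (Metric.ball 0 ρ) := (cap _ hD.contDiff_Γ12).add (cap _ hD.contDiff_Γ34)
  have cG : ContDiffOn ℝ ∞ G (Metric.ball 0 ρ) := cap _ hD.contDiff_Γ23
  -- the real and imaginary parts of `Γ12 + Γ34`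
  have h12 : ∀ x ∈ Metric.ball (0 : ℝ × ℂ) ρ, ∀ u,
      D.Γ12 x u = (s x * u.2 - starRingEnd ℂ (s x) * starRingEnd ℂ u.2) / 2 := by
    intro x hx u
    have e1 := hΓs x hx u
    have e2 := congrArg (starRingEnd ℂ) e1
    rw [map_add, hD.imag_Γ12 x hx, hD.real_Γ34 x hx, map_mul] at e2
    linear_combination (e1 - e2) / 2
  have h34 : ∀ x ∈ Metric.ball (0 : ℝ × ℂ) ρ, ∀ u,
      D.Γ34 x u = (s x * u.2 + starRingEnd ℂ (s x) * starRingEnd ℂ u.2) / 2 := by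
    intro x hx u
    linear_combination hΓs x hx u - h12 x hx u
  -- the equation for `dM`
  have hdW : ∀ x ∈ Metric.ball (0 : ℝ × ℂ) ρ, ∀ u v : ℝ × ℂ,
      (fderiv ℝ W x u - D.Γ12 x u) * v.2 = (fderiv ℝ W x v - D.Γ12 x v) * u.2 := by
    intro x hx u v
    have e0 : D.M =ᶠ[nhds x] fun y => Complex.exp (W y) • dζ := by
      filter_upwards [hB.mem_nhds hx] with y hy
      exact ContinuousLinearMap.ext fun u => hM y hy u
    have e1 := hD.curl_M x hx u v
    have hE := (da hW x hx).hasFDerivAt.cexp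
    rw [curl_congr e0, curl_smul hE.differentiableAt (differentiableAt_const _), curl_const,
      hE.fderiv, wedge_apply, hM x hx, hM x hx] at e1
    have cζ : ∀ u : ℝ × ℂ, dζ u = u.2 := fun u => rfl
    simp only [_root_.smul_apply, smul_eq_mul, cζ] at e1
    refine mul_left_cancel₀ (Complex.exp_ne_zero (W x)) ?_
    linear_combination e1
  have hW0 : ∀ x ∈ Metric.ball (0 : ℝ × ℂ) ρ, fderiv ℝ W x (1, 0) = 0 := by
    intro x hx
    have e1 := hdW x hx (1, 0) (0, 1)
    rw [h12 x hx] at e1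
    simpa using e1
  set w : ℂ → ℂ := fun ζ => W (0, ζ) with hw
  have cw : ContDiffOn ℝ ∞ w (Metric.ball 0 ρ) := slice hW
  have hWw : ∀ x ∈ Metric.ball (0 : ℝ × ℂ) ρ, W x = w x.2 := by
    intro x hx
    have := eq_affine_of_fderiv_fst (c := fun _ => 0) (da hW) hW0 x hx
    simpa using this
  have fW : ∀ x ∈ Metric.ball (0 : ℝ × ℂ) ρ, ∀ u, fderiv ℝ W x u = fderiv ℝ w x.2 u.2 := by
    intro x hx u
    have e0 : W =ᶠ[nhds x] fun y => w y.2 := by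
      filter_upwards [hB.mem_nhds hx] with y hy using hWw y hy
    rw [e0.fderiv_eq, fderiv_comp_snd (d2 cw _ (mem2 x hx))]
  have hwb : ∀ x ∈ Metric.ball (0 : ℝ × ℂ) ρ, dzbar w x.2 = -starRingEnd ℂ (s x) / 2 := by
    intro x hx
    have e1 := hdW x hx (0, 1) (0, Complex.I)
    rw [h12 x hx, h12 x hx, fW x hx, fW x hx] at e1
    simp at e1
    rw [dzbar]
    linear_combination (-Complex.I / 2) * e1 + (fderiv ℝ w x.2 1 / 2 + starRingEnd ℂ (s x) / 2) * Complex.I_sq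
  set a : ℂ → ℂ := dz (cbar w) with ha
  have caa : ContDiffOn ℝ ∞ a (Metric.ball 0 ρ) := contDiffOn_dz hV (contDiffOn_cbar cw)
  have hab : ∀ ζ ∈ Metric.ball (0 : ℂ) ρ, a ζ = starRingEnd ℂ (dzbar w ζ) := fun ζ hζ =>
    dz_cbar (d2 cw ζ hζ)
  have hsa : ∀ x ∈ Metric.ball (0 : ℝ × ℂ) ρ, s x = -2 * a x.2 := by
    intro x hx
    rw [hab _ (mem2 x hx), hwb x hx]
    simp [map_ofNat]
    ring
  -- the components of `K`
  set Y : ℝ × ℂ → ℂ := fun x => (D.K x (0, 1) - Complex.I * D.K x (0, Complex.I)) / 2 with hY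
  have cY : ContDiffOn ℝ ∞ Y (Metric.ball 0 ρ) :=
    ((cap _ hD.contDiff_K).sub (contDiffOn_const.mul (cap _ hD.contDiff_K))).div_const 2
  have hKu : ∀ x ∈ Metric.ball (0 : ℝ × ℂ) ρ, ∀ u,
      D.K x u = u.1 + Y x * u.2 + starRingEnd ℂ (Y x) * starRingEnd ℂ u.2 := by
    intro x hx u
    have hu : u = u.1 • ((1, 0) : ℝ × ℂ) + u.2.re • ((0, 1) : ℝ × ℂ)
        + u.2.im • ((0, Complex.I) : ℝ × ℂ) := by
      refine Prod.ext (by simp) ?_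
      simp
    have e1 : D.K x u = u.1 + u.2.re * D.K x (0, 1) + u.2.im * D.K x (0, Complex.I) := by
      conv_lhs => rw [hu]
      rw [map_add, map_add, map_smul, map_smul, map_smul, hK x hx]
      simp
    have e2 := hD.real_K x hx (0, 1)
    have e3 := hD.real_K x hx (0, Complex.I)
    have h2 : u.2 = u.2.re + u.2.im * Complex.I := (Complex.re_add_im _).symm
    have h3 : starRingEnd ℂ u.2 = u.2.re - u.2.im * Complex.I := by
      apply Complex.ext <;> simp
    rw [e1, h3]
    simp only [hY, map_div₀, map_sub, map_mul, e2, e3, Complex.conj_I, map_ofNat]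
    linear_combination (u.2.im * D.K x (0, Complex.I)) * Complex.I_sq
      - ((D.K x (0, 1) - Complex.I * D.K x (0, Complex.I)) / 2) * h2
  have hdK : ∀ x ∈ Metric.ball (0 : ℝ × ℂ) ρ, ∀ u : ℂ,
      fderiv ℝ (fun y => D.K y (0, u)) x (1, 0) = -D.Γ34 x (0, u) := by
    intro x hx u
    have e1 := hD.curl_K x hx (1, 0) (0, u)
    have e0 : (fun y => D.K y (1, 0)) =ᶠ[nhds x] fun _ => (1 : ℂ) := by
      filter_upwards [hB.mem_nhds hx] with y hy using hK y hy
    have e2 := hΓ23 x hx (1, 0)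
    rw [curl_eq_sub (da hD.contDiff_K x hx), e0.fderiv_eq] at e1
    simp only [wedge_apply, conjCov_apply, hM x hx, hK x hx, e2, h34 x hx (1, 0)] at e1
    simp at e1
    exact e1
  have hYr : ∀ x ∈ Metric.ball (0 : ℝ × ℂ) ρ, fderiv ℝ Y x (1, 0) = a x.2 := by
    intro x hx
    have k1 := (da (cap (0, 1) hD.contDiff_K) x hx).hasFDerivAt
    have k2 := (da (cap (0, Complex.I) hD.contDiff_K) x hx).hasFDerivAt
    have k3 : HasFDerivAt Y ((2 : ℂ)⁻¹ • (fderiv ℝ (fun y => D.K y (0, 1)) x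
        - Complex.I • fderiv ℝ (fun y => D.K y (0, Complex.I)) x)) x := by
      have := (k1.sub (k2.const_mul Complex.I)).const_mul (2 : ℂ)⁻¹
      refine this.congr_of_eventuallyEq (Filter.Eventually.of_forall fun y => ?_)
      simp only [hY, Pi.sub_apply]
      ring
    rw [k3.fderiv]
    simp only [_root_.smul_apply, _root_.sub_apply, hdK x hx, h34 x hx, smul_eq_mul, hsa x hx]
    simp [map_ofNat]
    linear_combination ((-a x.2 + starRingEnd ℂ (a x.2)) / 2) * Complex.I_sq
  have hYa := eq_affine_of_fderiv_fst (da cY) hYr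
  set X : ℂ → ℂ := fun ζ => Y (0, ζ) with hX
  have cX : ContDiffOn ℝ ∞ X (Metric.ball 0 ρ) := slice cY
  have fY : ∀ x ∈ Metric.ball (0 : ℝ × ℂ) ρ, ∀ u, fderiv ℝ Y x u
      = fderiv ℝ X x.2 u.2 + u.1 * a x.2 + x.1 * fderiv ℝ a x.2 u.2 := by
    intro x hx u
    have e0 : Y =ᶠ[nhds x] fun y => X y.2 + y.1 * a y.2 := by
      filter_upwards [hB.mem_nhds hx] with y hy using hYa y hy
    rw [e0.fderiv_eq, fderiv_affine (d2 cX _ (mem2 x hx)) (d2 caa _ (mem2 x hx))]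
  have fK : ∀ x ∈ Metric.ball (0 : ℝ × ℂ) ρ, ∀ u : ℝ × ℂ, ∀ v : ℂ,
      fderiv ℝ (fun y => D.K y (0, v)) x u
        = fderiv ℝ Y x u * v + starRingEnd ℂ (fderiv ℝ Y x u * v) := by
    intro x hx u v
    have e0 : (fun y => D.K y (0, v)) =ᶠ[nhds x] fun y => Y y * v + starRingEnd ℂ (Y y * v) := by
      filter_upwards [hB.mem_nhds hx] with y hy
      rw [hKu y hy, map_mul]
      simp
    have k1 := (da cY x hx).hasFDerivAt.mul_const v
    have k2 := (Complex.conjCLE : ℂ →L[ℝ] ℂ).hasFDerivAt.comp x k1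
    have k3 : HasFDerivAt (fun y => Y y * v + starRingEnd ℂ (Y y * v)) _ x := k1.add k2
    rw [e0.fderiv_eq, k3.fderiv]
    simp [mul_comm]
  have hconjexp : ∀ x ∈ Metric.ball (0 : ℝ × ℂ) ρ,
      starRingEnd ℂ (Complex.exp (w x.2)) = Complex.exp (cbar w x.2) := by
    intro x hx
    rw [← Complex.exp_conj]
    rfl
  have hE : ∀ ζ, Complex.exp (w ζ) ≠ 0 := fun ζ => Complex.exp_ne_zero _
  have hE' : ∀ ζ, Complex.exp (cbar w ζ) ≠ 0 := fun ζ => Complex.exp_ne_zero _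
  -- the imaginary part of `Γ23`, from the equation for `dK`
  have hT : ∀ ζ ∈ Metric.ball (0 : ℂ) ρ, G (0, ζ) * Complex.exp (cbar w ζ)
      - starRingEnd ℂ (G (0, ζ) * Complex.exp (cbar w ζ)) = coefT w X ζ := by
    intro ζ hζ
    have hx := mem0 ζ hζ
    have e1 := hD.curl_K _ hx (0, 1) (0, Complex.I)
    have hw' := hwb _ hx
    have hs' : starRingEnd ℂ (s (0, ζ)) = -2 * starRingEnd ℂ (a ζ) := by
      rw [hsa _ hx]; simp [map_ofNat]
    have ea : dz (cbar w) ζ = a ζ := rfl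
    have eX : Y (0, ζ) = X ζ := rfl
    have ecX : cbar X ζ = starRingEnd ℂ (X ζ) := rfl
    have ecc : starRingEnd ℂ (Complex.exp (cbar w ζ)) = Complex.exp (w ζ) := by
      rw [← hconjexp _ hx, Complex.conj_conj]
    rw [curl_eq_sub (da hD.contDiff_K _ hx), fK _ hx, fK _ hx, fY _ hx, fY _ hx] at e1
    simp only [wedge_apply, conjCov_apply, hM _ hx, hWw _ hx, hΓ23 _ hx (0, Complex.I), h34 _ hx,
      hKu _ hx, map_mul, map_add, hconjexp _ hx, hsa _ hx, eX] at e1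
    simp [map_ofNat] at e1
    rw [coefT, dz_cbar (d2 cX ζ hζ), ea, ecX]
    have hw2 : dzbar w ζ = starRingEnd ℂ (a ζ) := by
      have := hwb _ hx
      rw [hs'] at this
      rw [this]
      ring
    rw [hw2, map_mul, ecc]
    simp only [dzbar, map_add, map_div₀, map_mul, Complex.conj_I, map_ofNat, hG]
    linear_combination (Complex.I / 2) * e1
      + (-(fderiv ℝ X ζ 1 - starRingEnd ℂ (fderiv ℝ X ζ 1)) / 2
        + (D.Γ23 (0, ζ) (0, 1) * Complex.exp (cbar w ζ)
          - starRingEnd ℂ (D.Γ23 (0, ζ) (0, 1)) * Complex.exp (w ζ))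
        - starRingEnd ℂ (a ζ) * X ζ + a ζ * starRingEnd ℂ (X ζ)) * Complex.I_sq
  -- `Ψ2`, from the equation for `d(Γ12 + Γ34)`
  have hΨ2 : ∀ x ∈ Metric.ball (0 : ℝ × ℂ) ρ, dzbar a x.2
      = (D.Ψ2 x - (R : ℂ) / 24) * (Complex.exp (w x.2) * Complex.exp (cbar w x.2)) := by
    intro x hx
    have e1 := hD.curl_Γs x hx (0, 1) (0, Complex.I)
    have k : ∀ u : ℂ, (fun y => D.Γ12 y (0, u) + D.Γ34 y (0, u)) =ᶠ[nhds x]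
        fun y => (fun ζ => (-2 * u) * a ζ) y.2 := by
      intro u
      filter_upwards [hB.mem_nhds hx] with y hy
      rw [hΓs y hy]
      change s y * u = _
      rw [hsa y hy]
      ring
    have k' : ∀ u v : ℂ, fderiv ℝ (fun y => D.Γ12 y (0, u)) x (0, v)
        + fderiv ℝ (fun y => D.Γ34 y (0, u)) x (0, v) = -2 * u * fderiv ℝ a x.2 v := by
      intro u v
      have h1 := fderiv_fun_add (da (cap (0, u) hD.contDiff_Γ12) x hx)
        (da (cap (0, u) hD.contDiff_Γ34) x hx)
      have h2 := congrArg (fun T : ℝ × ℂ →L[ℝ] ℂ => T (0, v)) h1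
      simp only [_root_.add_apply] at h2
      rw [← h2, (k u).fderiv_eq, fderiv_comp_snd ((d2 caa _ (mem2 x hx)).const_mul _),
        fderiv_const_mul (d2 caa _ (mem2 x hx))]
      rfl
    rw [curl_eq_sub (da hD.contDiff_Γ12 x hx), curl_eq_sub (da hD.contDiff_Γ34 x hx)] at e1
    simp only [wedge_apply, conjCov_apply, hM x hx, hWw x hx, map_mul, hconjexp x hx] at e1
    simp at e1
    have k1 := k' Complex.I 1
    have k2 := k' 1 Complex.I
    rw [dzbar]
    linear_combination (Complex.I / 4) * e1 - (Complex.I / 4) * k1 + (Complex.I / 4) * k2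
      + (fderiv ℝ a x.2 1 / 2 - (D.Ψ2 x - (R : ℂ) / 24)
        * (Complex.exp (w x.2) * Complex.exp (cbar w x.2))) * Complex.I_sq
  have hP : ∀ x ∈ Metric.ball (0 : ℝ × ℂ) ρ,
      (D.Ψ2 x + (R : ℂ) / 12) * Complex.exp (w x.2) = coefC R w x.2 := by
    intro x hx
    have h1 := hΨ2 x hx
    have h2 := hE' x.2
    rw [coefC, Complex.exp_neg]
    change _ = _ + dzbar a x.2 * _
    rw [h1]
    field_simp
    ring
  -- `∂Γ23/∂r`, from the equation for `dΓ23`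
  have hGr : ∀ x ∈ Metric.ball (0 : ℝ × ℂ) ρ, fderiv ℝ G x (1, 0) = coefC R w x.2 := by
    intro x hx
    have e1 := hD.curl_Γ23 x hx (1, 0) (0, 1)
    have e0 : (fun y => D.Γ23 y (1, 0)) =ᶠ[nhds x] fun _ => (0 : ℂ) := by
      filter_upwards [hB.mem_nhds hx] with y hy
      rw [hΓ23 y hy]
      simp
    rw [curl_eq_sub (da hD.contDiff_Γ23 x hx), e0.fderiv_eq] at e1
    simp only [wedge_apply, conjCov_apply, hM x hx, hWw x hx, hK x hx, hΓ23 x hx (1, 0),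
      _root_.add_apply, hΓs x hx (1, 0)] at e1
    simp at e1
    rw [← hP x hx, ← e1]
  have hGa := eq_affine_of_fderiv_fst (da cG) hGr
  set S : ℂ → ℝ := fun ζ => (G (0, ζ) * Complex.exp (cbar w ζ)).re with hS
  have cS : ContDiffOn ℝ ∞ S (Metric.ball 0 ρ) :=
    Complex.reCLM.contDiff.comp_contDiffOn ((slice cG).mul
      (Complex.contDiff_exp.comp_contDiffOn (contDiffOn_cbar cw)))
  have hGG : ∀ x ∈ Metric.ball (0 : ℝ × ℂ) ρ, G x = coefG R w X S x.1 x.2 := by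
    intro x hx
    have h1 := hT _ (mem2 x hx)
    have h2 := Complex.add_conj (G (0, x.2) * Complex.exp (cbar w x.2))
    have h3 : Complex.exp (-cbar w x.2) * Complex.exp (cbar w x.2) = 1 := by
      rw [← Complex.exp_add]; simp
    rw [hGa x hx, coefG, ← h1]
    have h4 : ((S x.2 : ℝ) : ℂ) = ((G (0, x.2) * Complex.exp (cbar w x.2)).re : ℂ) := rfl
    rw [h4]
    have h5 : 2 * ((G (0, x.2) * Complex.exp (cbar w x.2)).re : ℂ)
        = G (0, x.2) * Complex.exp (cbar w x.2)
          + starRingEnd ℂ (G (0, x.2) * Complex.exp (cbar w x.2)) := by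
      rw [h2]; push_cast; ring
    rw [h5]
    linear_combination (-G (0, x.2)) * h3
  have hΨ3 : ∀ x ∈ Metric.ball (0 : ℝ × ℂ) ρ,
      D.Ψ3 x * (Complex.exp (w x.2) * Complex.exp (cbar w x.2))
        = dzbar (coefG R w X S x.1) x.2 - coefC R w x.2 * starRingEnd ℂ (Y x) := by
    intro x hx
    have e1 := hD.curl_Γ23 x hx (0, 1) (0, Complex.I)
    have e0 : (fun y => D.Γ23 y (0, Complex.I)) =ᶠ[nhds x] fun y => Complex.I * G y := by
      filter_upwards [hB.mem_nhds hx] with y hy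
      rw [hΓ23 y hy, mul_comm]
    have gs : ∀ u : ℂ, fderiv ℝ G x (0, u) = fderiv ℝ (coefG R w X S x.1) x.2 u := by
      intro u
      have h1 : HasFDerivAt (fun ζ : ℂ => ((x.1, ζ) : ℝ × ℂ)) (ContinuousLinearMap.inr ℝ ℝ ℂ) x.2 := by
        have := (hasFDerivAt_const (𝕜 := ℝ) x.1 x.2).prodMk (hasFDerivAt_id x.2)
        exact this
      have h2 : HasFDerivAt (fun ζ : ℂ => G (x.1, ζ))
          ((fderiv ℝ G x).comp (ContinuousLinearMap.inr ℝ ℝ ℂ)) x.2 :=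
        HasFDerivAt.comp (g := G) x.2 (da cG x hx).hasFDerivAt h1
      have h3 : coefG R w X S x.1 =ᶠ[nhds x.2] fun ζ : ℂ => G (x.1, ζ) := by
        filter_upwards [hV.mem_nhds (mem2 x hx)] with ζ hζ
        exact (hGG (x.1, ζ) (mem_ball_prod_iff.2
          ⟨(mem_ball_prod_iff.1 hx).1, mem_ball_zero_iff.1 hζ⟩)).symm
      rw [h3.fderiv_eq, h2.fderiv]
      rfl
    rw [curl_eq_sub (da hD.contDiff_Γ23 x hx), e0.fderiv_eq,
      fderiv_const_mul (da cG x hx)] at e1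
    change Complex.I * fderiv ℝ G x (0, 1) - fderiv ℝ G x (0, Complex.I) = _ at e1
    rw [gs, gs] at e1
    simp only [wedge_apply, conjCov_apply, hM x hx, hWw x hx, hΓ23 x hx (0, Complex.I), map_mul,
      _root_.add_apply, hΓs x hx (0, Complex.I), hconjexp x hx, hKu x hx] at e1
    simp at e1
    rw [← hP x hx, dzbar]
    linear_combination (Complex.I / 2) * e1 +
      (-fderiv ℝ (coefG R w X S x.1) x.2 1 / 2 + D.Ψ3 x * (Complex.exp (w x.2) * Complex.exp (cbar w x.2))
        + (D.Ψ2 x + (R : ℂ) / 12) * Complex.exp (w x.2) * starRingEnd ℂ (Y x)) * Complex.I_sq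
  refine ⟨w, X, S, cw, cX, cS, fun x hx => ?_⟩
  have hag : dzbar w x.2 = starRingEnd ℂ (a x.2) := by
    rw [hab _ (mem2 x hx), Complex.conj_conj]
  have h3 : Complex.exp (-(w x.2 + cbar w x.2)) * (Complex.exp (w x.2) * Complex.exp (cbar w x.2)) = 1 := by
    rw [← Complex.exp_add, ← Complex.exp_add]; simp
  have hYx : starRingEnd ℂ (Y x) = cbar X x.2 + x.1 * dzbar w x.2 := by
    rw [hYa x hx, map_add, map_mul, Complex.conj_ofReal, hag]
    rfl
  rw [← toFrameData_reducedNormalForm]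
  refine ⟨?_, ?_, ?_, ?_, ?_, rfl, rfl, rfl, ?_, ?_⟩
  · refine ContinuousLinearMap.ext fun u => (hM x hx u).trans ?_
    rw [hWw x hx]
    rfl
  · refine ContinuousLinearMap.ext fun u => (hKu x hx u).trans ?_
    rw [hYx, hYa x hx]
    rfl
  · refine ContinuousLinearMap.ext fun u => (h12 x hx u).trans ?_
    change _ = -a x.2 * u.2 + dzbar w x.2 * starRingEnd ℂ u.2
    rw [hag, hsa x hx]
    simp [map_ofNat]
    ring
  · refine ContinuousLinearMap.ext fun u => (h34 x hx u).trans ?_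
    change _ = -a x.2 * u.2 + -dzbar w x.2 * starRingEnd ℂ u.2
    rw [hag, hsa x hx]
    simp [map_ofNat]
    ring
  · refine ContinuousLinearMap.ext fun u => (hΓ23 x hx u).trans ?_
    change G x * u.2 = coefG R w X S x.1 x.2 * u.2
    rw [hGG x hx]
  · change D.Ψ2 x = (R : ℂ) / 24 + dzbar a x.2 * Complex.exp (-(w x.2 + cbar w x.2))
    rw [hΨ2 x hx]
    linear_combination (-(D.Ψ2 x - (R : ℂ) / 24)) * h3
  · change D.Ψ3 x = Complex.exp (-(w x.2 + cbar w x.2)) *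
      (dzbar (coefG R w X S x.1) x.2 - coefC R w x.2 * (cbar X x.2 + x.1 * dzbar w x.2))
    rw [← hYx, ← hΨ3 x hx]
    linear_combination (-D.Ψ3 x) * h3

end ReadingOff

/-! ### Potentials modulo `dζ` -/

section Coordinates

/-- The differentials of a coordinate change and of its inverse are inverse to each other. -/
theorem fderiv_symm_apply {e : OpenPartialHomeomorph (ℝ × ℂ) (ℝ × ℂ)}
    (he : ContDiffOn ℝ ∞ e e.source) (he' : ContDiffOn ℝ ∞ e.symm e.target) {x : ℝ × ℂ}
    (hx : x ∈ e.target) (u : ℝ × ℂ) : fderiv ℝ e (e.symm x) (fderiv ℝ e.symm x u) = u := by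
  have h1 : DifferentiableAt ℝ e.symm x :=
    (he'.contDiffAt (e.open_target.mem_nhds hx)).differentiableAt (by simp)
  have h2 : DifferentiableAt ℝ e (e.symm x) :=
    (he.contDiffAt (e.open_source.mem_nhds (e.map_target hx))).differentiableAt (by simp)
  have h3 := (h2.hasFDerivAt.comp x h1.hasFDerivAt).fderiv
  have h4 : (e ∘ e.symm : ℝ × ℂ → ℝ × ℂ) =ᶠ[nhds x] id := by
    filter_upwards [e.open_target.mem_nhds hx] with y hy using e.right_inv hy
  rw [h4.fderiv_eq, fderiv_id] at h3
  exact (congrArg (fun T : ℝ × ℂ →L[ℝ] ℝ × ℂ => T u) h3).symm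

theorem exists_equiv_of_injective {T : ℝ × ℂ →L[ℝ] ℝ × ℂ} (hT : ∀ u, T u = 0 → u = 0) :
    ∃ e : (ℝ × ℂ) ≃L[ℝ] (ℝ × ℂ), (e : ℝ × ℂ →L[ℝ] ℝ × ℂ) = T := by
  have hinj : Function.Injective T.toLinearMap := (injective_iff_map_eq_zero _).2 hT
  refine ⟨(LinearEquiv.ofInjectiveEndo T.toLinearMap hinj).toContinuousLinearEquiv, ?_⟩
  ext u <;> rfl

theorem pair_decomposition (u : ℝ × ℂ) : u = u.1 • ((1, 0) : ℝ × ℂ) + u.2.re • ((0, 1) : ℝ × ℂ)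
    + u.2.im • ((0, Complex.I) : ℝ × ℂ) := by
  refine Prod.ext (by simp) ?_
  simp

/-- A covector on `ℝ × ℂ` that kills `∂/∂r` and `∂/∂ζbar` is a multiple of `dζ`. -/
theorem apply_eq_mul_snd {T : ℝ × ℂ →L[ℝ] ℂ} (h0 : T (1, 0) = 0)
    (h1 : T (0, 1) + Complex.I * T (0, Complex.I) = 0) (u : ℝ × ℂ) : T u = T (0, 1) * u.2 := by
  have e1 : T u = u.2.re * T (0, 1) + u.2.im * T (0, Complex.I) := by
    conv_lhs => rw [pair_decomposition u]
    rw [map_add, map_add, map_smul, map_smul, map_smul, h0]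
    simp
  have h2 : u.2 = u.2.re + u.2.im * Complex.I := (Complex.re_add_im _).symm
  rw [e1]
  linear_combination (-T (0, 1)) * h2 - (Complex.I * u.2.im) * h1
    + (u.2.im * T (0, Complex.I)) * Complex.I_sq

/-- Solution of `dh ≡ α` modulo `dζ`, for a one-form `α` that satisfies the necessary
compatibility condition. -/
theorem exists_potential_mod_dζ {α : ℝ × ℂ → ℝ × ℂ →L[ℝ] ℂ} {U : Set (ℝ × ℂ)} (hU : IsOpen U)
    (h0 : (0 : ℝ × ℂ) ∈ U) (hα : ContDiffOn ℝ ∞ α U)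
    (hc : ∀ x ∈ U, curl α x (1, 0) (0, 1) + Complex.I * curl α x (1, 0) (0, Complex.I) = 0) :
    ∃ h : ℝ × ℂ → ℂ, ContDiff ℝ ∞ h ∧ ∀ᶠ x in nhds (0 : ℝ × ℂ), ∀ u,
      fderiv ℝ h x u - α x u = (fderiv ℝ h x (0, 1) - α x (0, 1)) * u.2 := by
  have hα0 : ContDiffOn ℝ ∞ (fun x => α x (1, 0)) U := hα.clm_apply contDiffOn_const
  obtain ⟨f, hf, hfα⟩ := exists_contDiff_eventuallyEq hU hα0 h0
  obtain ⟨H, hH, hHf⟩ := exists_smooth_primitive hf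
  have dH : ∀ x, DifferentiableAt ℝ H x := fun x => hH.contDiffAt.differentiableAt (by simp)
  have hH0 : ∀ x, fderiv ℝ H x (1, 0) = f x := by
    intro x
    have h1 : HasDerivAt (fun t : ℝ => ((t, x.2) : ℝ × ℂ)) (1, 0) x.1 :=
      (hasDerivAt_id x.1).prodMk (hasDerivAt_const x.1 x.2)
    have h2 := HasFDerivAt.comp_hasDerivAt (l := H) x.1 (dH x).hasFDerivAt h1
    exact h2.unique (hHf x)
  have hH1 : ContDiff ℝ ∞ (fderiv ℝ H) := hH.fderiv_right (by simp)
  -- a ball on which everything is defined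
  obtain ⟨ρ, hρ, hball⟩ : ∃ ρ > 0, ∀ x ∈ Metric.ball (0 : ℝ × ℂ) ρ, x ∈ U ∧ f x = α x (1, 0) := by
    have := Filter.inter_mem (hU.mem_nhds h0) hfα
    obtain ⟨ρ, hρ, h⟩ := Metric.mem_nhds_iff.1 this
    exact ⟨ρ, hρ, fun x hx => h hx⟩
  have hB : IsOpen (Metric.ball (0 : ℝ × ℂ) ρ) := Metric.isOpen_ball
  have hV : IsOpen (Metric.ball (0 : ℂ) ρ) := Metric.isOpen_ball
  set β : ℝ × ℂ → ℝ × ℂ →L[ℝ] ℂ := fun x => α x - fderiv ℝ H x with hβ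
  have cβ : ContDiffOn ℝ ∞ β (Metric.ball 0 ρ) :=
    (hα.mono fun x hx => (hball x hx).1).sub hH1.contDiffOn
  have dβ : ∀ x ∈ Metric.ball (0 : ℝ × ℂ) ρ, DifferentiableAt ℝ β x := fun x hx =>
    (cβ.contDiffAt (hB.mem_nhds hx)).differentiableAt (by simp)
  have hβ0 : ∀ x ∈ Metric.ball (0 : ℝ × ℂ) ρ, β x (1, 0) = 0 := by
    intro x hx
    simp only [hβ, _root_.sub_apply, hH0, (hball x hx).2, sub_self]
  set b : ℝ × ℂ → ℂ := fun x => (β x (0, 1) + Complex.I * β x (0, Complex.I)) / 2 with hb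
  have cap : ∀ u : ℝ × ℂ, ContDiffOn ℝ ∞ (fun x => β x u) (Metric.ball 0 ρ) := fun u =>
    cβ.clm_apply contDiffOn_const
  have cb : ContDiffOn ℝ ∞ b (Metric.ball 0 ρ) :=
    ((cap _).add (contDiffOn_const.mul (cap _))).div_const 2
  have hβr : ∀ x ∈ Metric.ball (0 : ℝ × ℂ) ρ, ∀ u,
      fderiv ℝ (fun y => β y u) x (1, 0) = curl α x (1, 0) u := by
    intro x hx u
    have e1 := curl_sub ((hα.contDiffAt (hU.mem_nhds (hball x hx).1)).differentiableAt (by simp))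
      (hH1.contDiffAt.differentiableAt (by simp)) (1, 0) u
    rw [curl_fderiv hH.contDiffAt, sub_zero] at e1
    have e2 := curl_eq_sub (dβ x hx) (1, 0) u
    have e0 : (fun y => β y (1, 0)) =ᶠ[nhds x] fun _ => (0 : ℂ) := by
      filter_upwards [hB.mem_nhds hx] with y hy using hβ0 y hy
    rw [e0.fderiv_eq] at e2
    simp at e2
    rw [← e2]
    exact e1
  have hbr : ∀ x ∈ Metric.ball (0 : ℝ × ℂ) ρ, fderiv ℝ b x (1, 0) = 0 := by
    intro x hx
    have k : ∀ u, DifferentiableAt ℝ (fun x => β x u) x := fun u =>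
      ((cap u).contDiffAt (hB.mem_nhds hx)).differentiableAt (by simp)
    have k3 : HasFDerivAt b ((2 : ℂ)⁻¹ • (fderiv ℝ (fun y => β y (0, 1)) x
        + Complex.I • fderiv ℝ (fun y => β y (0, Complex.I)) x)) x := by
      have := ((k (0, 1)).hasFDerivAt.add
        ((k (0, Complex.I)).hasFDerivAt.const_mul Complex.I)).const_mul (2 : ℂ)⁻¹
      refine this.congr_of_eventuallyEq (Filter.Eventually.of_forall fun y => ?_)
      simp only [hb, Pi.add_apply]
      ring
    rw [k3.fderiv]
    simp only [_root_.smul_apply, _root_.add_apply, hβr x hx, smul_eq_mul, hc x (hball x hx).1,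
      mul_zero]
  have hba : ∀ x ∈ Metric.ball (0 : ℝ × ℂ) ρ, b x = b (0, x.2) := by
    intro x hx
    have := eq_affine_of_fderiv_fst (c := fun _ => 0)
      (fun x hx => (cb.contDiffAt (hB.mem_nhds hx)).differentiableAt (by simp)) hbr x hx
    simpa using this
  have cb0 : ContDiffOn ℝ ∞ (fun ζ : ℂ => b (0, ζ)) (Metric.ball 0 ρ) :=
    cb.comp ((contDiff_const (c := (0 : ℝ))).prodMk contDiff_id).contDiffOn fun ζ hζ => by
      refine mem_ball_prod_iff.2 ⟨?_, mem_ball_zero_iff.1 hζ⟩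
      simpa using hρ
  obtain ⟨g, hg, hgb⟩ := exists_contDiff_eventuallyEq hV cb0 (Metric.mem_ball_self hρ)
  obtain ⟨y, hy, hyg, -⟩ := exists_beltrami_solution (μ := fun _ => 0) contDiff_const hg rfl
  refine ⟨fun x => H x + y x.2, hH.add (hy.comp contDiff_snd), ?_⟩
  have hsnd : Filter.Tendsto (Prod.snd : ℝ × ℂ → ℂ) (nhds 0) (nhds 0) :=
    (continuous_snd (X := ℝ) (Y := ℂ)).tendsto 0
  filter_upwards [Metric.ball_mem_nhds 0 hρ, hsnd hyg, hsnd hgb] with x hx hx1 hx2 u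
  have dy : DifferentiableAt ℝ y x.2 := hy.contDiffAt.differentiableAt (by simp)
  have hfd : ∀ u, fderiv ℝ (fun x : ℝ × ℂ => H x + y x.2) x u - α x u
      = fderiv ℝ y x.2 u.2 - β x u := by
    intro u
    have : DifferentiableAt ℝ (fun x : ℝ × ℂ => y x.2) x :=
      (hy.comp contDiff_snd).contDiffAt.differentiableAt (by simp)
    rw [fderiv_fun_add (dH x) this, _root_.add_apply, fderiv_comp_snd dy]
    simp only [hβ, _root_.sub_apply]
    ring
  have hzb : dzbar y x.2 = b x := by
    have h1 : dzbar y x.2 = 0 * dz y x.2 + g x.2 := hx1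
    have h2 : g x.2 = b (0, x.2) := hx2
    rw [h1, h2, ← hba x hx]
    ring
  rw [hfd, hfd]
  refine apply_eq_mul_snd (T := (fderiv ℝ y x.2).comp (ContinuousLinearMap.snd ℝ ℝ ℂ) - β x) ?_ ?_ u
  · simp [hβ0 x hx]
  · simp only [hb, dzbar] at hzb
    simp
    linear_combination 2 * hzb

end Coordinates

/-! ### The choice of gauge -/

section Gauge

theorem mem_maximalAtlas_prod {e : OpenPartialHomeomorph (ℝ × ℂ) (ℝ × ℂ)}
    (he : ContDiffOn ℝ ∞ e e.source) (he' : ContDiffOn ℝ ∞ e.symm e.target) :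
    e ∈ IsManifold.maximalAtlas 𝓘(ℝ, ℝ × ℂ) ∞ (ℝ × ℂ) :=
  e.mem_maximalAtlas_of_contMDiffOn (contMDiffOn_iff_contDiffOn.2 he)
    (contMDiffOn_iff_contDiffOn.2 he')

/-- The gauge transformation of reduced data is the general one with `A = e^{Re h}` and
`φ = Im h`. -/
theorem ReducedData.gauge_agreeAt (D : ReducedData) (h z : ℝ × ℂ → ℂ) (q : ℝ × ℂ) :
    (D.toFrameData.gauge (fun x => Real.exp (h x).re) (fun x => (h x).im) z).AgreeAt
      (D.gauge h z).toFrameData q := by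
  have hexp : (Real.exp (h q).re : ℂ) * Complex.exp (Complex.I * (h q).im) = Complex.exp (h q) := by
    rw [Complex.ofReal_exp, ← Complex.exp_add, mul_comm Complex.I, Complex.re_add_im]
  refine ⟨rfl, rfl, ?_, ?_, ?_, ?_, ?_, ?_, ?_, ?_⟩
  · refine ContinuousLinearMap.ext fun u : ℝ × ℂ => ?_
    have d := congrArg (fun T : ℝ × ℂ →L[ℝ] ℂ => T u) (dFun_self (fun y => ((h y).im : ℂ)) q)
    have k : ∀ a b : ℂ, a = b → D.Γ12 q u + z q * 0 - starRingEnd ℂ (z q) * starRingEnd ℂ 0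
        + Complex.I * a = D.Γ12 q u + Complex.I * b := by
      rintro a _ rfl
      simp
    exact k _ _ d
  · refine ContinuousLinearMap.ext fun u : ℝ × ℂ => ?_
    have d := congrArg (fun T : ℝ × ℂ →L[ℝ] ℂ => T u)
      (dFun_self (fun y => (Real.log (Real.exp (h y).re) : ℂ)) q)
    have hl : (fun y => (Real.log (Real.exp (h y).re) : ℂ)) = fun y => ((h y).re : ℂ) := by
      simp only [Real.log_exp]
    have k : ∀ a b : ℂ, a = b → D.Γ34 q u + z q * 0 + starRingEnd ℂ (z q) * starRingEnd ℂ 0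
        + a = D.Γ34 q u + b := by
      rintro a _ rfl
      simp
    refine (k _ _ d).trans ?_
    rw [hl]
    rfl
  · refine ContinuousLinearMap.ext fun u : ℝ × ℂ => ?_
    have d := congrArg (fun T : ℝ × ℂ →L[ℝ] ℂ => T u) (dFun_self z q)
    have k : ∀ a b : ℂ, a = b → (Real.exp (h q).re : ℂ) * Complex.exp (Complex.I * (h q).im) *
        (D.Γ23 q u + z q * (D.Γ12 q u + D.Γ34 q u) - (z q) ^ 2 * (-0) - a)
        = Complex.exp (h q) * (D.Γ23 q u + z q * (D.Γ12 q u + D.Γ34 q u) - b) := by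
      rintro a _ rfl
      rw [hexp]
      ring
    exact k _ _ d
  · exact ContinuousLinearMap.ext fun u : ℝ × ℂ => mul_zero _
  · exact mul_zero _
  · change _ * (0 - z q * 0) = (0 : ℂ)
    ring
  · change D.Ψ2 q - 2 * z q * 0 + (z q) ^ 2 * 0 = D.Ψ2 q
    ring
  · change (Real.exp (h q).re : ℂ) * Complex.exp (Complex.I * (h q).im) *
      (D.Ψ3 q - 3 * z q * D.Ψ2 q + 3 * (z q) ^ 2 * 0 - (z q) ^ 3 * 0)
      = Complex.exp (h q) * (D.Ψ3 q - 3 * z q * D.Ψ2 q)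
    rw [hexp]
    ring

/-- A gauge transformation and a coordinate change that lead to a normal form on a ball exhibit
the data as gauge equivalent to it. -/
theorem gaugeEquiv_of_gauge_pull {D : ReducedData} {R ρ : ℝ} {h z : ℝ × ℂ → ℂ}
    (hh : ContDiff ℝ ∞ h) (hz : ContDiff ℝ ∞ z) {e : OpenPartialHomeomorph (ℝ × ℂ) (ℝ × ℂ)}
    (he : ContDiffOn ℝ ∞ e e.source) (he' : ContDiffOn ℝ ∞ e.symm e.target) {p : ℝ × ℂ}
    (hp : p ∈ e.source) (hpρ : e p ∈ Metric.ball (0 : ℝ × ℂ) ρ) {w X : ℂ → ℂ} {S : ℂ → ℝ}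
    (hw : ContDiffOn ℝ ∞ w (Metric.ball 0 ρ)) (hX : ContDiffOn ℝ ∞ X (Metric.ball 0 ρ))
    (hS : ContDiffOn ℝ ∞ S (Metric.ball 0 ρ))
    (hag : ∀ x ∈ Metric.ball (0 : ℝ × ℂ) ρ,
      ((D.gauge h z).pull e.symm).toFrameData.AgreeAt (normalForm R w X S) x) :
    GaugeEquivNormalFormNear D.toFrameData R p := by
  have hmem := mem_maximalAtlas_prod he he'
  have hs : ∀ x ∈ Metric.ball (0 : ℝ × ℂ) ρ, x.2 ∈ Metric.ball (0 : ℂ) ρ := fun x hx =>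
    mem_ball_zero_iff.2 (mem_ball_prod_iff.1 hx).2
  have ce : ContDiff ℝ ∞ (fun x => Real.exp (h x).re) :=
    Real.contDiff_exp.comp (Complex.reCLM.contDiff.comp hh)
  have ci : ContDiff ℝ ∞ (fun x => (h x).im) := Complex.imCLM.contDiff.comp hh
  set Φ := e.trans (OpenPartialHomeomorph.ofSet (Metric.ball (0 : ℝ × ℂ) ρ) Metric.isOpen_ball)
    with hΦ
  have hsrc : ∀ q ∈ Φ.source, q ∈ e.source ∧ e q ∈ Metric.ball (0 : ℝ × ℂ) ρ := fun q hq => hq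
  have htgt : ∀ x ∈ Φ.target, x ∈ Metric.ball (0 : ℝ × ℂ) ρ ∧ x ∈ e.target := fun x hx => hx
  refine ⟨Φ, ?_, ⟨hp, hpρ⟩, fun x => Real.exp (h x).re, fun x => (h x).im, z,
    ce.contMDiff.contMDiffOn, ci.contMDiff.contMDiffOn, hz.contMDiff.contMDiffOn,
    fun q _ => Real.exp_pos _, Metric.ball 0 ρ, w, X, S, Metric.isOpen_ball,
    fun x hx => hs x (htgt x hx).1, hw, hX, hS, ?_⟩
  · exact mem_maximalAtlas_prod (he.mono fun q hq => (hsrc q hq).1)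
      (he'.mono fun x hx => (htgt x hx).2)
  intro q hq
  obtain ⟨hq1, hq2⟩ := hsrc q hq
  obtain ⟨a1, a2, a3, a4, a5, a6, a7, a8, a9, a10⟩ := hag (e q) hq2
  obtain ⟨b1, b2, b3, b4, b5, b6, b7, b8, b9, b10⟩ := D.gauge_agreeAt h z q
  rw [ReducedData.toFrameData_pull] at a1 a2 a3 a4 a5 a6
  have hl : e.symm (e q) = q := e.left_inv hq1
  have key : ∀ {α : OneForm (ℝ × ℂ) (ℝ × ℂ)} {β : OneForm (ℝ × ℂ) (ℝ × ℂ)},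
      pullForm (E := ℝ × ℂ) e.symm α (e q) = β (e q) → α q = pullForm (E := ℝ × ℂ) Φ β q :=
    fun h => ContinuousLinearMap.ext fun u => eq_pullForm_of_pullForm_symm hmem hq1 h u
  have s9 : (D.gauge h z).Ψ2 (e.symm (e q)) = (normalForm R w X S).Ψ2 (e q) := a9
  have s10 : (D.gauge h z).Ψ3 (e.symm (e q)) = (normalForm R w X S).Ψ3 (e q) := a10
  rw [hl] at s9 s10
  exact ⟨b1.trans (key a1), b2.trans (key a2), b3.trans (key a3), b4.trans (key a4),
    b5.trans (key a5), b6.trans (key a6), b7.trans a7, b8.trans a8, b9.trans s9, b10.trans s10⟩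

/-- When `M` is a multiple of `dζ`, a gauge makes `Γ12 + Γ34` and `Γ23` multiples of `dζ`. With
`A e^{iφ} = e^h` this asks for `dh ≡ -(Γ12 + Γ34)` and `d(e^h z) ≡ e^h Γ23` modulo `dζ`; the
structure equations provide the compatibility conditions. -/
theorem exists_gauge {D : ReducedData} {R : ℝ} {U : Set (ℝ × ℂ)} (hU : IsOpen U)
    (h0 : (0 : ℝ × ℂ) ∈ U) (hD : D.IsSolutionOn R U)
    (hM : ∀ x ∈ U, ∀ u, D.M x u = D.M x (0, 1) * u.2) :
    ∃ h z : ℝ × ℂ → ℂ, ContDiff ℝ ∞ h ∧ ContDiff ℝ ∞ z ∧ ∀ᶠ x in nhds (0 : ℝ × ℂ),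
      (∀ u, (D.gauge h z).Γ12 x u + (D.gauge h z).Γ34 x u
        = ((D.gauge h z).Γ12 x (0, 1) + (D.gauge h z).Γ34 x (0, 1)) * u.2) ∧
      ∀ u, (D.gauge h z).Γ23 x u = (D.gauge h z).Γ23 x (0, 1) * u.2 := by
  have cs : ContDiffOn ℝ ∞ (fun x => -(D.Γ12 x + D.Γ34 x)) U :=
    (hD.contDiff_Γ12.add hD.contDiff_Γ34).neg
  have dd : ∀ {F : Type} [NormedAddCommGroup F] [NormedSpace ℝ F] {A : ℝ × ℂ → F},
      ContDiffOn ℝ ∞ A U → ∀ x ∈ U, DifferentiableAt ℝ A x :=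
    fun hA x hx => (hA.contDiffAt (hU.mem_nhds hx)).differentiableAt (by simp)
  have hcs : ∀ x ∈ U, ∀ u v, curl (fun x => -(D.Γ12 x + D.Γ34 x)) x u v
      = -(2 * (D.Ψ2 x - (R : ℂ) / 24) * (D.M x ⋏ conjCov (D.M x)) u v) := by
    intro x hx u v
    have e1 := curl_const_smul (A := fun x => D.Γ12 x + D.Γ34 x)
      (dd (hD.contDiff_Γ12.add hD.contDiff_Γ34) x hx) (-1) u v
    have e2 := curl_add (dd hD.contDiff_Γ12 x hx) (dd hD.contDiff_Γ34 x hx) u v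
    have e3 : (fun x => -(D.Γ12 x + D.Γ34 x)) = fun y => (-1 : ℂ) • (D.Γ12 y + D.Γ34 y) := by
      funext y
      refine ContinuousLinearMap.ext fun u => ?_
      simp
      ring
    rw [e3, e1, e2, hD.curl_Γs x hx]
    ring
  obtain ⟨h, hh, hh1⟩ := exists_potential_mod_dζ hU h0 cs (by
    intro x hx
    rw [hcs x hx, hcs x hx]
    simp [wedge_apply, hM x hx (1, 0)])
  -- the region on which `h` is a solution
  obtain ⟨U₁, hU₁, hU₁o, h0₁⟩ := mem_nhds_iff.1 (Filter.inter_mem (hU.mem_nhds h0) hh1)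
  have ceh : ContDiff ℝ ∞ (fun x => Complex.exp (h x)) := Complex.contDiff_exp.comp hh
  have dh : ∀ x, DifferentiableAt ℝ h x := fun x => hh.contDiffAt.differentiableAt (by simp)
  have cβ : ContDiffOn ℝ ∞ (fun x => Complex.exp (h x) • D.Γ23 x) U₁ :=
    ceh.contDiffOn.smul (hD.contDiff_Γ23.mono fun x hx => (hU₁ hx).1)
  have fexp : ∀ x u, fderiv ℝ (fun y => Complex.exp (h y)) x u
      = Complex.exp (h x) * fderiv ℝ h x u := by
    intro x u
    rw [((dh x).hasFDerivAt.cexp).fderiv]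
    simp
  have hsh : ∀ x ∈ U₁, ∃ s : ℂ, ∀ u, fderiv ℝ h x u + (D.Γ12 x u + D.Γ34 x u) = s * u.2 := by
    intro x hx
    refine ⟨fderiv ℝ h x (0, 1) - (-(D.Γ12 x + D.Γ34 x)) (0, 1), fun u => ?_⟩
    have e1 := (hU₁ hx).2 u
    simp only [_root_.neg_apply, _root_.add_apply] at e1 ⊢
    linear_combination e1
  -- `y` plays the role of `e^h z`
  obtain ⟨y, hy, hy1⟩ := exists_potential_mod_dζ hU₁o h0₁ cβ (by
    intro x hx
    have hxU := (hU₁ hx).1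
    obtain ⟨s, hs⟩ := hsh x hx
    have e := hD.curl_Γ23 x hxU
    rw [curl_smul (ceh.contDiffAt.differentiableAt (by simp)) (dd hD.contDiff_Γ23 x hxU),
      curl_smul (ceh.contDiffAt.differentiableAt (by simp)) (dd hD.contDiff_Γ23 x hxU), e, e]
    have s0 := hs (1, 0)
    have s1 := hs (0, 1)
    have s2 := hs (0, Complex.I)
    simp only [mul_zero, mul_one] at s0 s1 s2
    simp only [fexp, wedge_apply, conjCov_apply, _root_.add_apply, hM x hxU (1, 0),
      hM x hxU (0, Complex.I), mul_zero, map_zero]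
    linear_combination (Complex.exp (h x) * (D.Γ23 x (0, 1) + Complex.I * D.Γ23 x (0, Complex.I))) * s0
      - Complex.exp (h x) * D.Γ23 x (1, 0) * (s1 + Complex.I * s2)
      + (Complex.exp (h x) * ((D.Ψ2 x + (R : ℂ) / 12) * D.K x (1, 0) * D.M x (0, 1)
        - s * D.Γ23 x (1, 0))) * Complex.I_sq)
  refine ⟨h, fun x => Complex.exp (-h x) * y x, hh,
    (Complex.contDiff_exp.comp hh.neg).mul hy, ?_⟩
  filter_upwards [hU₁o.mem_nhds h0₁, hy1] with x hx hyx
  obtain ⟨s, hs⟩ := hsh x hx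
  have dy : DifferentiableAt ℝ y x := hy.contDiffAt.differentiableAt (by simp)
  have g1 : ∀ u, (D.gauge h fun x => Complex.exp (-h x) * y x).Γ12 x u
      + (D.gauge h fun x => Complex.exp (-h x) * y x).Γ34 x u = s * u.2 := by
    intro u
    have cre := (Complex.ofRealCLM.comp Complex.reCLM).hasFDerivAt.comp x (dh x).hasFDerivAt
    have cim := (Complex.ofRealCLM.comp Complex.imCLM).hasFDerivAt.comp x (dh x).hasFDerivAt
    change D.Γ12 x u + Complex.I * fderiv ℝ ((Complex.ofRealCLM.comp Complex.imCLM) ∘ h) x u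
      + (D.Γ34 x u + fderiv ℝ ((Complex.ofRealCLM.comp Complex.reCLM) ∘ h) x u) = _
    rw [cre.fderiv, cim.fderiv]
    have e1 : fderiv ℝ h x u = (fderiv ℝ h x u).re + (fderiv ℝ h x u).im * Complex.I :=
      (Complex.re_add_im _).symm
    rw [← hs u]
    change D.Γ12 x u + Complex.I * ((fderiv ℝ h x u).im : ℂ) + (D.Γ34 x u + ((fderiv ℝ h x u).re : ℂ)) = _
    linear_combination (-1) * e1
  have hz : ∀ u, fderiv ℝ (fun x => Complex.exp (-h x) * y x) x u
      = Complex.exp (-h x) * (fderiv ℝ y x u - y x * fderiv ℝ h x u) := by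
    intro u
    have k := ((dh x).hasFDerivAt.neg.cexp.mul dy.hasFDerivAt).fderiv
    have k2 := congrArg (fun T : ℝ × ℂ →L[ℝ] ℂ => T u) k
    refine Eq.trans k2 ?_
    simp
    ring
  have he : Complex.exp (h x) * Complex.exp (-h x) = 1 := by rw [← Complex.exp_add]; simp
  have g2 : ∃ t : ℂ, ∀ u, (D.gauge h fun x => Complex.exp (-h x) * y x).Γ23 x u = t * u.2 := by
    refine ⟨y x * s - (fderiv ℝ y x (0, 1) - Complex.exp (h x) * D.Γ23 x (0, 1)), fun u => ?_⟩
    change Complex.exp (h x) * (D.Γ23 x u + Complex.exp (-h x) * y x * (D.Γ12 x u + D.Γ34 x u)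
      - fderiv ℝ (fun x => Complex.exp (-h x) * y x) x u) = _
    have e1 : fderiv ℝ y x u - Complex.exp (h x) * D.Γ23 x u
      = (fderiv ℝ y x (0, 1) - Complex.exp (h x) * D.Γ23 x (0, 1)) * u.2 := hyx u
    rw [hz]
    linear_combination y x * hs u - e1
      + (y x * (D.Γ12 x u + D.Γ34 x u) - fderiv ℝ y x u + y x * fderiv ℝ h x u) * he
  obtain ⟨t, ht⟩ := g2
  refine ⟨fun u => ?_, fun u => ?_⟩
  · rw [g1, g1]; simp
  · rw [ht, ht]; simp

end Gauge

/-! ### From isothermal coordinates to the normal form -/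

section LocalCoordinates

/-- A smooth map with injective differential at a point is a coordinate system near it. -/
theorem exists_coordinates {f : ℝ × ℂ → ℝ × ℂ} {U : Set (ℝ × ℂ)} (hU : IsOpen U)
    (hf : ContDiffOn ℝ ∞ f U) {a : ℝ × ℂ} (ha : a ∈ U) (hinj : ∀ u, fderiv ℝ f a u = 0 → u = 0) :
    ∃ e : OpenPartialHomeomorph (ℝ × ℂ) (ℝ × ℂ), a ∈ e.source ∧ e.source ⊆ U ∧ ⇑e = f ∧
      ContDiffOn ℝ ∞ e e.source ∧ ContDiffOn ℝ ∞ e.symm e.target := by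
  obtain ⟨T, hT⟩ := exists_equiv_of_injective hinj
  have hd := ((hf.contDiffAt (hU.mem_nhds ha)).differentiableAt (by simp)).hasFDerivAt
  rw [← hT] at hd
  obtain ⟨e, h1, h2, h3, h4⟩ := exists_smooth_local_inverse hU hf ha T hd
  exact ⟨e, h1, h2, h3, by rw [h3]; exact hf.mono h2, h4⟩

theorem ReducedData.IsSolutionOn.pull_symm {D : ReducedData} {R : ℝ} {U : Set (ℝ × ℂ)}
    (h : D.IsSolutionOn R U) (hU : IsOpen U) {e : OpenPartialHomeomorph (ℝ × ℂ) (ℝ × ℂ)}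
    (he : ContDiffOn ℝ ∞ e e.source) (he' : ContDiffOn ℝ ∞ e.symm e.target) (heU : e.source ⊆ U) :
    (D.pull e.symm).IsSolutionOn R e.target := by
  refine h.pull hU e.open_target he' (fun x hx => heU (e.map_target hx)) fun x hx => ?_
  intro u v huv
  rw [← fderiv_symm_apply he he' hx u, huv, fderiv_symm_apply he he' hx]

/-- Gauge equivalence to a normal form is invariant under coordinate changes. -/
theorem gaugeEquiv_of_pull_symm {D : ReducedData} {R : ℝ}
    {e : OpenPartialHomeomorph (ℝ × ℂ) (ℝ × ℂ)} (he : ContDiffOn ℝ ∞ e e.source)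
    (he' : ContDiffOn ℝ ∞ e.symm e.target) {p : ℝ × ℂ} (hp : p ∈ e.source)
    (h : GaugeEquivNormalFormNear (D.pull e.symm).toFrameData R (e p)) :
    GaugeEquivNormalFormNear D.toFrameData R p := by
  refine GaugeEquivNormalFormNear.of_chart (mem_maximalAtlas_prod he he') hp (fun x _ => ?_) h
  rw [ReducedData.toFrameData_pull]
  exact ⟨rfl, rfl, rfl, rfl, rfl, rfl, rfl, rfl, rfl, rfl⟩

/-- Data with `M = m dζ` are gauge equivalent to a normal form: after the choice of gauge, the new
coordinate `r` is a primitive of `K(∂/∂r)` along the lines of constant `ζ`. -/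
theorem gaugeEquiv_of_isothermal {D : ReducedData} {R : ℝ} {U : Set (ℝ × ℂ)} (hU : IsOpen U)
    (h0 : (0 : ℝ × ℂ) ∈ U) (hD : D.IsSolutionOn R U)
    (hM : ∀ x ∈ U, ∀ u, D.M x u = D.M x (0, 1) * u.2) :
    GaugeEquivNormalFormNear D.toFrameData R 0 := by
  obtain ⟨h, z, hh, hz, hg⟩ := exists_gauge hU h0 hD hM
  obtain ⟨U₁, hU₁, hU₁o, h0₁⟩ := mem_nhds_iff.1 (Filter.inter_mem (hU.mem_nhds h0) hg)
  have hD' := (hD.gauge hU hh hz).mono fun x hx => (hU₁ hx).1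
  set D' := D.gauge h z with hDdef
  have hM' : ∀ x ∈ U₁, ∀ u, D'.M x u = D'.M x (0, 1) * u.2 := by
    intro x hx u
    change Complex.exp _ * D.M x u = Complex.exp _ * D.M x (0, 1) * u.2
    rw [hM x (hU₁ hx).1 u, mul_assoc]
  have hm0 : ∀ x ∈ U₁, D'.M x (0, 1) ≠ 0 := by
    intro x hx hm
    obtain ⟨u, hu, -⟩ := exists_frame_values (hD'.real_K x hx) (hD'.nondegenerate x hx) 1 0
    rw [hM' x hx, hm, zero_mul] at hu
    exact zero_ne_one hu
  have hk : ∀ x ∈ U₁, ((D'.K x (1, 0)).re : ℂ) = D'.K x (1, 0) := fun x hx =>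
    Complex.conj_eq_iff_re.1 (hD'.real_K x hx _)
  have hk0 : ∀ x ∈ U₁, (D'.K x (1, 0)).re ≠ 0 := by
    intro x hx hk'
    have h1 : D'.K x (1, 0) = 0 := by rw [← hk x hx, hk', Complex.ofReal_zero]
    have h2 : D'.M x (1, 0) = 0 := by rw [hM' x hx]; simp
    have := hD'.nondegenerate x hx _ h2 h1
    simp at this
  have ck : ContDiffOn ℝ ∞ (fun x => (D'.K x (1, 0)).re) U₁ :=
    Complex.reCLM.contDiff.comp_contDiffOn (hD'.contDiff_K.clm_apply contDiffOn_const)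
  obtain ⟨k, hkc, hke⟩ := exists_contDiff_eventuallyEq hU₁o ck h0₁
  obtain ⟨H, hH, hHk⟩ := exists_smooth_primitive hkc
  have dH : ∀ x, DifferentiableAt ℝ H x := fun x => hH.contDiffAt.differentiableAt (by simp)
  have hH0 : ∀ x, fderiv ℝ H x (1, 0) = k x := by
    intro x
    have h1 : HasDerivAt (fun t : ℝ => ((t, x.2) : ℝ × ℂ)) (1, 0) x.1 :=
      (hasDerivAt_id x.1).prodMk (hasDerivAt_const x.1 x.2)
    exact (HasFDerivAt.comp_hasDerivAt (l := H) x.1 (dH x).hasFDerivAt h1).unique (hHk x)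
  obtain ⟨U₂, hU₂, hU₂o, h0₂⟩ := mem_nhds_iff.1 (Filter.inter_mem (hU₁o.mem_nhds h0₁) hke)
  -- the coordinates `(r, ζ)`
  set f : ℝ × ℂ → ℝ × ℂ := fun x => (H x - H 0, x.2) with hf
  have cf : ContDiff ℝ ∞ f := (hH.sub contDiff_const).prodMk contDiff_snd
  have ff : ∀ x u, fderiv ℝ f x u = (fderiv ℝ H x u, u.2) := by
    intro x u
    have h1 : HasFDerivAt f ((fderiv ℝ H x).prod (ContinuousLinearMap.snd ℝ ℝ ℂ)) x :=
      ((dH x).hasFDerivAt.sub_const _).prodMk hasFDerivAt_snd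
    rw [h1.fderiv]
    rfl
  have eu : ∀ u : ℝ × ℂ, u.2 = 0 → u = u.1 • ((1, 0) : ℝ × ℂ) := fun u hu =>
    Prod.ext (by simp) (by simp [hu])
  obtain ⟨e, he0, heU, hef, he, he'⟩ := exists_coordinates hU₂o cf.contDiffOn h0₂ (by
    intro u hu
    rw [ff, Prod.mk_eq_zero] at hu
    have h1 := hu.1
    rw [eu u hu.2, map_smul, hH0, (hU₂ h0₂).2, smul_eq_mul] at h1
    have h2 := (mul_eq_zero.1 h1).resolve_right (hk0 0 h0₁)
    exact Prod.ext h2 hu.2)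
  have hfe0 : e 0 = 0 := by rw [hef]; simp [hf]
  have heU' : e.source ⊆ U₁ := fun x hx => (hU₂ (heU hx)).1
  have h0t : (0 : ℝ × ℂ) ∈ e.target := by
    have := e.map_source he0
    rwa [hfe0] at this
  have hes0 : e.symm 0 = 0 := by
    have := e.left_inv he0
    rwa [hfe0] at this
  have hsnd : ∀ x ∈ e.target, ∀ u, (fderiv ℝ e.symm x u).2 = u.2 := by
    intro x hx u
    have h1 := fderiv_symm_apply he he' hx u
    rw [hef, ff] at h1
    have h2 := congrArg Prod.snd h1
    exact h2
  have hD'' := hD'.pull_symm hU₁o he he' heU'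
  have hmem : ∀ x ∈ e.target, e.symm x ∈ U₁ := fun x hx => heU' (e.map_target hx)
  -- the logarithm of the coefficient of `dζ` in `M`
  set m : ℝ × ℂ → ℂ := fun x => D'.M (e.symm x) (0, 1) with hm
  have cm : ContDiffOn ℝ ∞ m e.target :=
    (hD'.contDiff_M.clm_apply contDiffOn_const).comp he' hmem
  have hq : ContinuousAt (fun x => m x / m 0) 0 :=
    ((cm.contDiffAt (e.open_target.mem_nhds h0t)).continuousAt).div_const _
  have hm00 : m 0 ≠ 0 := hm0 _ (hmem 0 h0t)
  have hsl : ∀ᶠ x in nhds (0 : ℝ × ℂ), m x / m 0 ∈ Complex.slitPlane := by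
    refine hq.eventually (Complex.isOpen_slitPlane.mem_nhds ?_)
    simp [div_self hm00]
  obtain ⟨ρ, hρ, hball⟩ := Metric.mem_nhds_iff.1 (Filter.inter_mem (e.open_target.mem_nhds h0t) hsl)
  have hbt : Metric.ball (0 : ℝ × ℂ) ρ ⊆ e.target := fun x hx => (hball hx).1
  have cW : ContDiffOn ℝ ∞ (fun x => Complex.log (m x / m 0) + Complex.log (m 0))
      (Metric.ball 0 ρ) := by
    refine ContDiffOn.add ?_ contDiffOn_const
    intro x hx
    have h1 : ContDiffAt ℝ ∞ Complex.log (m x / m 0) :=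
      (Complex.contDiffAt_log (hball hx).2).restrict_scalars ℝ
    have h2 : ContDiffAt ℝ ∞ (fun x => m x / m 0) x :=
      (cm.contDiffAt (e.open_target.mem_nhds (hbt hx))).div_const _
    exact (ContDiffAt.comp x h1 h2).contDiffWithinAt
  obtain ⟨w, X, S, hw, hX, hS, hag⟩ := agreeAt_reducedNormalForm (hD''.mono hbt) cW
    (by
      intro x hx u
      have h1 : (D'.pull e.symm).M x u = D'.M (e.symm x) (fderiv ℝ e.symm x u) := rfl
      rw [h1, hM' _ (hmem x (hbt hx)), hsnd x (hbt hx), Complex.exp_add, Complex.exp_log,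
        Complex.exp_log hm00, div_mul_cancel₀ _ hm00]
      exact div_ne_zero (hm0 _ (hmem x (hbt hx))) hm00)
    (by
      intro x hx u
      have h1 := (hU₁ (hmem x (hbt hx))).2.1
      change D'.Γ12 (e.symm x) (fderiv ℝ e.symm x u) + D'.Γ34 (e.symm x) (fderiv ℝ e.symm x u)
        = (D'.Γ12 (e.symm x) (fderiv ℝ e.symm x (0, 1))
          + D'.Γ34 (e.symm x) (fderiv ℝ e.symm x (0, 1))) * u.2
      rw [h1, h1 (fderiv ℝ e.symm x (0, 1)), hsnd x (hbt hx), hsnd x (hbt hx), mul_one])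
    (by
      intro x hx u
      have h1 := (hU₁ (hmem x (hbt hx))).2.2
      change D'.Γ23 (e.symm x) (fderiv ℝ e.symm x u)
        = D'.Γ23 (e.symm x) (fderiv ℝ e.symm x (0, 1)) * u.2
      rw [h1, h1 (fderiv ℝ e.symm x (0, 1)), hsnd x (hbt hx), hsnd x (hbt hx), mul_one])
    (by
      intro x hx
      have hxU := e.map_target (hbt hx)
      have h1 := fderiv_symm_apply he he' (hbt hx) (1, 0)
      have h2 := eu _ (hsnd x (hbt hx) (1, 0))
      rw [hef, ff, h2, map_smul, hH0, (hU₂ (heU hxU)).2] at h1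
      have h3 := congrArg Prod.fst h1
      change D'.K (e.symm x) (fderiv ℝ e.symm x (1, 0)) = 1
      rw [h2, map_smul, ← hk _ (hmem x (hbt hx)), Complex.real_smul, ← Complex.ofReal_mul]
      exact (congrArg Complex.ofReal h3).trans Complex.ofReal_one)
  exact gaugeEquiv_of_gauge_pull hh hz he he' he0
    (by rw [hfe0]; exact Metric.mem_ball_self hρ) hw hX hS hag

end LocalCoordinates

/-! ### Straightening the kernel of `M` -/

section FlowBox

/-- The coframe `(K, M)` at a point as an endomorphism of `ℝ × ℂ`. -/
def ReducedData.coframe (D : ReducedData) (x : ℝ × ℂ) : ℝ × ℂ →L[ℝ] ℝ × ℂ :=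
  (Complex.reCLM.comp (D.K x)).prod (D.M x)

/-- Coordinates in which the kernel of `M` is spanned by `∂/∂r`, and in which `M = dζ` at the
origin. They are flow coordinates for the vector field `v` dual to `K` in the coframe. -/
theorem exists_flow_box {D : ReducedData} {R : ℝ} {U : Set (ℝ × ℂ)} (hU : IsOpen U)
    {x₀ : ℝ × ℂ} (h0 : x₀ ∈ U) (hD : D.IsSolutionOn R U) :
    ∃ e : OpenPartialHomeomorph (ℝ × ℂ) (ℝ × ℂ), x₀ ∈ e.source ∧ e.source ⊆ U ∧
      ContDiffOn ℝ ∞ e e.source ∧ ContDiffOn ℝ ∞ e.symm e.target ∧ e x₀ = 0 ∧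
      (∀ x ∈ e.target, (D.pull e.symm).M x (1, 0) = 0) ∧
      ∀ c : ℂ, (D.pull e.symm).M 0 (0, c) = c := by
  have hinj : ∀ x ∈ U, ∀ u, D.coframe x u = 0 → u = 0 := by
    intro x hx u hu
    have h1 : (D.K x u).re = 0 := congrArg Prod.fst hu
    have h2 : D.M x u = 0 := congrArg Prod.snd hu
    refine hD.nondegenerate x hx u h2 ?_
    rw [← Complex.conj_eq_iff_re.1 (hD.real_K x hx u), h1, Complex.ofReal_zero]
  have hinv : ∀ x ∈ U, ContDiffAt ℝ ∞ (fun x => ContinuousLinearMap.inverse (D.coframe x)) x ∧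
      ∀ u, D.coframe x (ContinuousLinearMap.inverse (D.coframe x) u) = u := by
    intro x hx
    obtain ⟨T, hT⟩ := exists_equiv_of_injective (hinj x hx)
    have h1 : ContDiffAt ℝ ∞ D.coframe x := by
      have h2 : ContDiffAt ℝ ∞ (fun x => Complex.reCLM.comp (D.K x)) x :=
        contDiffAt_const.clm_comp (hD.contDiff_K.contDiffAt (hU.mem_nhds hx))
      have h3 := hD.contDiff_M.contDiffAt (hU.mem_nhds hx)
      exact
        ((ContinuousLinearMap.prodₗᵢ (E := ℝ × ℂ) (F := ℝ) (G := ℂ) (𝕜 := ℝ) ℝ).contDiff.contDiffAt.comp x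
          (h2.prodMk h3))
    constructor
    · have h4 := contDiffAt_map_inverse (𝕜 := ℝ) (n := ∞) T
      rw [hT] at h4
      exact h4.comp x h1
    · intro u
      rw [← hT, ContinuousLinearMap.inverse_equiv]
      exact T.apply_symm_apply u
  have hn : ContDiffOn ℝ ∞ (fun x => ContinuousLinearMap.inverse (D.coframe x) (1, 0)) U :=
    fun x hx => ((hinv x hx).1.clm_apply contDiffAt_const).contDiffWithinAt
  obtain ⟨v, hv, hvn⟩ := exists_contDiff_eventuallyEq hU hn h0
  obtain ⟨U₁, hU₁, hU₁o, h0₁⟩ := mem_nhds_iff.1 (Filter.inter_mem (hU.mem_nhds h0) hvn)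
  -- flow along `v`, starting from an affine slice `ξ` on which `M = dζ` and `K = 0` at `x₀`
  obtain ⟨Fl, UF, hUF, h0F, cF, hF0, hFd⟩ := exists_smooth_flow hv x₀
  set ξ : ℂ →L[ℝ] ℝ × ℂ :=
    (ContinuousLinearMap.inverse (D.coframe x₀)).comp (ContinuousLinearMap.inr ℝ ℝ ℂ) with hξ
  set ι : ℝ × ℂ → ℝ × (ℝ × ℂ) := fun p => (p.1, x₀ + ξ p.2) with hι
  have cι : ContDiff ℝ ∞ ι := contDiff_fst.prodMk (contDiff_const.add (ξ.contDiff.comp contDiff_snd))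
  have hι0 : ι 0 = (0, x₀) := by simp [hι]
  set G : ℝ × ℂ → ℝ × ℂ := fun p => Fl (ι p) with hG
  have hG0 : G 0 = x₀ := by rw [hG]; simp only [hι0]; exact hF0 x₀ h0F
  have hUι : IsOpen (ι ⁻¹' UF) := hUF.preimage cι.continuous
  have cG0 : ContDiffOn ℝ ∞ G (ι ⁻¹' UF) := cF.comp cι.contDiffOn fun p hp => hp
  set UG := (ι ⁻¹' UF) ∩ G ⁻¹' U₁ with hUG
  have hUGo : IsOpen UG := cG0.continuousOn.isOpen_inter_preimage hUι hU₁o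
  have h0G : (0 : ℝ × ℂ) ∈ UG := ⟨by change ι 0 ∈ UF; rw [hι0]; exact h0F, by
    change G 0 ∈ U₁; rw [hG0]; exact h0₁⟩
  have cG : ContDiffOn ℝ ∞ G UG := cG0.mono Set.inter_subset_left
  have dG : ∀ p ∈ UG, DifferentiableAt ℝ G p := fun p hp =>
    (cG.contDiffAt (hUGo.mem_nhds hp)).differentiableAt (by simp)
  have hGr : ∀ p ∈ UG, fderiv ℝ G p (1, 0) = v (G p) := by
    intro p hp
    have h1 : HasDerivAt (fun t : ℝ => ((t, p.2) : ℝ × ℂ)) (1, 0) p.1 :=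
      (hasDerivAt_id p.1).prodMk (hasDerivAt_const p.1 p.2)
    exact (HasFDerivAt.comp_hasDerivAt (l := G) p.1 (dG p hp).hasFDerivAt h1).unique
      (hFd (ι p) hp.1)
  have hGs : ∀ c : ℂ, fderiv ℝ G 0 (0, c) = ξ c := by
    intro c
    have h1 : HasFDerivAt (fun c : ℂ => ((0, c) : ℝ × ℂ)) (ContinuousLinearMap.inr ℝ ℝ ℂ) 0 :=
      (ContinuousLinearMap.inr ℝ ℝ ℂ).hasFDerivAt
    have h2 := HasFDerivAt.comp (g := G) (0 : ℂ) (dG _ h0G).hasFDerivAt h1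
    have h3 : HasFDerivAt (fun c : ℂ => x₀ + ξ c) ξ 0 := ξ.hasFDerivAt.const_add x₀
    have h4 : (G ∘ fun c : ℂ => ((0, c) : ℝ × ℂ)) =ᶠ[nhds 0] fun c : ℂ => x₀ + ξ c := by
      have h5 : ∀ᶠ c : ℂ in nhds 0, ((0, c) : ℝ × ℂ) ∈ ι ⁻¹' UF :=
        (Continuous.prodMk_right (0 : ℝ)).continuousAt.eventually (hUι.mem_nhds h0G.1)
      filter_upwards [h5] with c hc using hF0 _ hc
    exact congrArg (fun T : ℂ →L[ℝ] ℝ × ℂ => T c) (h2.unique (h3.congr_of_eventuallyEq h4))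
  have hn0 : v x₀ = ContinuousLinearMap.inverse (D.coframe x₀) (1, 0) := (hU₁ h0₁).2
  have hG0' : ∀ u, fderiv ℝ G 0 u = ContinuousLinearMap.inverse (D.coframe x₀) u := by
    intro u
    have e1 : u = u.1 • ((1, 0) : ℝ × ℂ) + (0, u.2) := Prod.ext (by simp) (by simp)
    conv_lhs => rw [e1, map_add, map_smul, hGr 0 h0G, hG0, hn0, hGs]
    conv_rhs => rw [e1, map_add, map_smul]
    rfl
  -- `G` goes from the new coordinates to the old ones, so the chart wanted is its inverse
  obtain ⟨e, he0, heU, heG, he, he'⟩ := exists_coordinates hUGo cG h0G (by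
    intro u hu
    rw [hG0'] at hu
    rw [← (hinv x₀ h0).2 u, hu, map_zero])
  have hes : ∀ p ∈ e.source, (D.pull e.symm.symm).M p = (D.M (G p)).comp (fderiv ℝ G p) := by
    intro p _
    rw [OpenPartialHomeomorph.symm_symm, ← heG]
    rfl
  refine ⟨e.symm, ?_, ?_, he', ?_, ?_, ?_, ?_⟩
  · have := e.map_source he0
    rwa [heG, hG0] at this
  · intro x hx
    have h1 := heU (e.map_target hx)
    have h2 : G (e.symm x) = x := by rw [← heG]; exact e.right_inv hx
    have h3 := (hU₁ h1.2).1
    rwa [h2] at h3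
  · rw [OpenPartialHomeomorph.symm_symm]; exact he
  · have := e.left_inv he0
    rwa [heG, hG0] at this
  · intro p hp
    have hpG := heU hp
    rw [hes p hp]
    change D.M (G p) (fderiv ℝ G p (1, 0)) = 0
    rw [hGr p hpG, (hU₁ hpG.2).2]
    exact congrArg Prod.snd ((hinv (G p) (hU₁ hpG.2).1).2 (1, 0))
  · intro c
    rw [hes 0 he0]
    change D.M (G 0) (fderiv ℝ G 0 (0, c)) = c
    rw [hG0', hG0]
    exact congrArg Prod.snd ((hinv x₀ h0).2 (0, c))

end FlowBox

/-! ### Isothermal coordinates -/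

section Isothermal

/-- Coordinates in which `M` is a multiple of `dζ`. The form `M` is `a (dζ + q dζbar)`, and a
solution of the Beltrami equation with coefficient `q` is the new coordinate `ζ`. -/
theorem exists_isothermal_coordinates {D : ReducedData} {R : ℝ} {U : Set (ℝ × ℂ)} (hU : IsOpen U)
    (h0 : (0 : ℝ × ℂ) ∈ U) (hD : D.IsSolutionOn R U) (hMr : ∀ x ∈ U, D.M x (1, 0) = 0)
    (hM0 : ∀ c : ℂ, D.M 0 (0, c) = c) :
    ∃ e : OpenPartialHomeomorph (ℝ × ℂ) (ℝ × ℂ), (0 : ℝ × ℂ) ∈ e.source ∧ e.source ⊆ U ∧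
      ContDiffOn ℝ ∞ e e.source ∧ ContDiffOn ℝ ∞ e.symm e.target ∧ e 0 = 0 ∧
      ∀ x ∈ e.target, ∀ u, (D.pull e.symm).M x u = (D.pull e.symm).M x (0, 1) * u.2 := by
  have cM : ∀ c : ℂ, ContDiffOn ℝ ∞ (fun x => D.M x (0, c)) U := fun c =>
    hD.contDiff_M.clm_apply contDiffOn_const
  have dM : ∀ x ∈ U, DifferentiableAt ℝ D.M x := fun x hx =>
    (hD.contDiff_M.contDiffAt (hU.mem_nhds hx)).differentiableAt (by simp)
  set a : ℝ × ℂ → ℂ := fun x => (D.M x (0, 1) - Complex.I * D.M x (0, Complex.I)) / 2 with ha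
  set b : ℝ × ℂ → ℂ := fun x => (D.M x (0, 1) + Complex.I * D.M x (0, Complex.I)) / 2 with hb
  have ca : ContDiffOn ℝ ∞ a U := ((cM 1).sub (contDiffOn_const.mul (cM Complex.I))).div_const 2
  have cb : ContDiffOn ℝ ∞ b U := ((cM 1).add (contDiffOn_const.mul (cM Complex.I))).div_const 2
  have ha0 : a 0 = 1 := by
    simp only [ha, hM0]
    linear_combination (-1 / 2 : ℂ) * Complex.I_sq
  have hb0 : b 0 = 0 := by
    simp only [hb, hM0]
    linear_combination (1 / 2 : ℂ) * Complex.I_sq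
  have hMab : ∀ x ∈ U, ∀ u, D.M x u = a x * u.2 + b x * starRingEnd ℂ u.2 := by
    intro x hx u
    have e1 : D.M x u = u.2.re * D.M x (0, 1) + u.2.im * D.M x (0, Complex.I) := by
      conv_lhs => rw [pair_decomposition u]
      rw [map_add, map_add, map_smul, map_smul, map_smul, hMr x hx]
      simp
    have h2 : u.2 = u.2.re + u.2.im * Complex.I := (Complex.re_add_im _).symm
    have h3 : starRingEnd ℂ u.2 = u.2.re - u.2.im * Complex.I := by
      apply Complex.ext <;> simp
    rw [e1, h3]
    simp only [ha, hb]
    linear_combination (-(D.M x (0, 1) - Complex.I * D.M x (0, Complex.I)) / 2) * h2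
      + (u.2.im * D.M x (0, Complex.I)) * Complex.I_sq
  -- the Lie derivative of `M` along `∂/∂r` is a multiple of `M`
  have hLie : ∀ x ∈ U, ∀ c : ℂ,
      fderiv ℝ (fun y => D.M y (0, c)) x (1, 0) = D.Γ12 x (1, 0) * D.M x (0, c) := by
    intro x hx c
    have e1 := hD.curl_M x hx (1, 0) (0, c)
    have e2 : fderiv ℝ (fun y => D.M y (1, 0)) x = 0 := by
      have h1 : (fun y => D.M y (1, 0)) =ᶠ[nhds x] fun _ => (0 : ℂ) := by
        filter_upwards [hU.mem_nhds hx] with y hy using hMr y hy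
      rw [h1.fderiv_eq, fderiv_fun_const]
      rfl
    rw [curl, fderiv_clm_apply_const (dM x hx), fderiv_clm_apply_const (dM x hx), e2,
      wedge_apply, hMr x hx] at e1
    simpa using e1
  have dMc : ∀ x ∈ U, ∀ c : ℂ, DifferentiableAt ℝ (fun x => D.M x (0, c)) x := fun x hx c =>
    ((cM c).contDiffAt (hU.mem_nhds hx)).differentiableAt (by simp)
  have har : ∀ x ∈ U, fderiv ℝ a x (1, 0) = D.Γ12 x (1, 0) * a x := by
    intro x hx
    have h1 := (((dMc x hx 1).hasFDerivAt.sub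
      ((dMc x hx Complex.I).hasFDerivAt.const_mul Complex.I)).mul_const (2⁻¹ : ℂ)).fderiv
    have h2 := congrArg (fun T : ℝ × ℂ →L[ℝ] ℂ => T (1, 0)) h1
    refine Eq.trans h2 ?_
    simp [hLie x hx, ha]
    ring
  have hbr : ∀ x ∈ U, fderiv ℝ b x (1, 0) = D.Γ12 x (1, 0) * b x := by
    intro x hx
    have h1 := (((dMc x hx 1).hasFDerivAt.add
      ((dMc x hx Complex.I).hasFDerivAt.const_mul Complex.I)).mul_const (2⁻¹ : ℂ)).fderiv
    have h2 := congrArg (fun T : ℝ × ℂ →L[ℝ] ℂ => T (1, 0)) h1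
    refine Eq.trans h2 ?_
    simp [hLie x hx, hb]
    ring
  have han : ∀ᶠ x in nhds (0 : ℝ × ℂ), a x ≠ 0 :=
    (ca.contDiffAt (hU.mem_nhds h0)).continuousAt.eventually_ne (by rw [ha0]; exact one_ne_zero)
  obtain ⟨ρ, hρ, hball⟩ := Metric.mem_nhds_iff.1 (Filter.inter_mem (hU.mem_nhds h0) han)
  -- hence the Beltrami coefficient does not depend on `r`
  have cq : ContDiffOn ℝ ∞ (fun x => b x / a x) (Metric.ball 0 ρ) := by
    simp only [div_eq_mul_inv]
    exact (cb.mono fun x hx => (hball hx).1).mul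
      ((ca.mono fun x hx => (hball hx).1).inv fun x hx => (hball hx).2)
  have hq : ∀ x ∈ Metric.ball (0 : ℝ × ℂ) ρ, b x / a x = b (0, x.2) / a (0, x.2) := by
    have dq : ∀ x ∈ Metric.ball (0 : ℝ × ℂ) ρ, DifferentiableAt ℝ (fun x => b x / a x) x :=
      fun x hx => (cq.contDiffAt (Metric.isOpen_ball.mem_nhds hx)).differentiableAt (by simp)
    intro x hx
    have h1 := eq_affine_of_fderiv_fst (f := fun x => b x / a x) (c := fun _ => 0) dq (by
      intro x hx
      obtain ⟨hxU, hxa⟩ := hball hx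
      have da := (ca.contDiffAt (hU.mem_nhds hxU)).differentiableAt (by simp)
      have e1 : (fun x => b x / a x * a x) =ᶠ[nhds x] b := by
        filter_upwards [Metric.isOpen_ball.mem_nhds hx] with y hy
        exact div_mul_cancel₀ _ (hball hy).2
      have e2 := ((dq x hx).hasFDerivAt.mul da.hasFDerivAt).fderiv
      have e3 := congrArg (fun T : ℝ × ℂ →L[ℝ] ℂ => T (1, 0)) (e1.fderiv_eq.symm.trans e2)
      have e4 : fderiv ℝ b x (1, 0) = b x / a x * fderiv ℝ a x (1, 0)
          + a x * fderiv ℝ (fun x => b x / a x) x (1, 0) := e3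
      rw [har x hxU, hbr x hxU] at e4
      have e5 : b x / a x * a x = b x := div_mul_cancel₀ _ hxa
      exact (mul_eq_zero.1 (by linear_combination (-1) * e4 - D.Γ12 x (1, 0) * e5 :
        a x * fderiv ℝ (fun x => b x / a x) x (1, 0) = 0)).resolve_left hxa) x hx
    simpa using h1
  have cμ : ContDiffOn ℝ ∞ (fun ζ : ℂ => b (0, ζ) / a (0, ζ)) (Metric.ball 0 ρ) := by
    have h1 : ContDiff ℝ ∞ fun ζ : ℂ => ((0, ζ) : ℝ × ℂ) := contDiff_prodMk_right 0
    have h2 : Set.MapsTo (fun ζ : ℂ => ((0, ζ) : ℝ × ℂ)) (Metric.ball 0 ρ) (Metric.ball 0 ρ) :=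
      fun ζ hζ => mem_ball_prod_iff.2 ⟨by simpa using hρ, mem_ball_zero_iff.1 hζ⟩
    exact cq.comp h1.contDiffOn h2
  obtain ⟨μ, hμ, hμe⟩ := exists_contDiff_eventuallyEq Metric.isOpen_ball cμ
    (Metric.mem_ball_self hρ)
  have hμ0 : μ 0 = 0 := by
    rw [hμe.self_of_nhds]
    change b 0 / a 0 = 0
    rw [hb0, zero_div]
  -- `ζ + s` solves the Beltrami equation with coefficient `μ` when `s` solves it with source `μ`
  obtain ⟨s, hs, hse, hs1⟩ := exists_beltrami_solution hμ hμ hμ0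
  have hs0 : 1 + dz s 0 ≠ 0 := by
    intro h
    have h1 : dz s 0 = -1 := by linear_combination h
    have h2 := hs1 rfl
    rw [h1] at h2
    simp at h2
  have cdz : Continuous fun ζ => 1 + dz s ζ :=
    continuous_const.add ((contDiffOn_univ.1 (contDiffOn_dz isOpen_univ hs.contDiffOn)).continuous)
  have hev : ∀ᶠ ζ in nhds (0 : ℂ), 1 + dz s ζ ≠ 0 ∧ ∀ c, fderiv ℝ s ζ c + c
      = (1 + dz s ζ) * (c + b (0, ζ) / a (0, ζ) * starRingEnd ℂ c) := by
    filter_upwards [cdz.continuousAt.eventually_ne hs0, hse, hμe] with ζ h1 h2 h3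
    refine ⟨h1, fun c => ?_⟩
    rw [fderiv_eq_dz_add_dzbar, h2, h3]
    ring
  obtain ⟨V, hV, hVo, h0V⟩ := mem_nhds_iff.1 hev
  set f : ℝ × ℂ → ℝ × ℂ := fun x => (x.1, x.2 + (s x.2 - s 0)) with hf
  have cf : ContDiff ℝ ∞ f := contDiff_fst.prodMk
    (contDiff_snd.add ((hs.comp contDiff_snd).sub contDiff_const))
  have ff : ∀ x u, fderiv ℝ f x u = (u.1, fderiv ℝ s x.2 u.2 + u.2) := by
    intro x u
    have h1 : HasFDerivAt f ((ContinuousLinearMap.fst ℝ ℝ ℂ).prod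
        (ContinuousLinearMap.snd ℝ ℝ ℂ
          + (fderiv ℝ s x.2).comp (ContinuousLinearMap.snd ℝ ℝ ℂ))) x := by
      have h2 := HasFDerivAt.comp (g := s) x
        ((hs.contDiffAt.differentiableAt (by simp)).hasFDerivAt (x := x.2))
        (hasFDerivAt_snd (p := x))
      exact hasFDerivAt_fst.prodMk (hasFDerivAt_snd.add (h2.sub_const (s 0)))
    rw [h1.fderiv]
    exact Prod.ext rfl (add_comm _ _)
  set U' := Metric.ball (0 : ℝ × ℂ) ρ ∩ Prod.snd ⁻¹' V with hU'
  have hU'o : IsOpen U' := Metric.isOpen_ball.inter (hVo.preimage continuous_snd)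
  have h0' : (0 : ℝ × ℂ) ∈ U' := ⟨Metric.mem_ball_self hρ, h0V⟩
  obtain ⟨e, he0, heU, hef, he, he'⟩ := exists_coordinates hU'o cf.contDiffOn h0' (by
    intro u hu
    rw [ff, Prod.mk_eq_zero] at hu
    have h1 := hu.2
    have h2 : b (0, (0 : ℂ)) = 0 := hb0
    rw [show ((0 : ℝ × ℂ).2) = 0 from rfl, (hV h0V).2, h2] at h1
    have h3 := (mul_eq_zero.1 h1).resolve_left hs0
    exact Prod.ext hu.1 (by simpa using h3))
  refine ⟨e, he0, fun x hx => (hball (heU hx).1).1, he, he', by rw [hef]; simp [hf], ?_⟩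
  have key : ∀ x ∈ e.target, ∃ m : ℂ, ∀ u, (D.pull e.symm).M x u = m * u.2 := by
    intro x hx
    obtain ⟨hy1, hy2⟩ := heU (e.map_target hx)
    obtain ⟨hyU, hya⟩ := hball hy1
    obtain ⟨hn, hfd⟩ := hV hy2
    refine ⟨a (e.symm x) / (1 + dz s (e.symm x).2), fun u => ?_⟩
    have h1 := fderiv_symm_apply he he' hx u
    rw [hef, ff, hfd, ← hq _ hy1] at h1
    have h2 := congrArg Prod.snd h1
    change D.M (e.symm x) (fderiv ℝ e.symm x u) = _
    rw [hMab _ hyU, ← h2]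
    have hya' : a (e.symm x) ≠ 0 := hya
    field_simp
  intro x hx u
  obtain ⟨m, hm⟩ := key x hx
  rw [hm u, hm (0, 1), mul_one]

end Isothermal

/-! ### Solutions on manifolds and null hypersurfaces in spacetimes -/

section Reduction

/-- Solutions of the structure equations with vanishing shear and expansion are locally gauge
equivalent to a normal form. -/
theorem gaugeEquivNormalFormNear_of_solution {N : Type*} [TopologicalSpace N]
    [ChartedSpace (ℝ × ℂ) N] [IsManifold 𝓘(ℝ, ℝ × ℂ) ∞ N] {D : FrameData (ℝ × ℂ) N} {R : ℝ}
    (hD : D.IsNullEinsteinSolutionOn R Set.univ) {κ : N → ℂ}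
    (hκ : ∀ p, D.Γ41 p = κ p • D.K p) (p : N) : GaugeEquivNormalFormNear D R p := by
  obtain ⟨D', hD', hag⟩ := exists_reducedData_of_solution hD hκ p
  have hp := mem_chart_source (ℝ × ℂ) p
  refine GaugeEquivNormalFormNear.of_chart (IsManifold.chart_mem_maximalAtlas p) hp hag ?_
  have ho := (chartAt (ℝ × ℂ) p).open_target
  obtain ⟨e, he0, heU, he, he', he1, hMr, hM0⟩ :=
    exists_flow_box ho ((chartAt (ℝ × ℂ) p).map_source hp) hD'
  refine gaugeEquiv_of_pull_symm he he' he0 ?_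
  rw [he1]
  have h0t : (0 : ℝ × ℂ) ∈ e.target := he1 ▸ e.map_source he0
  have hD1 := hD'.pull_symm ho he he' heU
  obtain ⟨f, hf0, hfU, hf, hf', hf1, hM⟩ :=
    exists_isothermal_coordinates e.open_target h0t hD1 hMr hM0
  refine gaugeEquiv_of_pull_symm hf hf' hf0 ?_
  rw [hf1]
  have h0f : (0 : ℝ × ℂ) ∈ f.target := by
    have := f.map_source hf0
    rwa [hf1] at this
  exact gaugeEquiv_of_isothermal f.open_target h0f
    (hD1.pull_symm e.open_target hf hf' hfU) hM

end Reduction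

section Immersions

variable {E : Type*} [NormedAddCommGroup E] [NormedSpace ℝ E]
variable {N : Type*} [TopologicalSpace N] [ChartedSpace E N]
variable {E' : Type*} [NormedAddCommGroup E'] [NormedSpace ℝ E']
variable {N' : Type*} [TopologicalSpace N'] [ChartedSpace E' N']

/-- In adapted charts an immersion is `x ↦ (x, 0)`, so a local diffeomorphism factors through
it. -/
theorem mfderiv_injective_of_isImmersionAt {f : N → N'} {p : N} {F : Type*}
    [NormedAddCommGroup F] [NormedSpace ℝ F]
    (h : Manifold.IsImmersionAtOfComplement F 𝓘(ℝ, E) 𝓘(ℝ, E') ∞ f p) :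
    Function.Injective (mfderiv 𝓘(ℝ, E) 𝓘(ℝ, E') f p) := by
  have m1 : MDifferentiableAt 𝓘(ℝ, E) 𝓘(ℝ, E') f p := h.contMDiffAt.mdifferentiableAt (by simp)
  have m2 : MDifferentiableAt 𝓘(ℝ, E') 𝓘(ℝ, E') h.codChart (f p) :=
    (contMDiffAt_of_mem_maximalAtlas h.codChart_mem_maximalAtlas
      h.mem_codChart_source).mdifferentiableAt (by simp)
  set P : E' →L[ℝ] E := (ContinuousLinearMap.fst ℝ E F).comp (h.equiv.symm : E' →L[ℝ] E × F)
  have m3 : MDifferentiableAt 𝓘(ℝ, E') 𝓘(ℝ, E) (P ∘ h.codChart) (f p) :=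
    P.differentiable.mdifferentiable.mdifferentiableAt.comp (f p) m2
  have e1 : (P ∘ h.codChart) ∘ f =ᶠ[nhds p] h.domChart := by
    filter_upwards [h.domChart.open_source.mem_nhds h.mem_domChart_source] with y hy
    have h1 := h.writtenInCharts
      ((h.domChart.extend 𝓘(ℝ, E)).map_source (by rwa [h.domChart.extend_source]))
    have h2 : h.codChart (f (h.domChart.symm (h.domChart y))) = h.equiv (h.domChart y, 0) := h1
    rw [h.domChart.left_inv hy] at h2
    change (h.equiv.symm (h.codChart (f y))).1 = h.domChart y
    rw [h2, ContinuousLinearEquiv.symm_apply_apply]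
  have m4 : OpenPartialHomeomorph.MDifferentiable 𝓘(ℝ, E) 𝓘(ℝ, E) h.domChart :=
    ⟨(contMDiffOn_of_mem_maximalAtlas h.domChart_mem_maximalAtlas).mdifferentiableOn (by simp),
      (contMDiffOn_symm_of_mem_maximalAtlas h.domChart_mem_maximalAtlas).mdifferentiableOn
        (by simp)⟩
  have e2 := mfderiv_comp p m3 m1
  rw [e1.mfderiv_eq] at e2
  have e3 := m4.mfderiv_injective h.mem_domChart_source
  rw [e2] at e3
  exact Function.Injective.of_comp e3

end Immersions

section Spacetime

variable {V : Type*} [AddCommGroup V] [Module ℝ V] [TopologicalSpace V]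

theorem zero_smul_add_zero_smul_add (a b c : V →L[ℝ] ℂ) :
    (0 : ℂ) • a + (0 : ℂ) • b + c = c := by
  ext u
  simp

/-! On vectors annihilated by `l`, the pull-back of `L`, the Cartan structure equations of the
spacetime reduce to those of the hypersurface; the `tᵢ` stand for traceless Ricci components. -/

theorem first_structure_M_of_annihilates (a b c m l k : V →L[ℝ] ℂ) {u v : V}
    (hu : l u = 0) (hv : l v = 0) :
    (-(a ⋏ m) - b ⋏ l - c ⋏ k) u v = (-(a ⋏ m) - c ⋏ k) u v := by
  simp [wedge_apply, hu, hv]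

theorem first_structure_L_of_annihilates (a b c m n l : V →L[ℝ] ℂ) {u v : V}
    (hu : l u = 0) (hv : l v = 0) :
    (a ⋏ m + b ⋏ n + c ⋏ l) u v = (a ⋏ m + b ⋏ n) u v := by
  simp [wedge_apply, hu, hv]

theorem second_structure_Γ23_of_annihilates (s g m n l k : V →L[ℝ] ℂ) (a b c : ℂ) {t₁ t₂ t₃ : ℂ}
    (h₁ : t₁ = 0) (h₂ : t₂ = 0) (h₃ : t₃ = 0) {u v : V} (hu : l u = 0) (hv : l v = 0) :
    (s ⋏ g + a • (n ⋏ l) + b • (k ⋏ l - m ⋏ n) + c • (k ⋏ m) + (1 / 2 * t₁) • (m ⋏ l)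
      + (1 / 2 * t₂) • (k ⋏ l + m ⋏ n) + (1 / 2 * t₃) • (k ⋏ n)) u v
      = (s ⋏ g - b • (m ⋏ n) + c • (k ⋏ m)) u v := by
  simp [wedge_apply, hu, hv, h₁, h₂, h₃]
  ring

theorem second_structure_Γ14_of_annihilates (s g m n l k : V →L[ℝ] ℂ) (a b c : ℂ) {t₁ t₂ t₃ : ℂ}
    (h₁ : t₁ = 0) (h₂ : t₂ = 0) (h₃ : t₃ = 0) {u v : V} (hu : l u = 0) (hv : l v = 0) :
    (s ⋏ g + a • (n ⋏ l) - b • (k ⋏ l - m ⋏ n) - c • (k ⋏ m) - (1 / 2 * t₁) • (m ⋏ l)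
      - (1 / 2 * t₂) • (k ⋏ l + m ⋏ n) - (1 / 2 * t₃) • (k ⋏ n)) u v
      = (s ⋏ g + b • (m ⋏ n) - c • (k ⋏ m)) u v := by
  simp [wedge_apply, hu, hv, h₁, h₂, h₃]
  ring

theorem second_structure_Γs_of_annihilates (s g m n l k : V →L[ℝ] ℂ) (a b c : ℂ)
    {t₁ t₂ t₃ t₄ : ℂ} (h₁ : t₁ = 0) (h₂ : t₂ = 0) (h₃ : t₃ = 0) (h₄ : t₄ = 0) {u v : V}
    (hu : l u = 0) (hv : l v = 0) :
    (s ⋏ g - a • (n ⋏ l) - b • (k ⋏ l - m ⋏ n) - c • (k ⋏ m) - (1 / 2 * t₁) • (m ⋏ l)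
      - (1 / 4 * (t₂ + t₃)) • (k ⋏ l + m ⋏ n) - (1 / 2 * t₄) • (k ⋏ n)) u v
      = (s ⋏ g + b • (m ⋏ n) - c • (k ⋏ m)) u v := by
  simp [wedge_apply, hu, hv, h₁, h₂, h₃, h₄]
  ring

theorem SmoothFormAt.neg {E : Type*} [NormedAddCommGroup E] [NormedSpace ℝ E]
    {N : Type*} [TopologicalSpace N] [ChartedSpace E N] {α : OneForm E N} {p : N}
    (h : SmoothFormAt α p) : SmoothFormAt (fun q => -α q) p := by
  have e : chartRep (chartAt E p) (fun q => -α q) = fun x => -chartRep (chartAt E p) α x := by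
    funext x
    exact ContinuousLinearMap.neg_comp _ _
  unfold SmoothFormAt
  rw [e]
  exact ContDiffAt.neg h

variable {N : Type*} [TopologicalSpace N] [ChartedSpace (ℝ × ℂ) N]
variable {Q : Type*} [TopologicalSpace Q] [ChartedSpace (EuclideanSpace ℝ (Fin 4)) Q]

/-- With `ρ = σ = 0` along the hypersurface, `Γ41` pulls back to a multiple of `K`. -/
theorem BulkData.pullback_Γ41 {B : BulkData Q} {ι : N → Q} (hι : B.IsNullHypersurface ι)
    {σ ρ τ κ : Q → ℂ}
    (h : ∀ p, B.Γ41 p = σ p • B.M p + ρ p • B.Mbar p + τ p • B.L p + κ p • B.K p)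
    (hρ : ∀ p, ρ (ι p) = 0) (hσ : ∀ p, σ (ι p) = 0) (p : N) :
    (B.toFrameData.pullback (E := ℝ × ℂ) ι).Γ41 p
      = κ (ι p) • (B.toFrameData.pullback (E := ℝ × ℂ) ι).K p := by
  refine ContinuousLinearMap.ext fun u => ?_
  have hl : B.L (ι p) (mfderiv 𝓘(ℝ, ℝ × ℂ) 𝓘(ℝ, EuclideanSpace ℝ (Fin 4)) ι p u) = 0 :=
    congrArg (fun T : ℝ × ℂ →L[ℝ] ℂ => T u) (hι.2 p)
  have h1 := congrArg (fun T : EuclideanSpace ℝ (Fin 4) →L[ℝ] ℂ =>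
    T (mfderiv 𝓘(ℝ, ℝ × ℂ) 𝓘(ℝ, EuclideanSpace ℝ (Fin 4)) ι p u)) (h (ι p))
  rw [hρ, hσ] at h1
  have gen : ∀ {s t m n l k : ℂ}, l = 0 → 0 * m + 0 * n + t * l + s * k = s * k := by
    rintro s t m n _ k rfl
    ring
  exact h1.trans (gen hl)

variable [IsManifold 𝓘(ℝ, ℝ × ℂ) ∞ N] [IsManifold 𝓘(ℝ, EuclideanSpace ℝ (Fin 4)) ∞ Q]

/-- The pulled-back coframe is nondegenerate because `L` vanishes on the image of `dι`, which is
injective; the pulled-back structure equations lose all terms in `L` and in the traceless Ricci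
tensor. -/
theorem BulkData.isNullEinsteinSolutionOn_pullback {B : BulkData Q} {Λ : ℝ} {ι : N → Q}
    (hB : B.IsSpacetime) (hE : B.IsEinstein Λ) (hι : B.IsNullHypersurface ι) :
    (B.toFrameData.pullback ι).IsNullEinsteinSolutionOn (4 * Λ) (Set.univ : Set N) := by
  obtain ⟨hemb, hL⟩ := hι
  have cι : ContMDiffOn 𝓘(ℝ, ℝ × ℂ) 𝓘(ℝ, EuclideanSpace ℝ (Fin 4)) ∞ ι Set.univ :=
    hemb.contMDiff.contMDiffOn
  obtain ⟨F, iF, iF', hF⟩ := hemb.isImmersion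
  have hinj : ∀ p : N, Function.Injective
      (mfderiv 𝓘(ℝ, ℝ × ℂ) 𝓘(ℝ, EuclideanSpace ℝ (Fin 4)) ι p) := fun p =>
    mfderiv_injective_of_isImmersionAt (hF p)
  have hl : ∀ (p : N) (u : TangentSpace 𝓘(ℝ, ℝ × ℂ) p),
      B.L (ι p) (mfderiv 𝓘(ℝ, ℝ × ℂ) 𝓘(ℝ, EuclideanSpace ℝ (Fin 4)) ι p u) = 0 := fun p u =>
    congrArg (fun T : ℝ × ℂ →L[ℝ] ℂ => T u) (hL p)
  have hs : ∀ α : OneForm (EuclideanSpace ℝ (Fin 4)) Q, SmoothFormOn α Set.univ →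
      SmoothFormOn (E := ℝ × ℂ) (pullForm ι α) (Set.univ : Set N) := fun α hα p hp =>
    SmoothFormAt.pullForm isOpen_univ hp cι (hα (ι p) trivial)
  have hd : ∀ α : OneForm (EuclideanSpace ℝ (Fin 4)) Q, SmoothFormOn α Set.univ →
      ∀ (p : N) (u v : TangentSpace 𝓘(ℝ, ℝ × ℂ) p), extD (E := ℝ × ℂ) (pullForm ι α) p u v
        = extD α (ι p) (mfderiv 𝓘(ℝ, ℝ × ℂ) 𝓘(ℝ, EuclideanSpace ℝ (Fin 4)) ι p u)
          (mfderiv 𝓘(ℝ, ℝ × ℂ) 𝓘(ℝ, EuclideanSpace ℝ (Fin 4)) ι p v) := fun α hα p u v =>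
    extD_pullForm isOpen_univ trivial cι (hα (ι p) trivial) u v
  obtain ⟨sM, sK, s12, s34, s23, s41⟩ := hB.smooth
  have s14 : SmoothFormOn B.Γ14 Set.univ := fun q hq => SmoothFormAt.neg (s41 q hq)
  refine ⟨⟨hs _ sM, hs _ sK, hs _ s12, hs _ s34, hs _ s23, hs _ s41⟩, ?_, ?_, ?_, ?_⟩
  · intro p _
    obtain ⟨h1, h2, h3⟩ := hB.real (ι p) trivial
    have gen : ∀ {a b : EuclideanSpace ℝ (Fin 4) →L[ℝ] ℂ} (T : ℝ × ℂ →L[ℝ] EuclideanSpace ℝ (Fin 4)),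
      conjCov a = b → conjCov (a.comp T) = b.comp T := by
      rintro a _ T rfl
      rfl
    exact ⟨gen _ h1, gen _ h2, gen _ h3⟩
  · intro p _ u h1 h2
    exact hinj p ((hB.nondegenerate (ι p) _ h1 (hl p u) h2).trans (map_zero _).symm)
  · intro p _
    obtain ⟨h1, h2, h3⟩ := hB.first (ι p)
    refine ⟨?_, ?_, ?_⟩
    · funext u v
      exact (hd _ sM p u v).trans ((congrFun (congrFun h1 _) _).trans
        (first_structure_M_of_annihilates _ _ _ _ _ _ (hl p u) (hl p v)))
    · funext u v
      have e0 : extD (E := ℝ × ℂ) (pullForm ι B.L) p u v = 0 := by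
        have h0 : chartRep (chartAt (ℝ × ℂ) p) (pullForm ι B.L) = fun _ => 0 := by
          funext x
          simp only [chartRep, hL]
          exact ContinuousLinearMap.zero_comp _
        rw [extD_eq_curl (by rw [h0]; exact differentiableAt_const _), h0]
        exact curl_const 0 _ _ _
      exact e0.symm.trans ((hd _ hB.smooth_L p u v).trans ((congrFun (congrFun h2 _) _).trans
        (first_structure_L_of_annihilates _ _ _ _ _ _ (hl p u) (hl p v))))
    · funext u v
      exact (hd _ sK p u v).trans (congrFun (congrFun h3 _) _)
  · intro p _
    obtain ⟨h1, h2, h3⟩ := hB.second (ι p)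
    rw [hE.2] at h1 h2 h3
    refine ⟨?_, ?_, ?_⟩
    · funext u v
      exact (hd _ s23 p u v).trans ((congrFun (congrFun h1 _) _).trans
        (second_structure_Γ23_of_annihilates _ _ _ _ _ _ _ _ _ (hE.1 _ _ _) (hE.1 _ _ _)
          (hE.1 _ _ _) (hl p u) (hl p v)))
    · funext u v
      exact (hd _ s14 p u v).trans ((congrFun (congrFun h2 _) _).trans
        (second_structure_Γ14_of_annihilates _ _ _ _ _ _ _ _ _ (hE.1 _ _ _) (hE.1 _ _ _)
          (hE.1 _ _ _) (hl p u) (hl p v)))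
    · funext u v
      have e1 := congrArg₂ (fun a b : ℂ => (1 / 2 : ℂ) * (a + b)) (hd _ s12 p u v) (hd _ s34 p u v)
      exact e1.trans ((congrFun (congrFun h3 _) _).trans
        (second_structure_Γs_of_annihilates _ _ _ _ _ _ _ _ _ (hE.1 _ _ _) (hE.1 _ _ _)
          (hE.1 _ _ _) (hE.1 _ _ _) (hl p u) (hl p v)))

end Spacetime

end NullHyp

end

theorem proposition1
    (N : Type*) [TopologicalSpace N] [ChartedSpace (ℝ × ℂ) N]
    [IsManifold 𝓘(ℝ, ℝ × ℂ) ∞ N]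
    (Q : Type*) [TopologicalSpace Q] [ChartedSpace (EuclideanSpace ℝ (Fin 4)) Q]
    [IsManifold 𝓘(ℝ, EuclideanSpace ℝ (Fin 4)) ∞ Q] :
    -- null hypersurfaces embedded in four-dimensional Einstein spacetimes
    (∀ (B : NullHyp.BulkData Q) (Λ : ℝ) (ι : N → Q) (σ ρ τ κ : Q → ℂ),
      B.IsSpacetime → B.IsEinstein Λ → B.IsNullHypersurface ι →
      (∀ p, B.Γ41 p = σ p • B.M p + ρ p • B.Mbar p + τ p • B.L p + κ p • B.K p) →
      (∀ p, ρ (ι p) = 0) → (∀ p, σ (ι p) = 0) →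
      (B.toFrameData.pullback ι).IsNullEinsteinSolutionOn (4 * Λ) (Set.univ : Set N) ∧
      ∀ p : N, NullHyp.GaugeEquivNormalFormNear (B.toFrameData.pullback ι) (4 * Λ) p) ∧
    -- all solutions of the pulled-back structure equations
    (∀ (D : NullHyp.FrameData (ℝ × ℂ) N) (R : ℝ) (σ ρ κ : N → ℂ),
      D.IsNullEinsteinSolutionOn R Set.univ →
      D.HasOpticalScalarsOn σ ρ κ Set.univ →
      (∀ p, ρ p = 0) → (∀ p, σ p = 0) →
      ∀ p : N, NullHyp.GaugeEquivNormalFormNear D R p) ∧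
    -- the functions in the normal form are arbitrary
    (∀ (R : ℝ) (V : Set ℂ) (w X : ℂ → ℂ) (S : ℂ → ℝ), IsOpen V →
      ContDiffOn ℝ ∞ w V → ContDiffOn ℝ ∞ X V → ContDiffOn ℝ ∞ S V →
      (NullHyp.normalForm R w X S).IsNullEinsteinSolutionOn R (Set.univ ×ˢ V) ∧
      (NullHyp.normalForm R w X S).HasOpticalScalarsOn
        (fun _ => 0) (fun _ => 0) (fun _ => 0) (Set.univ ×ˢ V)) := by
  refine ⟨?_, ?_, ?_⟩
  · intro B Λ ι σ ρ τ κ hB hE hι h41 hρ hσ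
    have h1 := NullHyp.BulkData.isNullEinsteinSolutionOn_pullback hB hE hι
    exact ⟨h1, NullHyp.gaugeEquivNormalFormNear_of_solution h1 (κ := fun p => κ (ι p))
      (NullHyp.BulkData.pullback_Γ41 hι h41 hρ hσ)⟩
  · intro D R σ ρ κ hD h41 hρ hσ p
    refine NullHyp.gaugeEquivNormalFormNear_of_solution hD (κ := κ) (fun q => ?_) p
    rw [h41 q trivial, hρ, hσ]
    exact NullHyp.zero_smul_add_zero_smul_add _ _ _
  · intro R V w X S hV hw hX hS
    have h1 := (NullHyp.isSolutionOn_reducedNormalForm R hV hw hX hS).toFrameData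
      (isOpen_univ.prod hV)
    rw [NullHyp.toFrameData_reducedNormalForm] at h1
    refine ⟨h1, fun x _ => ?_⟩
    rw [← NullHyp.toFrameData_reducedNormalForm]
    have e := NullHyp.zero_smul_add_zero_smul_add (V := ℝ × ℂ)
    refine ((e _ _ _).trans (ContinuousLinearMap.ext fun u : ℝ × ℂ => ?_)).symm
    exact zero_mul _
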